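/- **Theorem 7.** *Setting.* Let $\phi(a,b)$ be a (measurable) real function on $\mathbb{R}^2$ that is convex and three times differentiable in $b$, and write $\phi_k=\partial^k\phi/\partial b^k$, $k=1,2,3$. Let $(X_i,Y_i)$, $i=1,\dots,n$, be i.i.d. copies of $(X_0,Y_0)\in\mathbb{R}^p\times\mathbb{R}$, let $\mathbb{E}|\phi(Y_0,X_0^{T}\beta)|<\infty$ for all $\beta\in\mathbb{R}^p$, let $\bar\beta$ be a minimizer of $\beta\mapsto\mathbb{E}[\phi(Y_0,X_0^{T}\beta)]$ over $\mathbb{R}^p$, and let $s_0=\|\bar\beta\|_0$ be its number of nonzero entries. Put $\Sigma=\mathbb{E}[X_0X_0^{T}]$, $\Omega^*=\Sigma^{-1}$, $H=\mathbb{E}[\phi_2(Y_0,X_0^{T}\bar\beta)X_0X_0^{T}]$, $M^*=H^{-1}$. Fix $0\neq\xi\in\mathbb{R}^p$. Let $J\subset\{1,\dots,n\}$ be a fixed subset with complement $J^c$, $|J|>\rho n$ and $|J^c|>\rho n$, where $0<\rho<1$. Let $\hat M^{J}$ and $\hat M^{J^c}$ be symmetric $p\times p$ matrices computed as measurable functions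 of $(X_i,Y_i)_{i\in J}$ and of $(X_i,Y_i)_{i\in J^c}$ respectively, and let $\hat\beta$ be a random vector in $\mathbb{R}^p$ (an initial estimator of $\bar\beta$, which may depend on the whole sample). Define $$\widehat{\xi^{T}\beta}=\xi^{T}\hat\beta-\xi^{T}\hat M^{J^c}\tfrac1n\sum_{i\in J}X_i\phi_1(Y_i,X_i^{T}\hat\beta)-\xi^{T}\hat M^{J}\tfrac1n\sum_{i\in J^c}X_i\phi_1(Y_i,X_i^{T}\hat\beta),$$ $$\hat V=\tfrac1n\sum_{i\in J}(\xi^{T}\hat M^{J^c}X_i)^2\phi_1^2(Y_i,X_i^{T}\hat\beta)+\tfrac1n\sum_{i\in J^c}(\xi^{T}\hat M^{J}X_i)^2\phi_1^2(Y_i,X_i^{T}\hat\beta),\qquad V=\mathbb{E}[(\xi^{T}M^*X_0)^2\phi_1^2(Y_0,X_0^{T}\bar\beta)],$$ and define $\Delta_1,\Delta_2$ by $$\frac{\widehat{\xi^{T}\beta}-\xi^{T}\bar\beta}{\sqrt V}=-\frac1n\sum_{i=1}^n\frac{(\xi^{T}M^*X_i)\phi_1(Y_i,X_i^{T}\bar\beta)}{\sqrt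 V}+\Delta_1n^{-1/2},\qquad \frac{\hat V}{V}=1+\Delta_2 .$$ Let $Q_1=\xi^{T}(\hat M^{J^c}-M^*)\frac1n\sum_{i\in J}X_iX_i^{T}(\hat M^{J^c}-M^*)\xi$, $Q_1'=\xi^{T}(\hat M^{J}-M^*)\frac1n\sum_{i\in J^c}X_iX_i^{T}(\hat M^{J}-M^*)\xi$, and, for $q=1,2$, $L_q=\|(\hat M^{J}-M^*)\xi\|_q$ and $L_q'=\|(\hat M^{J^c}-M^*)\xi\|_q$. The sub-gaussian norm of a random variable $z$ is $\inf\{t>0:\mathbb{E}\exp(z^2/t^2)\le2\}$ (infinite if there is no such $t$), that of a random vector $Z$ is the supremum over $s\ne0$ of the sub-gaussian norms of $\langle s,Z\rangle/\|s\|_2$. Write $D=p\vee n$. *Assumptions.* Let $C_1,C_3,C_4,C_5,C_6,\sigma_1,\sigma_2>0$ and $C_7\ge0$ be constants such that: (B1) for some number $\delta_1(n)$, with probability at least $1-\delta_1(n)$, both $\|\hat\beta-\bar\beta\|_1\le C_1s_0\sqrt{\log(D)/n}$ and $\frac1n\sum_{i=1}^n(X_i^{T}\hat\beta-X_i^{T}\bar\beta)^2\le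 C_1s_0\log(D)/n$; (E) $\Sigma$ and $H$ are invertible, $C_3\le\lambda_{\min}(\Omega^*)$, $C_3\le\lambda_{\min}(M^*)$, $C_3\le\lambda_{\min}(M^*\Sigma M^*)$ and $\lambda_{\max}(M^*)\le C_4$; (R) $\phi_1(Y_0,X_0^{T}\bar\beta)$ is sub-gaussian with norm at most $\sigma_2$, and $\mathbb{E}[\phi_1^2(Y_0,X_0^{T}\bar\beta)\mid X_0]\ge C_5$ almost surely; (D) almost surely, $\phi_2(Y_0,X_0^{T}\beta)\le C_6$ and $|\phi_3(Y_0,X_0^{T}\beta)|\le C_7$ for all $\beta\in\mathbb{R}^p$. *Conclusion.* Let $c(\tfrac12),c(\tfrac23),c(1)$ be any positive constants. There is a constant $C$, depending only on $(C_1,C_3,C_4,C_5,C_6,\sigma_1,\sigma_2,\rho)$ and on $c(\tfrac12),c(\tfrac23),c(1)$, such that in every such setting the following hold. (i) Suppose that every entry of $X_0$ is sub-gaussian with norm at most $\sigma_1$, that $\xi^{T}M^*X_0$ is sub-gaussian with norm at most $\sigma_1\|M^*\xi\|_2$, and that $\frac{\log D}{\sqrt n}\le\min\{\frac{c(1)\rho\sqrt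 n}{2},\frac{c(2/3)n^{1/6}}{4}\}$. Then with probability at least $1-\delta_1(n)-\frac4n-\frac8D-2\exp\{-c(\tfrac12)n^{1/3}\}-4\exp\{-\tfrac12\sqrt n\}$, both $$|\Delta_1|\le C\Big(s_0\tfrac{\log D}{\sqrt n}+\sqrt{\log D}\,\tfrac{L_1+L_1'}{\|\xi\|_2}+\tfrac{\sqrt{Q_1}+\sqrt{Q_1'}}{\|\xi\|_2}\sqrt{s_0\log D}+C_7s_0\tfrac{\log(D)\sqrt{\log n}}{\sqrt n}\Big)$$ and $$|\Delta_2|\le C\Big(n^{-1/3}+\sqrt{s_0}\sqrt{\tfrac{\log(n)\log D}{n}}+s_0\tfrac{\log(D)\log n}{n}+\tfrac{\sqrt{\log n}(\sqrt{Q_1}+\sqrt{Q_1'})}{\|\xi\|_2}+s_0^2\tfrac{\log(D)\sqrt{\log n}}{n}\tfrac{L_1+L_1'}{\|\xi\|_2}+\tfrac{(Q_1+Q_1')\log n}{\|\xi\|_2^2}+s_0^2\tfrac{\log D}{n}\tfrac{L_1^2+L_1'^2}{\|\xi\|_2^2}\Big).$$ (ii) Suppose that $X_0$ is a sub-gaussian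 random vector with norm at most $\sigma_1$ and that $\frac{\log D}{\sqrt n}\le\min\{c(1)\rho\sqrt n,\frac{c(1)\sqrt n}{2},\frac{c(2/3)n^{1/6}\rho^{2/3}}{3}\}$. Then with probability at least $1-\delta_1(n)-\frac8n-\frac{12}{D}-2\exp\{-c(\tfrac12)n^{1/3}\}-4\exp\{-\tfrac12\sqrt n\}$, both $$|\Delta_1|\le C\Big(s_0\tfrac{\log D}{\sqrt n}+\sqrt{\log D}\,\tfrac{L_2+L_2'}{\|\xi\|_2}+\tfrac{\sqrt{Q_1}+\sqrt{Q_1'}}{\|\xi\|_2}\sqrt{s_0\log D}+C_7s_0\tfrac{\log(D)\sqrt{\log n}}{\sqrt n}\Big)$$ and $$|\Delta_2|\le C\Big(n^{-1/3}+\sqrt{s_0}\sqrt{\tfrac{\log(n)\log D}{n}}+s_0\tfrac{\log(D)\log n}{n}+\tfrac{\sqrt{\log n}(\sqrt{Q_1}+\sqrt{Q_1'})}{\|\xi\|_2}+s_0^2\tfrac{\log(D)\sqrt{\log n}}{n}\tfrac{L_2+L_2'}{\|\xi\|_2}+\tfrac{(Q_1+Q_1')\log n}{\|\xi\|_2^2}+s_0^2\tfrac{\log(D)\sqrt{\log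 n}}{n}\tfrac{L_2^2+L_2'^2}{\|\xi\|_2^2}\Big).$$ -/

import Mathlib

open MeasureTheory ProbabilityTheory Matrix
open scoped ENNReal

noncomputable section

namespace DebiasedGLM

/-- The norm `‖v‖₁ = ∑ⱼ |vⱼ|`. -/
def l1Norm {p : ℕ} (v : Fin p → ℝ) : ℝ := ∑ j, |v j|

/-- The Euclidean norm `‖v‖₂ = √(∑ⱼ vⱼ²)`. -/
def l2Norm {p : ℕ} (v : Fin p → ℝ) : ℝ := Real.sqrt (∑ j, v j ^ 2)

/-- Smallest eigenvalue of a symmetric real matrix. -/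
def lamMin {p : ℕ} (A : Matrix (Fin p) (Fin p) ℝ) : ℝ := sInf (spectrum ℝ A)

/-- Largest eigenvalue of a symmetric real matrix. -/
def lamMax {p : ℕ} (A : Matrix (Fin p) (Fin p) ℝ) : ℝ := sSup (spectrum ℝ A)

/-- Sub-gaussian norm `inf {t > 0 : E exp (z² / t²) ≤ 2}` of a random variable, with values in
`[0, ∞]`: it is `∞` when no such `t` exists. -/
def psi2Norm {Ω : Type*} [MeasurableSpace Ω] (P : Measure Ω) (z : Ω → ℝ) : ℝ≥0∞ :=
  ⨅ (t : ℝ) (_ : 0 < t)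
    (_ : ∫⁻ ω, ENNReal.ofReal (Real.exp (z ω ^ 2 / t ^ 2)) ∂P ≤ 2), ENNReal.ofReal t

/-- Sub-gaussian norm `sup_{s ≠ 0} ‖⟨s, Z⟩ / ‖s‖₂‖` of a random vector. -/
def psi2NormVec {Ω : Type*} [MeasurableSpace Ω] {p : ℕ} (P : Measure Ω)
    (Z : Ω → Fin p → ℝ) : ℝ≥0∞ :=
  ⨆ (s : Fin p → ℝ) (_ : s ≠ 0), psi2Norm P (fun ω => (s ⬝ᵥ Z ω) / l2Norm s)

/-- The possibly misspecified GLM setting with cross-fitting: sample size `n`, dimension `p`. -/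
structure Setting (Ω : Type*) [MeasurableSpace Ω] (P : Measure Ω) (n p : ℕ) where
  /-- the loss `φ(a, b)` -/
  φ : ℝ → ℝ → ℝ
  measurable_φ : Measurable (Function.uncurry φ)
  convex_φ : ∀ a, ConvexOn ℝ Set.univ (φ a)
  /-- `φ(a, b)` is three times differentiable in `b` -/
  differentiable_φ : ∀ a, ∀ k < 3, Differentiable ℝ (iteratedDeriv k (φ a))
  /-- the generic pair `(X₀, Y₀)` -/
  X₀ : Ω → Fin p → ℝ
  Y₀ : Ω → ℝ
  measurable_X₀ : Measurable X₀
  measurable_Y₀ : Measurable Y₀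
  /-- the sample `(Xᵢ, Yᵢ)`, i.i.d. as `(X₀, Y₀)` -/
  X : Fin n → Ω → Fin p → ℝ
  Y : Fin n → Ω → ℝ
  measurable_X : ∀ i, Measurable (X i)
  measurable_Y : ∀ i, Measurable (Y i)
  indep : iIndepFun (fun i ω => (X i ω, Y i ω)) P
  identDistrib : ∀ i, IdentDistrib (fun ω => (X i ω, Y i ω)) (fun ω => (X₀ ω, Y₀ ω)) P P
  /-- the target coefficient vector, a minimizer of `β ↦ E φ(Y₀, X₀ᵀβ)` -/
  βbar : Fin p → ℝ
  integrable_loss : ∀ β : Fin p → ℝ, Integrable (fun ω => φ (Y₀ ω) (X₀ ω ⬝ᵥ β)) P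
  βbar_isMin : ∀ β : Fin p → ℝ,
    ∫ ω, φ (Y₀ ω) (X₀ ω ⬝ᵥ βbar) ∂P ≤ ∫ ω, φ (Y₀ ω) (X₀ ω ⬝ᵥ β) ∂P
  /-- the loading -/
  ξ : Fin p → ℝ
  ξ_ne_zero : ξ ≠ 0
  /-- the initial estimator of `βbar` -/
  βhat : Ω → Fin p → ℝ
  measurable_βhat : Measurable βhat
  /-- the index set of the first subsample -/
  J : Finset (Fin n)
  /-- the symmetric matrix estimator computed from the subsample `J` -/
  estJ : ({i // i ∈ J} → (Fin p → ℝ) × ℝ) → Matrix (Fin p) (Fin p) ℝ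
  measurable_estJ : ∀ j k, Measurable (fun d => estJ d j k)
  symm_estJ : ∀ d, (estJ d).IsSymm
  /-- the symmetric matrix estimator computed from the complementary subsample -/
  estJc : ({i // i ∈ Jᶜ} → (Fin p → ℝ) × ℝ) → Matrix (Fin p) (Fin p) ℝ
  measurable_estJc : ∀ j k, Measurable (fun d => estJc d j k)
  symm_estJc : ∀ d, (estJc d).IsSymm

namespace Setting

variable {Ω : Type*} [MeasurableSpace Ω] {P : Measure Ω} {n p : ℕ} (S : Setting Ω P n p)

/-- `φₖ(a, b)`, the `k`-th partial derivative of `φ(a, b)` in `b`. -/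
def φd (k : ℕ) (a b : ℝ) : ℝ := iteratedDeriv k (S.φ a) b

/-- `s₀ = ‖βbar‖₀`. -/
def s₀ : ℝ := (hammingNorm S.βbar : ℝ)

/-- `log (p ∨ n)`. -/
def logpn (_S : Setting Ω P n p) : ℝ := Real.log ((max p n : ℕ) : ℝ)

/-- `Σ = E[X₀ X₀ᵀ]`. -/
def Sig : Matrix (Fin p) (Fin p) ℝ := Matrix.of fun j k => ∫ ω, S.X₀ ω j * S.X₀ ω k ∂P

/-- `Ω* = Σ⁻¹`. -/
def Omegastar : Matrix (Fin p) (Fin p) ℝ := S.Sig⁻¹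

/-- `H = E[φ₂(Y₀, X₀ᵀβbar) X₀ X₀ᵀ]`. -/
def H : Matrix (Fin p) (Fin p) ℝ :=
  Matrix.of fun j k => ∫ ω, S.φd 2 (S.Y₀ ω) (S.X₀ ω ⬝ᵥ S.βbar) * (S.X₀ ω j * S.X₀ ω k) ∂P

/-- `M* = H⁻¹`. -/
def Mstar : Matrix (Fin p) (Fin p) ℝ := S.H⁻¹

/-- The estimator `M̂ᴶ`, based on `(Xᵢ, Yᵢ)`, `i ∈ J`. -/
def MhatJ (ω : Ω) : Matrix (Fin p) (Fin p) ℝ := S.estJ fun i => (S.X i ω, S.Y i ω)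

/-- The estimator `M̂` based on `(Xᵢ, Yᵢ)`, `i ∈ Jᶜ`. -/
def MhatJc (ω : Ω) : Matrix (Fin p) (Fin p) ℝ := S.estJc fun i => (S.X i ω, S.Y i ω)

/-- The debiased estimator of `ξᵀβbar`. -/
def debiased (ω : Ω) : ℝ :=
  S.ξ ⬝ᵥ S.βhat ω
    - S.ξ ⬝ᵥ (S.MhatJc ω *ᵥ ((1 / (n : ℝ)) •
        ∑ i ∈ S.J, S.φd 1 (S.Y i ω) (S.X i ω ⬝ᵥ S.βhat ω) • S.X i ω))
    - S.ξ ⬝ᵥ (S.MhatJ ω *ᵥ ((1 / (n : ℝ)) •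
        ∑ i ∈ S.Jᶜ, S.φd 1 (S.Y i ω) (S.X i ω ⬝ᵥ S.βhat ω) • S.X i ω))

/-- The variance estimator `V̂`. -/
def Vhat (ω : Ω) : ℝ :=
  1 / (n : ℝ) * ∑ i ∈ S.J, (S.ξ ⬝ᵥ (S.MhatJc ω *ᵥ S.X i ω)) ^ 2
      * S.φd 1 (S.Y i ω) (S.X i ω ⬝ᵥ S.βhat ω) ^ 2
    + 1 / (n : ℝ) * ∑ i ∈ S.Jᶜ, (S.ξ ⬝ᵥ (S.MhatJ ω *ᵥ S.X i ω)) ^ 2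
      * S.φd 1 (S.Y i ω) (S.X i ω ⬝ᵥ S.βhat ω) ^ 2

/-- `V = E[(ξᵀ M* X₀)² φ₁(Y₀, X₀ᵀβbar)²]`. -/
def V : ℝ := ∫ ω, (S.ξ ⬝ᵥ (S.Mstar *ᵥ S.X₀ ω)) ^ 2 * S.φd 1 (S.Y₀ ω) (S.X₀ ω ⬝ᵥ S.βbar) ^ 2 ∂P

/-- `Δ₁`, the scaled remainder of the linear expansion of the debiased estimator:
`(debiased - ξᵀβbar) / √V = - (1/n) ∑ᵢ (ξᵀ M* Xᵢ) φ₁(Yᵢ, Xᵢᵀβbar) / √V + Δ₁ / √n`. -/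
def Δ₁ (ω : Ω) : ℝ :=
  Real.sqrt n * ((S.debiased ω - S.ξ ⬝ᵥ S.βbar) / Real.sqrt S.V
    + 1 / (n : ℝ) * ∑ i, (S.ξ ⬝ᵥ (S.Mstar *ᵥ S.X i ω))
        * S.φd 1 (S.Y i ω) (S.X i ω ⬝ᵥ S.βbar) / Real.sqrt S.V)

/-- `Δ₂ = V̂ / V - 1`. -/
def Δ₂ (ω : Ω) : ℝ := S.Vhat ω / S.V - 1

/-- `Q₁ = ξᵀ (M̂ - M*) (1/n) ∑_{i ∈ J} Xᵢ Xᵢᵀ (M̂ - M*) ξ` with `M̂` computed from `Jᶜ`. -/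
def Q₁ (ω : Ω) : ℝ :=
  S.ξ ⬝ᵥ (((S.MhatJc ω - S.Mstar)
    * (∑ i ∈ S.J, (1 / (n : ℝ)) • vecMulVec (S.X i ω) (S.X i ω))
    * (S.MhatJc ω - S.Mstar)) *ᵥ S.ξ)

/-- `Q₁' = ξᵀ (M̂ᴶ - M*) (1/n) ∑_{i ∈ Jᶜ} Xᵢ Xᵢᵀ (M̂ᴶ - M*) ξ`. -/
def Q₁' (ω : Ω) : ℝ :=
  S.ξ ⬝ᵥ (((S.MhatJ ω - S.Mstar)
    * (∑ i ∈ S.Jᶜ, (1 / (n : ℝ)) • vecMulVec (S.X i ω) (S.X i ω))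
    * (S.MhatJ ω - S.Mstar)) *ᵥ S.ξ)

def L₁ (ω : Ω) : ℝ := l1Norm ((S.MhatJ ω - S.Mstar) *ᵥ S.ξ)
def L₁' (ω : Ω) : ℝ := l1Norm ((S.MhatJc ω - S.Mstar) *ᵥ S.ξ)
def L₂ (ω : Ω) : ℝ := l2Norm ((S.MhatJ ω - S.Mstar) *ᵥ S.ξ)
def L₂' (ω : Ω) : ℝ := l2Norm ((S.MhatJc ω - S.Mstar) *ᵥ S.ξ)

/-- Both subsamples have more than `ρ n` elements. -/
def SplitRatio (ρ : ℝ) : Prop := ρ * n < (S.J.card : ℝ) ∧ ρ * n < (S.Jᶜ.card : ℝ)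

/-- The rate condition on the initial estimator: it holds with probability at least `1 - δ₁`. -/
def InitialRate (C₁ δ₁ : ℝ) : Prop :=
  1 - δ₁ ≤ P.real {ω |
    l1Norm (S.βhat ω - S.βbar) ≤ C₁ * S.s₀ * Real.sqrt (S.logpn / n) ∧
    1 / (n : ℝ) * ∑ i, (S.X i ω ⬝ᵥ S.βhat ω - S.X i ω ⬝ᵥ S.βbar) ^ 2 ≤ C₁ * S.s₀ * (S.logpn / n)}

/-- Entrywise sub-gaussian covariates, together with sub-gaussianity of `ξᵀ M* X₀`. -/
def SubGaussianEntries (σ₁ : ℝ) : Prop :=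
  (∀ j, psi2Norm P (fun ω => S.X₀ ω j) ≤ ENNReal.ofReal σ₁) ∧
  psi2Norm P (fun ω => S.ξ ⬝ᵥ (S.Mstar *ᵥ S.X₀ ω)) ≤
    ENNReal.ofReal (σ₁ * l2Norm (S.Mstar *ᵥ S.ξ))

/-- Sub-gaussian covariate vector. -/
def SubGaussianVector (σ₁ : ℝ) : Prop := psi2NormVec P S.X₀ ≤ ENNReal.ofReal σ₁

/-- The eigenvalue assumption on `Ω*`, `M*` and `M* Σ M*`. -/
def EigenvalueBounds (C₃ C₄ : ℝ) : Prop :=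
  (C₃ ≤ lamMin S.Omegastar ∧ C₃ ≤ lamMin S.Mstar ∧ C₃ ≤ lamMin (S.Mstar * S.Sig * S.Mstar)) ∧
  lamMax S.Mstar ≤ C₄

/-- `φ₁(Y₀, X₀ᵀβbar)` is sub-gaussian, with conditional second moment given `X₀` bounded below. -/
def ScoreAssumption (C₅ σ₂ : ℝ) : Prop :=
  psi2Norm P (fun ω => S.φd 1 (S.Y₀ ω) (S.X₀ ω ⬝ᵥ S.βbar)) ≤ ENNReal.ofReal σ₂ ∧
  ∀ᵐ ω ∂P, C₅ ≤ (P[fun ω' => S.φd 1 (S.Y₀ ω') (S.X₀ ω' ⬝ᵥ S.βbar) ^ 2 |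
    MeasurableSpace.comap S.X₀ inferInstance]) ω

/-- Almost surely, `φ₂(Y₀, X₀ᵀβ) ≤ C₆` and `|φ₃(Y₀, X₀ᵀβ)| ≤ C₇` for all `β`. -/
def BoundedDerivatives (C₆ C₇ : ℝ) : Prop :=
  ∀ᵐ ω ∂P, ∀ β : Fin p → ℝ,
    S.φd 2 (S.Y₀ ω) (S.X₀ ω ⬝ᵥ β) ≤ C₆ ∧ |S.φd 3 (S.Y₀ ω) (S.X₀ ω ⬝ᵥ β)| ≤ C₇

end Setting

end DebiasedGLM

end

open DebiasedGLM

/-!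
# Debiased estimation of a linear functional in a misspecified GLM

Both parts follow from one statement, in which a norm `N` stands for the `ℓ₁` norm (entrywise
sub-Gaussian covariates) or the `ℓ₂` norm (sub-Gaussian covariate vector). All that is used about
`N` is that `vᵀX₀` is sub-Gaussian at scale `K N(v)` for every fixed `v` (`SubGaussianDesign`); for
the `ℓ₁` norm this is Jensen's inequality.

Write `aᵢ = ξᵀM*Xᵢ`, `εᵢ` for the score at `βbar`, `δᵢ` for the error of the weight of observation
`i`, `h = βhat - βbar`, and `eᵢ` for the change of the score from `βbar` to `βhat`, so that
`|eᵢ| ≤ C₆ |hᵀXᵢ|`. Since `ξ = H M* ξ`, the linearization error of the debiased estimator splits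
into `∑ δᵢ εᵢ`, `∑ δᵢ eᵢ`, the inner product of `h` with the deviation of the empirical Hessian in
direction `M*ξ`, and a second-order Taylor term. The error of the variance estimator is the
deviation of `∑ aᵢ² εᵢ²` plus the effect of replacing `aᵢ` by `aᵢ + δᵢ` and `εᵢ` by `εᵢ + eᵢ`, in
which the only delicate sum is `∑ δᵢ² (hᵀXᵢ)² ≤ ‖h‖₁² maxⱼ ∑ δᵢ² Xᵢⱼ²`.

The probabilistic content is that `GoodEvent` fails with probability at most `δ₁ + 4/n`:

* `bernstein` bounds the centred sums of products of two sub-Gaussian variables. The scores are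
  centred by the first-order condition `integral_dotProduct_mul_score_eq_zero`.
* By cross-fitting the direction entering `δᵢ` is independent of the observations it multiplies, so
  it can be frozen (`IndepFun.measureReal_le_of_forall`). Along a fixed direction `δᵢ` is
  `O(N √(log n))`, which leaves `δᵢ² Xᵢⱼ²` with exponential moments at scale `log n`; this makes the
  maximum over `j` affordable for `log p` up to the order `n^(2/3)`.
* `measureReal_sum_sq_mul_sq_deviation_le` gives the `n^(-1/3)` rate for `∑ aᵢ² εᵢ²`.

On `GoodEvent` the bounds are deterministic (`GoodEvent.abs_Δ₁_le`, `GoodEvent.abs_Δ₂_le`), with the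
variance bounded below by `C₃ C₅ ‖ξ‖₂²` (`le_V`).
-/

namespace DebiasedGLM

/-! ### Sub-Gaussian random variables -/

/-- `z` is sub-Gaussian at scale `K`: `E exp((z/K)²) ≤ 2`, stated for the Bochner integral together
with the integrability it presupposes. -/
structure SubG {Ω : Type*} [MeasurableSpace Ω] (P : Measure Ω) (z : Ω → ℝ) (K : ℝ) : Prop where
  pos : 0 < K
  meas : Measurable z
  integrable : Integrable (fun ω => Real.exp ((z ω / K) ^ 2)) P
  integral_le : ∫ ω, Real.exp ((z ω / K) ^ 2) ∂P ≤ 2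

section SubG

variable {Ω : Type*} [MeasurableSpace Ω] {P : Measure Ω}

lemma subG_of_lintegral_le {z : Ω → ℝ} {K : ℝ} (hK : 0 < K) (hz : Measurable z)
    (h : ∫⁻ ω, ENNReal.ofReal (Real.exp ((z ω / K) ^ 2)) ∂P ≤ 2) : SubG P z K := by
  have hm : Measurable fun ω => Real.exp ((z ω / K) ^ 2) := by fun_prop
  refine ⟨hK, hz, ⟨hm.aestronglyMeasurable, ?_⟩, ?_⟩
  · rw [hasFiniteIntegral_iff_ofReal (Filter.Eventually.of_forall fun ω => (Real.exp_pos _).le)]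
    exact h.trans_lt (by norm_num)
  · rw [integral_eq_lintegral_of_nonneg_ae (Filter.Eventually.of_forall fun ω => (Real.exp_pos _).le)
      hm.aestronglyMeasurable]
    exact ENNReal.toReal_le_of_le_ofReal (by norm_num) (by simpa using h)

/-- The infimum defining `psi2Norm` need not be known to be attained, so the scale is doubled. -/
lemma subG_of_psi2Norm_le {z : Ω → ℝ} {σ : ℝ} (hσ : 0 < σ) (hz : Measurable z)
    (h : psi2Norm P z ≤ ENNReal.ofReal σ) : SubG P z (2 * σ) := by
  have h2 : psi2Norm P z < ENNReal.ofReal (2 * σ) :=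
    h.trans_lt ((ENNReal.ofReal_lt_ofReal_iff (by positivity)).2 (by linarith))
  unfold psi2Norm at h2
  simp only [iInf_lt_iff] at h2
  obtain ⟨t, ht, hle, hlt⟩ := h2
  have hlt' : t < 2 * σ := (ENNReal.ofReal_lt_ofReal_iff (by positivity)).1 hlt
  refine subG_of_lintegral_le (by positivity) hz (le_trans (lintegral_mono fun ω => ?_) hle)
  apply ENNReal.ofReal_le_ofReal
  rw [Real.exp_le_exp, div_pow]
  gcongr

lemma SubG.mono {z : Ω → ℝ} {K K' : ℝ} (h : SubG P z K) (hK : K ≤ K') : SubG P z K' := by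
  have h0 := h.pos
  have hm := h.meas
  have hle : ∀ ω, Real.exp ((z ω / K') ^ 2) ≤ Real.exp ((z ω / K) ^ 2) := fun ω => by
    rw [Real.exp_le_exp, div_pow, div_pow]; gcongr
  have hi : Integrable (fun ω => Real.exp ((z ω / K') ^ 2)) P :=
    h.integrable.mono' (by fun_prop) (Filter.Eventually.of_forall fun ω => by
      rw [Real.norm_eq_abs, abs_of_pos (Real.exp_pos _)]; exact hle ω)
  exact ⟨h0.trans_le hK, hm, hi, (integral_mono hi h.integrable hle).trans h.integral_le⟩

/-- Scaling: if `w = c z` with `c > 0` then `w` has scale `c K`. -/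
lemma SubG.const_mul {z : Ω → ℝ} {K : ℝ} (h : SubG P z K) {c : ℝ} (hc : 0 < c) :
    SubG P (fun ω => c * z ω) (c * K) := by
  have h0 := h.pos
  have e : (fun ω => Real.exp ((c * z ω / (c * K)) ^ 2)) = fun ω => Real.exp ((z ω / K) ^ 2) := by
    funext ω; rw [mul_div_mul_left _ _ hc.ne']
  exact ⟨by positivity, by have := h.meas; fun_prop, by rw [e]; exact h.integrable,
    by rw [e]; exact h.integral_le⟩

/-- Anything dominated by the exponential squares of two sub-Gaussian variables is integrable. -/
lemma SubG.integral_le_of_abs_le {x y : Ω → ℝ} {K K' : ℝ} (hx : SubG P x K) (hy : SubG P y K')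
    {f : Ω → ℝ} (hf : Measurable f) {a b : ℝ} (ha : 0 ≤ a) (hb : 0 ≤ b)
    (h : ∀ ω, |f ω| ≤ a * Real.exp ((x ω / K) ^ 2) + b * Real.exp ((y ω / K') ^ 2)) :
    Integrable f P ∧ ∫ ω, f ω ∂P ≤ 2 * (a + b) := by
  have hi := (hx.integrable.const_mul a).add (hy.integrable.const_mul b)
  have hfi : Integrable f P := hi.mono' hf.aestronglyMeasurable (Filter.Eventually.of_forall h)
  refine ⟨hfi, (integral_mono hfi hi fun ω => (le_abs_self _).trans (h ω)).trans ?_⟩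
  simp only [Pi.add_apply]
  rw [integral_add (hx.integrable.const_mul a) (hy.integrable.const_mul b), integral_const_mul,
    integral_const_mul]
  nlinarith [hx.integral_le, hy.integral_le]

lemma sq_le_exp_sq (x : ℝ) : x ^ 2 ≤ Real.exp (x ^ 2) := by
  have := Real.add_one_le_exp (x ^ 2); linarith

lemma pow_four_le_exp_sq (x : ℝ) : x ^ 4 ≤ 2 * Real.exp (x ^ 2) := by
  have := Real.pow_div_factorial_le_exp (x := x ^ 2) (by positivity) 2
  norm_num [Nat.factorial] at this
  nlinarith

lemma pow_eight_le_exp_sq (x : ℝ) : x ^ 8 ≤ 24 * Real.exp (x ^ 2) := by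
  have := Real.pow_div_factorial_le_exp (x := x ^ 2) (by positivity) 4
  norm_num [Nat.factorial] at this
  nlinarith

lemma sq_le_exp_half_abs (z : ℝ) : z ^ 2 ≤ 8 * Real.exp (|z| / 2) := by
  have := Real.pow_div_factorial_le_exp (x := |z| / 2) (by positivity) 2
  norm_num [Nat.factorial, div_pow, sq_abs] at this
  nlinarith

lemma exp_le_one_add_add_sq_mul_exp {x B : ℝ} (hB : 0 ≤ B) (h : x ≤ B) :
    Real.exp x ≤ 1 + x + x ^ 2 * Real.exp B := by
  have h1 : 1 ≤ Real.exp B := Real.one_le_exp hB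
  rcases le_or_gt |x| 1 with hx | hx
  · have := Real.norm_exp_sub_one_sub_id_le (x := x) hx
    rw [Real.norm_eq_abs, Real.norm_eq_abs, sq_abs] at this
    have := (abs_le.1 this).2
    nlinarith [sq_nonneg x]
  · rcases lt_or_ge x 0 with h0 | h0
    · rw [abs_of_neg h0] at hx
      have : Real.exp x ≤ 1 := by
        have := Real.exp_le_exp.2 h0.le; simpa using this
      nlinarith [sq_nonneg x]
    · rw [abs_of_nonneg h0] at hx
      have h2 : Real.exp x ≤ Real.exp B := Real.exp_le_exp.2 h
      have h3 : Real.exp B ≤ x ^ 2 * Real.exp B :=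
        le_mul_of_one_le_left (Real.exp_pos _).le (by nlinarith)
      linarith

/-- The product of two sub-Gaussian variables has an exponential moment. -/
lemma SubG.exp_mul_le {x y w : Ω → ℝ} {K K' c : ℝ} (hx : SubG P x K) (hy : SubG P y K')
    (hw : Measurable w) (hc : 0 < c) (h : ∀ᵐ ω ∂P, |w ω| ≤ c * |x ω * y ω|) :
    Integrable (fun ω => Real.exp (|w ω| / (c * (K * K')))) P ∧
      ∫ ω, Real.exp (|w ω| / (c * (K * K'))) ∂P ≤ 2 := by
  have h0 := hx.pos
  have h0' := hy.pos
  have hi := (hx.integrable.const_mul (1 / 2)).add (hy.integrable.const_mul (1 / 2))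
  have hle : ∀ᵐ ω ∂P, Real.exp (|w ω| / (c * (K * K'))) ≤
      (1 / 2) * Real.exp ((x ω / K) ^ 2) + (1 / 2) * Real.exp ((y ω / K') ^ 2) := by
    filter_upwards [h] with ω hω
    have h1 : |w ω| / (c * (K * K')) ≤ (1 / 2) * (x ω / K) ^ 2 + (1 / 2) * (y ω / K') ^ 2 := by
      have e : c * |x ω * y ω| / (c * (K * K')) = |x ω / K| * |y ω / K'| := by
        rw [abs_div, abs_div, abs_of_pos h0, abs_of_pos h0', abs_mul]; field_simp
      calc _ ≤ c * |x ω * y ω| / (c * (K * K')) := by gcongr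
        _ = |x ω / K| * |y ω / K'| := e
        _ ≤ _ := by
          nlinarith [sq_nonneg (|x ω / K| - |y ω / K'|), sq_abs (x ω / K), sq_abs (y ω / K')]
    refine (Real.exp_le_exp.2 h1).trans ?_
    have := convexOn_exp.2 (Set.mem_univ ((x ω / K) ^ 2)) (Set.mem_univ ((y ω / K') ^ 2))
      (show (0 : ℝ) ≤ 1 / 2 by norm_num) (show (0 : ℝ) ≤ 1 / 2 by norm_num) (by norm_num)
    simpa [smul_eq_mul] using this
  have hwi : Integrable (fun ω => Real.exp (|w ω| / (c * (K * K')))) P :=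
    hi.mono' (by fun_prop) (by
      filter_upwards [hle] with ω hω
      rw [Real.norm_eq_abs, abs_of_pos (Real.exp_pos _)]; exact hω)
  refine ⟨hwi, (integral_mono_ae hwi hi hle).trans ?_⟩
  simp only [Pi.add_apply]
  rw [integral_add (hx.integrable.const_mul _) (hy.integrable.const_mul _), integral_const_mul,
    integral_const_mul]
  linarith [hx.integral_le, hy.integral_le]

lemma SubG.integrable_mul {x y : Ω → ℝ} {K K' : ℝ}
    (hx : SubG P x K) (hy : SubG P y K') : Integrable (fun ω => x ω * y ω) P := by
  have mx := hx.meas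
  have my := hy.meas
  have h0 := hx.pos
  have h0' := hy.pos
  refine (hx.integral_le_of_abs_le hy (f := fun ω => x ω * y ω) (by fun_prop) (a := K * K')
    (b := K * K') (by positivity) (by positivity) fun ω => ?_).1
  have e : |x ω * y ω| = K * K' * (|x ω / K| * |y ω / K'|) := by
    rw [abs_div, abs_div, abs_of_pos h0, abs_of_pos h0', abs_mul]; field_simp
  rw [e, ← mul_add]
  gcongr
  have h1 := sq_le_exp_sq (x ω / K)
  have h2 := sq_le_exp_sq (y ω / K')
  have h3 := sq_nonneg (|x ω / K| - |y ω / K'|)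
  rw [sub_sq, sq_abs, sq_abs] at h3
  nlinarith [abs_nonneg (x ω / K), abs_nonneg (y ω / K'), sq_nonneg (x ω / K), sq_nonneg (y ω / K')]

lemma SubG.integrable_sq {x : Ω → ℝ} {K : ℝ}
    (hx : SubG P x K) : Integrable (fun ω => x ω ^ 2) P := by
  simpa only [sq] using hx.integrable_mul hx

end SubG

/-! ### Concentration for an i.i.d. sample -/

section Chernoff

variable {Ω E : Type*} [MeasurableSpace Ω] [MeasurableSpace E] {P : Measure Ω}
  [IsProbabilityMeasure P]

/-- A one-sided moment generating function bound with a quadratic remainder, for variables with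
`t w ≤ B`. -/
lemma integral_exp_mul_le_of_le {w : Ω → ℝ} (hw : Measurable w) (hi : Integrable w P)
    (hi2 : Integrable (fun ω => w ω ^ 2) P) {t B s : ℝ} (hB : 0 ≤ B)
    (hs : ∫ ω, w ω ^ 2 ∂P ≤ s) (hb : ∀ ω, t * w ω ≤ B) :
    Integrable (fun ω => Real.exp (t * w ω)) P ∧
      ∫ ω, Real.exp (t * w ω) ∂P ≤ Real.exp (t * ∫ ω, w ω ∂P + t ^ 2 * s * Real.exp B) := by
  have hie : Integrable (fun ω => Real.exp (t * w ω)) P :=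
    (integrable_const (Real.exp B)).mono' (by fun_prop) (Filter.Eventually.of_forall fun ω => by
      rw [Real.norm_eq_abs, abs_of_pos (Real.exp_pos _)]; exact Real.exp_le_exp.2 (hb ω))
  refine ⟨hie, ?_⟩
  have hi1 : Integrable (fun ω => 1 + t * w ω) P := (integrable_const _).add (hi.const_mul t)
  have hi3 : Integrable (fun ω => t ^ 2 * Real.exp B * w ω ^ 2) P := hi2.const_mul _
  calc ∫ ω, Real.exp (t * w ω) ∂P
      ≤ ∫ ω, ((1 + t * w ω) + t ^ 2 * Real.exp B * w ω ^ 2) ∂P :=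
        integral_mono hie (hi1.add hi3) fun ω =>
          (exp_le_one_add_add_sq_mul_exp hB (hb ω)).trans (le_of_eq (by ring))
    _ = 1 + t * ∫ ω, w ω ∂P + t ^ 2 * Real.exp B * ∫ ω, w ω ^ 2 ∂P := by
        rw [integral_add hi1 hi3, integral_add (integrable_const _) (hi.const_mul t),
          integral_const_mul, integral_const_mul]
        simp
    _ ≤ (t * ∫ ω, w ω ∂P + t ^ 2 * s * Real.exp B) + 1 := by
        have : t ^ 2 * Real.exp B * ∫ ω, w ω ^ 2 ∂P ≤ t ^ 2 * Real.exp B * s := by gcongr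
        linarith
    _ ≤ _ := Real.add_one_le_exp _

/-- Bernstein's moment generating function bound for sub-exponential variables. -/
lemma integral_exp_mul_sub_le {w : Ω → ℝ} (hw : Measurable w) {K t : ℝ} (hK : 0 < K)
    (hi : Integrable (fun ω => Real.exp (|w ω| / K)) P)
    (h2 : ∫ ω, Real.exp (|w ω| / K) ∂P ≤ 2) (ht : |t| * (2 * K) ≤ 1) :
    Integrable (fun ω => Real.exp (t * (w ω - ∫ ω', w ω' ∂P))) P ∧
      ∫ ω, Real.exp (t * (w ω - ∫ ω', w ω' ∂P)) ∂P ≤ Real.exp (16 * t ^ 2 * K ^ 2) := by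
  set m := ∫ ω', w ω' ∂P with hm
  have hwi : Integrable w P := by
    refine (hi.const_mul K).mono' hw.aestronglyMeasurable (Filter.Eventually.of_forall fun ω => ?_)
    rw [Real.norm_eq_abs]
    have := Real.add_one_le_exp (|w ω| / K)
    have h3 : |w ω| = K * (|w ω| / K) := by field_simp
    nlinarith
  have hb : ∀ ω, |t * w ω| ≤ |w ω| / K / 2 := fun ω => by
    rw [abs_mul, div_div, le_div_iff₀ (by positivity)]
    nlinarith [abs_nonneg (w ω)]
  have hpt : ∀ ω, Real.exp (t * w ω) ≤ (1 + t * w ω) + 8 * t ^ 2 * K ^ 2 * Real.exp (|w ω| / K) := by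
    intro ω
    have h1 := exp_le_one_add_add_sq_mul_exp (x := t * w ω) (B := |w ω| / K / 2)
      (by positivity) ((le_abs_self _).trans (hb ω))
    have h3 : (w ω) ^ 2 ≤ 8 * K ^ 2 * Real.exp (|w ω| / K / 2) := by
      have := sq_le_exp_half_abs (w ω / K)
      rw [abs_div, abs_of_pos hK, div_pow, div_le_iff₀ (by positivity)] at this
      linarith
    have h4 : Real.exp (|w ω| / K) = Real.exp (|w ω| / K / 2) * Real.exp (|w ω| / K / 2) := by
      rw [← Real.exp_add]; ring_nf
    rw [h4]
    have h5 : (t * w ω) ^ 2 * Real.exp (|w ω| / K / 2) ≤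
        t ^ 2 * (8 * K ^ 2 * Real.exp (|w ω| / K / 2)) * Real.exp (|w ω| / K / 2) := by
      rw [mul_pow]; gcongr
    linarith
  have hie : Integrable (fun ω => Real.exp (t * w ω)) P := by
    refine hi.mono' (by fun_prop) (Filter.Eventually.of_forall fun ω => ?_)
    rw [Real.norm_eq_abs, abs_of_pos (Real.exp_pos _), Real.exp_le_exp]
    have h3 : 0 ≤ |w ω| / K := by positivity
    linarith [le_abs_self (t * w ω), hb ω]
  have hi1 : Integrable (fun ω => 1 + t * w ω) P := (integrable_const _).add (hwi.const_mul t)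
  have e : (fun ω => Real.exp (t * (w ω - m))) = fun ω => Real.exp (-(t * m)) * Real.exp (t * w ω) := by
    funext ω; rw [← Real.exp_add]; ring_nf
  rw [e]
  refine ⟨hie.const_mul _, ?_⟩
  rw [integral_const_mul]
  have h6 : ∫ ω, Real.exp (t * w ω) ∂P ≤ Real.exp (t * m + 16 * t ^ 2 * K ^ 2) := by
    calc ∫ ω, Real.exp (t * w ω) ∂P
        ≤ ∫ ω, ((1 + t * w ω) + 8 * t ^ 2 * K ^ 2 * Real.exp (|w ω| / K)) ∂P :=
          integral_mono hie (hi1.add (hi.const_mul _)) hpt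
      _ = 1 + t * m + 8 * t ^ 2 * K ^ 2 * ∫ ω, Real.exp (|w ω| / K) ∂P := by
          rw [integral_add hi1 (hi.const_mul _), integral_add (integrable_const _) (hwi.const_mul t),
            integral_const_mul, integral_const_mul]
          simp [hm]
      _ ≤ (t * m + 16 * t ^ 2 * K ^ 2) + 1 := by
          have : 8 * t ^ 2 * K ^ 2 * ∫ ω, Real.exp (|w ω| / K) ∂P ≤ 8 * t ^ 2 * K ^ 2 * 2 := by gcongr
          linarith
      _ ≤ _ := Real.add_one_le_exp _
  calc _ ≤ Real.exp (-(t * m)) * Real.exp (t * m + 16 * t ^ 2 * K ^ 2) := by gcongr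
    _ = _ := by rw [← Real.exp_add]; ring_nf

variable {n : ℕ} {Z : Fin n → Ω → E} {Z₀ : Ω → E}

lemma measureReal_sum_ge_le (hZ : ∀ i, Measurable (Z i)) (hind : iIndepFun Z P)
    (hid : ∀ i, IdentDistrib (Z i) Z₀ P P) (s : Finset (Fin n)) {f : E → ℝ} (hf : Measurable f)
    {t b : ℝ} (ht : 0 ≤ t) (hi : Integrable (fun ω => Real.exp (t * f (Z₀ ω))) P)
    (hb : ∫ ω, Real.exp (t * f (Z₀ ω)) ∂P ≤ Real.exp b) (T : ℝ) :
    P.real {ω | T ≤ ∑ i ∈ s, f (Z i ω)} ≤ Real.exp (s.card * b - t * T) := by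
  have hid' : ∀ i, IdentDistrib (fun ω => Real.exp (t * f (Z i ω)))
      (fun ω => Real.exp (t * f (Z₀ ω))) P P := fun i =>
    (hid i).comp (u := fun z => Real.exp (t * f z)) (by fun_prop)
  have hm : ∀ i, Measurable (fun ω => f (Z i ω)) := fun i => hf.comp (hZ i)
  have hind' : iIndepFun (fun i ω => f (Z i ω)) P := hind.comp (fun _ => f) fun _ => hf
  have hint := hind'.integrable_exp_mul_sum (t := t) hm (s := s)
    (fun i _ => (hid' i).integrable_iff.2 hi)
  have h1 := measure_ge_le_exp_mul_mgf (X := ∑ i ∈ s, fun ω => f (Z i ω)) T ht hint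
  rw [hind'.mgf_sum hm s] at h1
  have h2 : ∏ i ∈ s, mgf (fun ω => f (Z i ω)) P t ≤ Real.exp (s.card * b) := by
    rw [Real.exp_nat_mul, ← Finset.prod_const]
    refine Finset.prod_le_prod (fun i _ => mgf_nonneg) fun i _ => ?_
    rw [mgf, (hid' i).integral_eq]
    exact hb
  calc P.real {ω | T ≤ ∑ i ∈ s, f (Z i ω)}
      = P.real {ω | T ≤ (∑ i ∈ s, fun ω => f (Z i ω)) ω} := by simp only [Finset.sum_apply]
    _ ≤ _ := h1
    _ ≤ Real.exp (-t * T) * Real.exp (s.card * b) := by gcongr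
    _ = _ := by rw [← Real.exp_add]; ring_nf

/-- Two-sided Bernstein inequality for a partial sum, in the regime `l ≤ c n` in which the tail is
sub-Gaussian: the deviation is of order `√(n l)` with failure probability `2 exp(-4 l)`. -/
lemma bernstein (hZ : ∀ i, Measurable (Z i)) (hind : iIndepFun Z P)
    (hid : ∀ i, IdentDistrib (Z i) Z₀ P P) (hZ₀ : Measurable Z₀) (s : Finset (Fin n)) {f : E → ℝ}
    (hf : Measurable f) {K c l : ℝ} (hK : 0 < K) (hc : 0 < c) (hn : 0 < n) (hl : 0 ≤ l)
    (hlc : l ≤ c * n) (hi : Integrable (fun ω => Real.exp (|f (Z₀ ω)| / K)) P)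
    (h2 : ∫ ω, Real.exp (|f (Z₀ ω)| / K) ∂P ≤ 2) :
    P.real {ω | (8 * √c + 8 / √c) * K * √(n * l) ≤
      |∑ i ∈ s, (f (Z i ω) - ∫ ω', f (Z₀ ω') ∂P)|} ≤ 2 * Real.exp (-(4 * l)) := by
  set m := ∫ ω', f (Z₀ ω') ∂P with hm
  set T := (8 * √c + 8 / √c) * K * √(n * l) with hT
  have hn' : (0 : ℝ) < n := by exact_mod_cast hn
  have hsc : 0 < √c := Real.sqrt_pos.2 hc
  -- The Chernoff parameter, at most `1 / (2 K)` because `l ≤ c n`.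
  set t := √l / (2 * K * √c * √n) with ht
  have hsn : 0 < √(n : ℝ) := Real.sqrt_pos.2 hn'
  have ht0 : 0 ≤ t := by positivity
  have hsl : √l ≤ √c * √n := by
    rw [← Real.sqrt_mul hc.le]; exact Real.sqrt_le_sqrt hlc
  have htK : t * (2 * K) ≤ 1 := by
    have : t * (2 * K) = √l / (√c * √n) := by rw [ht]; field_simp
    rw [this, div_le_one (by positivity)]; exact hsl
  have hcard : (s.card : ℝ) ≤ n := by
    have := s.card_le_univ; rw [Fintype.card_fin] at this; exact_mod_cast this
  have hexp : (s.card : ℝ) * (16 * t ^ 2 * K ^ 2) - t * T ≤ -(4 * l) := by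
    have e1 : (n : ℝ) * (16 * t ^ 2 * K ^ 2) = 4 * l / c := by
      rw [ht, div_pow, mul_pow, mul_pow, mul_pow, Real.sq_sqrt hl, Real.sq_sqrt hc.le,
        Real.sq_sqrt hn'.le]
      field_simp; ring
    have e2 : t * T = 4 * l + 4 * l / c := by
      rw [ht, hT, Real.sqrt_mul hn'.le]
      have h3 := Real.mul_self_sqrt hl
      have h4 := Real.mul_self_sqrt hc.le
      have : 4 * l + 4 * l / c = (√l * √l) * (4 + 4 / (√c * √c)) := by rw [h3, h4]; ring
      rw [this]
      field_simp
      ring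
    have : (s.card : ℝ) * (16 * t ^ 2 * K ^ 2) ≤ n * (16 * t ^ 2 * K ^ 2) := by gcongr
    linarith
  have hfm : Measurable fun z => f z - m := by fun_prop
  obtain ⟨i1, b1⟩ := integral_exp_mul_sub_le (t := t) (hf.comp hZ₀) hK hi h2
    (by rw [abs_of_nonneg ht0]; exact htK)
  obtain ⟨i2, b2⟩ := integral_exp_mul_sub_le (t := -t) (hf.comp hZ₀) hK hi h2
    (by rw [abs_neg, abs_of_nonneg ht0]; exact htK)
  have u1 := measureReal_sum_ge_le hZ hind hid s (f := fun z => f z - m) hfm ht0 i1 b1 T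
  have u2 := measureReal_sum_ge_le hZ hind hid s (f := fun z => -(f z - m)) hfm.neg ht0
    (b := 16 * t ^ 2 * K ^ 2)
    (by refine i2.congr (Filter.Eventually.of_forall fun ω => ?_)
        simp only [Function.comp]; congr 1; ring)
    (by refine le_trans (le_of_eq (integral_congr_ae (Filter.Eventually.of_forall fun ω => ?_)))
          (b2.trans (le_of_eq (by ring_nf)))
        simp only [Function.comp]; congr 1; ring) T
  have hsub : {ω | T ≤ |∑ i ∈ s, (f (Z i ω) - m)|} ⊆
      {ω | T ≤ ∑ i ∈ s, (f (Z i ω) - m)} ∪ {ω | T ≤ ∑ i ∈ s, -(f (Z i ω) - m)} := by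
    intro ω hω
    simp only [Set.mem_ofPred_eq, Set.mem_union, Finset.sum_neg_distrib] at hω ⊢
    exact le_abs.1 hω
  have h3 := Real.exp_le_exp.2 hexp
  calc _ ≤ P.real ({ω | T ≤ ∑ i ∈ s, (f (Z i ω) - m)} ∪ {ω | T ≤ ∑ i ∈ s, -(f (Z i ω) - m)}) :=
        measureReal_mono hsub
    _ ≤ _ := measureReal_union_le _ _
    _ ≤ _ := by linarith

/-- Maximum of `n` sub-Gaussian variables: at most `2 K √(log n)` up to probability `2 n⁻³`. -/
lemma measureReal_exists_abs_gt_le (hid : ∀ i, IdentDistrib (Z i) Z₀ P P) {f : E → ℝ}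
    (hf : Measurable f) {K : ℝ} (hn : 0 < n) (h : SubG P (fun ω => f (Z₀ ω)) K) :
    P.real {ω | ∃ i, 2 * K * √(Real.log n) < |f (Z i ω)|} ≤ 2 / (n : ℝ) ^ 3 := by
  have hn' : (0 : ℝ) < n := by exact_mod_cast hn
  have hn1 : (1 : ℝ) ≤ n := by exact_mod_cast hn
  have hlog : 0 ≤ Real.log n := Real.log_nonneg hn1
  have hK := h.pos
  have key : ∀ i, P.real {ω | 2 * K * √(Real.log n) < |f (Z i ω)|} ≤ 2 / (n : ℝ) ^ 4 := by
    intro i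
    have hidi : IdentDistrib (fun ω => Real.exp ((f (Z i ω) / K) ^ 2))
        (fun ω => Real.exp ((f (Z₀ ω) / K) ^ 2)) P P :=
      (hid i).comp (u := fun z => Real.exp ((f z / K) ^ 2)) (by fun_prop)
    have hmk := mul_meas_ge_le_integral_of_nonneg
      (Filter.Eventually.of_forall fun ω => (Real.exp_pos ((f (Z i ω) / K) ^ 2)).le)
      (hidi.integrable_iff.2 h.integrable) ((n : ℝ) ^ 4)
    rw [hidi.integral_eq] at hmk
    have hsub : {ω | 2 * K * √(Real.log n) < |f (Z i ω)|} ⊆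
        {ω | (n : ℝ) ^ 4 ≤ Real.exp ((f (Z i ω) / K) ^ 2)} := by
      intro ω hω
      simp only [Set.mem_ofPred_eq] at hω ⊢
      have h1 : 4 * Real.log n ≤ (f (Z i ω) / K) ^ 2 := by
        rw [← sq_abs, abs_div, abs_of_pos hK]
        have : 2 * √(Real.log n) ≤ |f (Z i ω)| / K := by
          rw [le_div_iff₀ hK]; linarith
        calc 4 * Real.log n = (2 * √(Real.log n)) ^ 2 := by
              rw [mul_pow, Real.sq_sqrt hlog]; norm_num
          _ ≤ _ := by gcongr
      calc (n : ℝ) ^ 4 = Real.exp (4 * Real.log n) := by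
            rw [show (4 : ℝ) = ((4 : ℕ) : ℝ) by norm_num, Real.exp_nat_mul, Real.exp_log hn']
        _ ≤ _ := Real.exp_le_exp.2 h1
    rw [le_div_iff₀ (by positivity)]
    have := measureReal_mono (μ := P) hsub
    have hle := h.integral_le
    calc _ ≤ P.real {ω | (n : ℝ) ^ 4 ≤ Real.exp ((f (Z i ω) / K) ^ 2)} * (n : ℝ) ^ 4 := by gcongr
      _ ≤ _ := by linarith
  have hU : {ω | ∃ i, 2 * K * √(Real.log n) < |f (Z i ω)|} =
      ⋃ i ∈ (Finset.univ : Finset (Fin n)), {ω | 2 * K * √(Real.log n) < |f (Z i ω)|} := by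
    ext ω; simp
  rw [hU]
  calc _ ≤ ∑ i : Fin n, P.real {ω | 2 * K * √(Real.log n) < |f (Z i ω)|} :=
        measureReal_biUnion_finset_le _ _
    _ ≤ ∑ _i : Fin n, 2 / (n : ℝ) ^ 4 := Finset.sum_le_sum fun i _ => key i
    _ = _ := by simp; field_simp

end Chernoff

/-! ### Sums of products of squares of sub-Gaussian variables -/

section Products

variable {Ω E : Type*} [MeasurableSpace Ω] [MeasurableSpace E] {P : Measure Ω}

lemma SubG.sq_mul_sq_moments {x y : Ω → ℝ} {K K' : ℝ} (hx : SubG P x K) (hy : SubG P y K') :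
    (Integrable (fun ω => (x ω / K) ^ 2 * (y ω / K') ^ 2) P ∧
      ∫ ω, (x ω / K) ^ 2 * (y ω / K') ^ 2 ∂P ≤ 4) ∧
    (Integrable (fun ω => ((x ω / K) ^ 2 * (y ω / K') ^ 2) ^ 2) P ∧
      ∫ ω, ((x ω / K) ^ 2 * (y ω / K') ^ 2) ^ 2 ∂P ≤ 48) := by
  have mx := hx.meas
  have my := hy.meas
  constructor
  · have := hx.integral_le_of_abs_le hy (f := fun ω => (x ω / K) ^ 2 * (y ω / K') ^ 2)
      (by fun_prop) (a := 1) (b := 1) (by norm_num) (by norm_num) fun ω => by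
        rw [abs_of_nonneg (by positivity)]
        nlinarith [pow_four_le_exp_sq (x ω / K), pow_four_le_exp_sq (y ω / K'),
          sq_nonneg ((x ω / K) ^ 2 - (y ω / K') ^ 2)]
    norm_num at this
    exact this
  · have := hx.integral_le_of_abs_le hy (f := fun ω => ((x ω / K) ^ 2 * (y ω / K') ^ 2) ^ 2)
      (by fun_prop) (a := 12) (b := 12) (by norm_num) (by norm_num) fun ω => by
        rw [abs_of_nonneg (by positivity)]
        nlinarith [pow_eight_le_exp_sq (x ω / K), pow_eight_le_exp_sq (y ω / K'),
          sq_nonneg ((x ω / K) ^ 4 - (y ω / K') ^ 4)]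
    norm_num at this
    exact this

/-- If `r = n^(1/3)` then `log n ≤ 3 r` and `(log n)² ≤ 36 r`. -/
lemma log_le_of_pow_three_eq {n r : ℝ} (hr : 0 < r) (h : r ^ 3 = n) :
    Real.log n ≤ 3 * r ∧ (1 ≤ n → Real.log n ^ 2 ≤ 36 * r) := by
  have e : Real.log n = 3 * Real.log r := by rw [← h, Real.log_pow]; norm_num
  constructor
  · rw [e]; linarith [Real.log_le_sub_one_of_pos hr]
  · intro hn
    have h1 : Real.log n ≤ 6 * √r := by
      have h2 := Real.log_le_sub_one_of_pos (Real.sqrt_pos.2 hr)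
      rw [Real.log_sqrt hr.le] at h2
      linarith
    calc Real.log n ^ 2 ≤ (6 * √r) ^ 2 := by
          gcongr
          exact Real.log_nonneg hn
      _ = 36 * r := by rw [mul_pow, Real.sq_sqrt hr.le]; norm_num

variable [IsProbabilityMeasure P] {n : ℕ} {Z : Fin n → Ω → E} {Z₀ : Ω → E}

/-- Law of large numbers with rate `n^(-1/3)` for a product of two squared sub-Gaussian variables.
The summands only have finite exponential moments of order `1/2`; the upper tail is handled by
truncation at a multiple of `n^(1/3)`, which is not active when the factors are `O(√(log n))`, and
the lower tail needs no truncation because the summands are nonnegative. -/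
lemma measureReal_sum_sq_mul_sq_deviation_le (hZ : ∀ i, Measurable (Z i)) (hind : iIndepFun Z P)
    (hid : ∀ i, IdentDistrib (Z i) Z₀ P P) (hZ₀ : Measurable Z₀)
    {f g : E → ℝ} (hf : Measurable f) (hg : Measurable g) {K K' r : ℝ} (hn : 0 < n)
    (hr : 0 < r) (hrn : r ^ 3 = n)
    (hfK : SubG P (fun ω => f (Z₀ ω)) K) (hgK : SubG P (fun ω => g (Z₀ ω)) K') :
    P.real {ω | (∀ i, |f (Z i ω)| ≤ 2 * K * √(Real.log n)) ∧
      (∀ i, |g (Z i ω)| ≤ 2 * K' * √(Real.log n)) ∧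
      4032 * n / r < |∑ i, (f (Z i ω) / K) ^ 2 * (g (Z i ω) / K') ^ 2 -
        n * ∫ ω', (f (Z₀ ω') / K) ^ 2 * (g (Z₀ ω') / K') ^ 2 ∂P|} ≤ 2 / (n : ℝ) ^ 2 := by
  have hn' : (0 : ℝ) < n := by exact_mod_cast hn
  have hn1 : (1 : ℝ) ≤ n := by exact_mod_cast hn
  have hK := hfK.pos
  have hK' := hgK.pos
  obtain ⟨hlog, hlog2⟩ := log_le_of_pow_three_eq hr hrn
  specialize hlog2 hn1
  have hlog0 : 0 ≤ Real.log n := Real.log_nonneg hn1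
  set w : E → ℝ := fun z => (f z / K) ^ 2 * (g z / K') ^ 2 with hw
  have hwm : Measurable w := by fun_prop
  have hw0 : ∀ z, 0 ≤ w z := fun z => by positivity
  obtain ⟨⟨wi, wle⟩, w2i, w2le⟩ := hfK.sq_mul_sq_moments hgK
  set m := ∫ ω', w (Z₀ ω') ∂P with hm
  change ∫ ω, w (Z₀ ω) ^ 2 ∂P ≤ 48 at w2le
  change Integrable (fun ω => w (Z₀ ω)) P at wi
  change Integrable (fun ω => w (Z₀ ω) ^ 2) P at w2i
  -- The truncation level is `576 r` because `(4 log n)² ≤ 576 r`.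
  set t := 1 / (576 * r) with ht
  have ht0 : 0 < t := by positivity
  set w' : E → ℝ := fun z => min (w z) (576 * r) with hw'
  have hw'm : Measurable w' := hwm.min measurable_const
  have hw'0 : ∀ z, 0 ≤ w' z := fun z => le_min (hw0 z) (by positivity)
  have hw'le : ∀ z, w' z ≤ w z := fun z => min_le_left _ _
  have w'i : Integrable (fun ω => w' (Z₀ ω)) P :=
    wi.mono' (hw'm.comp hZ₀).aestronglyMeasurable (Filter.Eventually.of_forall fun ω => by
      rw [Real.norm_eq_abs, abs_of_nonneg (hw'0 _)]; exact hw'le _)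
  have hsq : ∀ ω, w' (Z₀ ω) ^ 2 ≤ w (Z₀ ω) ^ 2 := fun ω =>
    pow_le_pow_left₀ (hw'0 _) (hw'le _) 2
  have w'2i : Integrable (fun ω => w' (Z₀ ω) ^ 2) P :=
    w2i.mono' ((hw'm.comp hZ₀).pow_const 2).aestronglyMeasurable
      (Filter.Eventually.of_forall fun ω => by
        rw [Real.norm_eq_abs, abs_of_nonneg (by positivity)]; exact hsq ω)
  have w'2le : ∫ ω, w' (Z₀ ω) ^ 2 ∂P ≤ 48 := (integral_mono w'2i w2i hsq).trans w2le
  have w'm : ∫ ω, w' (Z₀ ω) ∂P ≤ m := integral_mono w'i wi fun ω => hw'le _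
  have he1 : Real.exp 1 ≤ 3 := by have := Real.exp_one_lt_d9; linarith
  obtain ⟨i1, b1⟩ := integral_exp_mul_le_of_le (t := t) (hw'm.comp hZ₀) w'i w'2i zero_le_one w'2le
    fun ω => by
      have : w' (Z₀ ω) ≤ 576 * r := min_le_right _ _
      simp only [Function.comp, ht, one_div]
      rw [inv_mul_le_iff₀ (by positivity)]; linarith
  obtain ⟨i2, b2⟩ := integral_exp_mul_le_of_le (t := t) (w := fun ω => -w (Z₀ ω)) (s := 48)
    (hwm.comp hZ₀).neg wi.neg (by simpa using w2i) le_rfl (by simpa using w2le) fun ω => by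
      have := hw0 (Z₀ ω)
      nlinarith
  rw [integral_neg] at b2
  have b1' : ∫ ω, Real.exp (t * w' (Z₀ ω)) ∂P ≤ Real.exp (t * m + 144 * t ^ 2) := by
    refine b1.trans (Real.exp_le_exp.2 ?_)
    have h1 : t * ∫ ω, w' (Z₀ ω) ∂P ≤ t * m := by gcongr
    have h2 : t ^ 2 * 48 * Real.exp 1 ≤ t ^ 2 * 48 * 3 := by gcongr
    simp only [Function.comp]
    linarith
  have b2' : ∫ ω, Real.exp (t * -w (Z₀ ω)) ∂P ≤ Real.exp (-(t * m) + 144 * t ^ 2) := by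
    refine b2.trans (Real.exp_le_exp.2 ?_)
    rw [Real.exp_zero]
    nlinarith [sq_nonneg t]
  have u1 := measureReal_sum_ge_le hZ hind hid Finset.univ hw'm ht0.le i1 b1'
    (n * m + 4032 * n / r)
  have u2 := measureReal_sum_ge_le hZ hind hid Finset.univ hwm.neg ht0.le i2 b2'
    (-(n * m) + 4032 * n / r)
  have hexp : (n : ℝ) * (144 * t ^ 2) - t * (4032 * n / r) ≤ -(2 * Real.log n) := by
    have e1 : (n : ℝ) * (144 * t ^ 2) = 144 / 576 ^ 2 * r := by
      rw [← hrn, ht]; field_simp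
    have e2 : t * (4032 * n / r) = 7 * r := by
      rw [← hrn, ht]; field_simp; norm_num
    rw [e1, e2]; linarith
  have hn2 : Real.exp (-(2 * Real.log n)) = 1 / (n : ℝ) ^ 2 := by
    rw [Real.exp_neg, show (2 : ℝ) = ((2 : ℕ) : ℝ) by norm_num, Real.exp_nat_mul,
      Real.exp_log hn', one_div]
  rw [Finset.card_univ, Fintype.card_fin] at u1 u2
  have u1' : P.real {ω | n * m + 4032 * n / r ≤ ∑ i, w' (Z i ω)} ≤ 1 / (n : ℝ) ^ 2 := by
    refine u1.trans ?_
    rw [← hn2, Real.exp_le_exp]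
    linarith
  have u2' : P.real {ω | -(n * m) + 4032 * n / r ≤ ∑ i, (-w) (Z i ω)} ≤ 1 / (n : ℝ) ^ 2 := by
    refine u2.trans ?_
    rw [← hn2, Real.exp_le_exp]
    linarith
  refine (measureReal_mono (s₂ := {ω | n * m + 4032 * n / r ≤ ∑ i, w' (Z i ω)} ∪
    {ω | -(n * m) + 4032 * n / r ≤ ∑ i, (-w) (Z i ω)}) ?_).trans
    ((measureReal_union_le _ _).trans ?_)
  · rintro ω ⟨hf', hg', hlt⟩
    -- On this event the truncation is not active.
    have hww : ∀ i, w' (Z i ω) = w (Z i ω) := by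
      intro i
      refine min_eq_left ?_
      have h1 : (f (Z i ω) / K) ^ 2 ≤ 4 * Real.log n := by
        have h3 : |f (Z i ω) / K| ≤ 2 * √(Real.log n) := by
          rw [abs_div, abs_of_pos hK, div_le_iff₀ hK]; linarith [hf' i]
        rw [← sq_abs]
        calc |f (Z i ω) / K| ^ 2 ≤ (2 * √(Real.log n)) ^ 2 := by gcongr
          _ = _ := by rw [mul_pow, Real.sq_sqrt hlog0]; norm_num
      have h2 : (g (Z i ω) / K') ^ 2 ≤ 4 * Real.log n := by
        have h3 : |g (Z i ω) / K'| ≤ 2 * √(Real.log n) := by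
          rw [abs_div, abs_of_pos hK', div_le_iff₀ hK']; linarith [hg' i]
        rw [← sq_abs]
        calc |g (Z i ω) / K'| ^ 2 ≤ (2 * √(Real.log n)) ^ 2 := by gcongr
          _ = _ := by rw [mul_pow, Real.sq_sqrt hlog0]; norm_num
      calc w (Z i ω) ≤ (4 * Real.log n) * (4 * Real.log n) := by
            simp only [hw]; gcongr
        _ ≤ 576 * r := by nlinarith
    simp only [Set.mem_union, Set.mem_ofPred_eq, hww, Pi.neg_apply, Finset.sum_neg_distrib]
    rcases lt_abs.1 hlt with h | h
    · left; change 4032 * n / r < ∑ i, w (Z i ω) - n * m at h; linarith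
    · right; change 4032 * n / r < -(∑ i, w (Z i ω) - n * m) at h; linarith
  · calc _ ≤ 1 / (n : ℝ) ^ 2 + 1 / (n : ℝ) ^ 2 := add_le_add u1' u2'
      _ = _ := by ring

/-- A uniform bound on a sum of `f² g²`: once `f` is truncated at `O(√(log n))`, the summands have
exponential moments at the scale `log n`, so the bound fails with probability at most
`exp(-4 l)` for all `l` up to the order `n^(2/3)`. -/
lemma measureReal_sum_sq_mul_sq_gt_le (hZ : ∀ i, Measurable (Z i)) (hind : iIndepFun Z P)
    (hid : ∀ i, IdentDistrib (Z i) Z₀ P P) (hZ₀ : Measurable Z₀) (s : Finset (Fin n))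
    {f g : E → ℝ} (hf : Measurable f) (hg : Measurable g) {K K' r c l : ℝ} (hn : 2 ≤ n)
    (hr : 0 < r) (hrn : r ^ 3 = n) (hc : 0 < c) (hl : l ≤ c * r ^ 2)
    (hfK : SubG P (fun ω => f (Z₀ ω)) K) (hgK : SubG P (fun ω => g (Z₀ ω)) K') :
    P.real {ω | (∀ i, |f (Z i ω)| ≤ 2 * K * √(Real.log n)) ∧
      n * ((32 + 96 * c) * (K * K') ^ 2) < ∑ i ∈ s, f (Z i ω) ^ 2 * g (Z i ω) ^ 2} ≤
        Real.exp (-(4 * l)) := by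
  have hn' : (0 : ℝ) < n := by positivity
  have hn1 : (1 : ℝ) < n := by exact_mod_cast hn
  have hK := hfK.pos
  have hK' := hgK.pos
  obtain ⟨hlog, -⟩ := log_le_of_pow_three_eq hr hrn
  have hlog0 : 0 < Real.log n := Real.log_pos hn1
  set w : E → ℝ := fun z => min ((f z / K) ^ 2) (4 * Real.log n) * (g z / K') ^ 2 with hw
  have hwm : Measurable w := by fun_prop
  have hw0 : ∀ z, 0 ≤ w z := fun z => by positivity
  -- This parameter turns the truncated summand into `t w ≤ (g / K')² / 2`, which leaves room to
  -- absorb a polynomial factor into the exponential moments.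
  set t := 1 / (8 * Real.log n) with ht
  have ht0 : 0 < t := by positivity
  have htw : ∀ z, t * w z ≤ (g z / K') ^ 2 / 2 := fun z => by
    calc t * w z ≤ t * ((4 * Real.log n) * (g z / K') ^ 2) := by
          simp only [hw]; gcongr; exact min_le_right _ _
      _ = _ := by rw [ht]; field_simp; ring
  have hpt : ∀ z, w z * Real.exp (t * w z) ≤
      4 * Real.exp ((f z / K) ^ 2) + 12 * Real.exp ((g z / K') ^ 2) := fun z => by
    set x := f z / K
    set y := g z / K'
    have h1 : x ^ 2 ≤ 4 * Real.exp (x ^ 2 / 4) := by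
      linarith [Real.add_one_le_exp (x ^ 2 / 4)]
    have h2 : y ^ 2 ≤ 4 * Real.exp (y ^ 2 / 4) := by
      linarith [Real.add_one_le_exp (y ^ 2 / 4)]
    have h3 := convexOn_exp.2 (Set.mem_univ (x ^ 2)) (Set.mem_univ (y ^ 2))
      (show (0 : ℝ) ≤ 1 / 4 by norm_num) (show (0 : ℝ) ≤ 3 / 4 by norm_num) (by norm_num)
    simp only [smul_eq_mul] at h3
    calc w z * Real.exp (t * w z) ≤ (x ^ 2 * y ^ 2) * Real.exp (y ^ 2 / 2) := by
          gcongr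
          · simp only [hw]; gcongr; exact min_le_left _ _
          · exact htw z
      _ ≤ ((4 * Real.exp (x ^ 2 / 4)) * (4 * Real.exp (y ^ 2 / 4))) * Real.exp (y ^ 2 / 2) := by
          gcongr
      _ = 16 * Real.exp (1 / 4 * x ^ 2 + 3 / 4 * y ^ 2) := by
          rw [show 1 / 4 * x ^ 2 + 3 / 4 * y ^ 2 = x ^ 2 / 4 + y ^ 2 / 4 + y ^ 2 / 2 by ring,
            Real.exp_add, Real.exp_add]
          ring
      _ ≤ _ := by linarith
  obtain ⟨vi, vle⟩ := hfK.integral_le_of_abs_le hgK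
    (f := fun ω => w (Z₀ ω) * Real.exp (t * w (Z₀ ω))) (by fun_prop) (a := 4) (b := 12)
    (by norm_num) (by norm_num) fun ω => by
      rw [abs_of_nonneg (mul_nonneg (hw0 _) (Real.exp_pos _).le)]; exact hpt (Z₀ ω)
  have hexp1 : ∀ ω, Real.exp (t * w (Z₀ ω)) ≤ 1 + t * (w (Z₀ ω) * Real.exp (t * w (Z₀ ω))) := by
    intro ω
    have h1 := Real.add_one_le_exp (-(t * w (Z₀ ω)))
    have h2 : Real.exp (t * w (Z₀ ω)) * Real.exp (-(t * w (Z₀ ω))) = 1 := by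
      rw [← Real.exp_add]; simp
    nlinarith [Real.exp_pos (t * w (Z₀ ω))]
  have hii : Integrable (fun ω => 1 + t * (w (Z₀ ω) * Real.exp (t * w (Z₀ ω)))) P :=
    (integrable_const _).add (vi.const_mul t)
  have ei : Integrable (fun ω => Real.exp (t * w (Z₀ ω))) P :=
    hii.mono' (Measurable.aestronglyMeasurable (by fun_prop)) (Filter.Eventually.of_forall fun ω => by
      rw [Real.norm_eq_abs, abs_of_pos (Real.exp_pos _)]; exact hexp1 ω)
  have ele : ∫ ω, Real.exp (t * w (Z₀ ω)) ∂P ≤ Real.exp (32 * t) := by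
    refine (integral_mono ei hii hexp1).trans ?_
    rw [integral_add (integrable_const _) (vi.const_mul t), integral_const_mul]
    have : t * ∫ ω, w (Z₀ ω) * Real.exp (t * w (Z₀ ω)) ∂P ≤ t * (2 * (4 + 12)) := by gcongr
    simp only [integral_const, probReal_univ, smul_eq_mul, one_mul]
    linarith [Real.add_one_le_exp (32 * t)]
  have u := measureReal_sum_ge_le hZ hind hid s hwm ht0.le ei ele (n * (32 + 96 * c))
  have hcard : (s.card : ℝ) ≤ n := by
    have := s.card_le_univ; rw [Fintype.card_fin] at this; exact_mod_cast this
  have hexp : (s.card : ℝ) * (32 * t) - t * (n * (32 + 96 * c)) ≤ -(4 * l) := by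
    have h1 : (s.card : ℝ) * (32 * t) ≤ n * (32 * t) := by gcongr
    have h2 : r ^ 2 / 24 ≤ t * n := by
      rw [ht, ← hrn, one_div, inv_mul_eq_div, le_div_iff₀ (by rw [hrn]; positivity), hrn]
      nlinarith [sq_nonneg r]
    have h3 : r ^ 2 / 24 * (96 * c) ≤ t * n * (96 * c) := by gcongr
    nlinarith
  refine (measureReal_mono ?_).trans (u.trans (Real.exp_le_exp.2 hexp))
  rintro ω ⟨hf', hlt⟩
  have hww : ∀ i, w (Z i ω) = f (Z i ω) ^ 2 * g (Z i ω) ^ 2 / (K * K') ^ 2 := by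
    intro i
    have h3 : |f (Z i ω) / K| ≤ 2 * √(Real.log n) := by
      rw [abs_div, abs_of_pos hK, div_le_iff₀ hK]; linarith [hf' i]
    have h1 : (f (Z i ω) / K) ^ 2 ≤ 4 * Real.log n := by
      rw [← sq_abs]
      calc |f (Z i ω) / K| ^ 2 ≤ (2 * √(Real.log n)) ^ 2 := by gcongr
        _ = _ := by rw [mul_pow, Real.sq_sqrt hlog0.le]; norm_num
    simp only [hw, min_eq_left h1]
    field_simp
  simp only [Set.mem_ofPred_eq, hww, ← Finset.sum_div]
  rw [le_div_iff₀ (by positivity)]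
  linarith

end Products

/-! ### Directions independent of the sample -/

section Direction

variable {Ω E : Type*} [MeasurableSpace Ω] [MeasurableSpace E] {P : Measure Ω}
  [IsProbabilityMeasure P]

/-- Conditioning on an independent variable: a bound on the bad event for each frozen value `b` of
`W'` is a bound on the bad event itself. -/
lemma IndepFun.measureReal_le_of_forall {A B : Type*} [MeasurableSpace A] [MeasurableSpace B]
    {W : Ω → A} {W' : Ω → B} (hW : Measurable W) (hW' : Measurable W') (h : IndepFun W W' P)
    {s : Set (A × B)} (hs : MeasurableSet s) {η : ℝ} (hη : 0 ≤ η)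
    (hle : ∀ b, P.real {ω | (W ω, b) ∈ s} ≤ η) : P.real {ω | (W ω, W' ω) ∈ s} ≤ η := by
  have hp := (indepFun_iff_map_prod_eq_prod_map_map hW.aemeasurable hW'.aemeasurable).1 h
  have : IsProbabilityMeasure (P.map W) := Measure.isProbabilityMeasure_map hW.aemeasurable
  have : IsProbabilityMeasure (P.map W') := Measure.isProbabilityMeasure_map hW'.aemeasurable
  have e : P {ω | (W ω, W' ω) ∈ s} = ∫⁻ b, P {ω | (W ω, b) ∈ s} ∂(P.map W') := by
    have e1 : P {ω | (W ω, W' ω) ∈ s} = P.map (fun ω => (W ω, W' ω)) s :=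
      (Measure.map_apply (hW.prodMk hW') hs).symm
    rw [e1, hp, Measure.prod_apply_symm hs]
    refine lintegral_congr fun b => ?_
    rw [Measure.map_apply hW (measurable_prodMk_right hs)]
    rfl
  refine ENNReal.toReal_le_of_le_ofReal hη ?_
  rw [e]
  calc _ ≤ ∫⁻ _b, ENNReal.ofReal η ∂(P.map W') := lintegral_mono fun b => by
        rw [← ofReal_measureReal]
        exact ENNReal.ofReal_le_ofReal (hle b)
    _ = _ := by simp

variable {n p : ℕ} {Z : Fin n → Ω → E} {Z₀ : Ω → E}

/-- Simultaneous control of the linear and the quartic sums along one fixed function `f` of the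
observations. -/
lemma measureReal_not_fixed_direction_le (hZ : ∀ i, Measurable (Z i)) (hind : iIndepFun Z P)
    (hid : ∀ i, IdentDistrib (Z i) Z₀ P P) (hZ₀ : Measurable Z₀) (s : Finset (Fin n))
    {f e : E → ℝ} {g : Fin p → E → ℝ} (hf : Measurable f) (he : Measurable e)
    (hg : ∀ j, Measurable (g j)) {K Ke K' r c l : ℝ} (hn : 5 ≤ n)
    (hr : 0 < r) (hrn : r ^ 3 = n) (hc : 0 < c) (hl : l ≤ c * r ^ 2)
    (hnl : Real.log n ≤ l) (hpl : (p : ℝ) ≤ Real.exp l)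
    (hfK : SubG P (fun ω => f (Z₀ ω)) K) (heK : SubG P (fun ω => e (Z₀ ω)) Ke)
    (hgK : ∀ j, SubG P (fun ω => g j (Z₀ ω)) K') (hfe : ∫ ω, f (Z₀ ω) * e (Z₀ ω) ∂P = 0) :
    P.real {ω | ¬ (|∑ i ∈ s, f (Z i ω) * e (Z i ω)| ≤ (8 * √c + 8 / √c) * (K * Ke) * √(n * l) ∧
      ∀ j, ∑ i ∈ s, f (Z i ω) ^ 2 * g j (Z i ω) ^ 2 ≤ n * ((32 + 96 * c) * (K * K') ^ 2))} ≤
        1 / (n : ℝ) := by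
  have hn5 : (5 : ℝ) ≤ n := by exact_mod_cast hn
  have hn' : (0 : ℝ) < n := by linarith
  have hK := hfK.pos
  have hKe := heK.pos
  have hl0 : 0 ≤ l := (Real.log_nonneg (by linarith)).trans hnl
  have hr1 : 1 ≤ r := by
    by_contra hlt
    push Not at hlt
    have := pow_lt_one₀ hr.le hlt (n := 3) (by norm_num)
    linarith
  have hlc : l ≤ c * n := by
    rw [← hrn]
    have : r ^ 2 ≤ r ^ 3 := pow_le_pow_right₀ hr1 (by norm_num)
    nlinarith
  obtain ⟨i1, b1⟩ := hfK.exp_mul_le heK (w := fun ω => f (Z₀ ω) * e (Z₀ ω))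
    (by fun_prop) one_pos (Filter.Eventually.of_forall fun ω => by rw [one_mul])
  rw [one_mul] at i1 b1
  have u1 := bernstein hZ hind hid hZ₀ s (f := fun z => f z * e z) (by fun_prop)
    (mul_pos hK hKe) hc (by omega) hl0 hlc i1 b1
  rw [hfe] at u1
  simp only [sub_zero] at u1
  have u2 := measureReal_exists_abs_gt_le hid hf (by omega) hfK
  have u3 := fun j => measureReal_sum_sq_mul_sq_gt_le hZ hind hid hZ₀ s hf (hg j) (by omega) hr hrn
    hc hl hfK (hgK j)
  have hexp : Real.exp (-(4 * l)) ≤ 1 / (n : ℝ) ^ 3 * (1 / Real.exp l) := by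
    have h1 : (n : ℝ) ≤ Real.exp l := by rwa [← Real.log_le_iff_le_exp hn']
    have h2 : Real.exp (-(4 * l)) = 1 / Real.exp l ^ 3 * (1 / Real.exp l) := by
      rw [← Real.exp_nat_mul, Real.exp_neg, show 4 * l = ((3 : ℕ) : ℝ) * l + l by push_cast; ring,
        Real.exp_add]
      field_simp
    rw [h2]
    gcongr
  have he1 : 1 ≤ Real.exp l := Real.one_le_exp hl0
  have hsub : {ω | ¬ (|∑ i ∈ s, f (Z i ω) * e (Z i ω)| ≤
      (8 * √c + 8 / √c) * (K * Ke) * √(n * l) ∧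
      ∀ j, ∑ i ∈ s, f (Z i ω) ^ 2 * g j (Z i ω) ^ 2 ≤ n * ((32 + 96 * c) * (K * K') ^ 2))} ⊆
      ({ω | (8 * √c + 8 / √c) * (K * Ke) * √(n * l) ≤ |∑ i ∈ s, f (Z i ω) * e (Z i ω)|} ∪
        {ω | ∃ i, 2 * K * √(Real.log n) < |f (Z i ω)|}) ∪
      ⋃ j ∈ (Finset.univ : Finset (Fin p)), {ω | (∀ i, |f (Z i ω)| ≤ 2 * K * √(Real.log n)) ∧
        n * ((32 + 96 * c) * (K * K') ^ 2) < ∑ i ∈ s, f (Z i ω) ^ 2 * g j (Z i ω) ^ 2} := by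
    intro ω hω
    by_contra hcon
    simp only [Set.mem_union, Set.mem_iUnion, Set.mem_ofPred_eq, Finset.mem_univ, exists_prop,
      true_and, not_or, not_exists, not_le, not_lt, not_and] at hcon hω
    obtain ⟨⟨h1, h2⟩, h3⟩ := hcon
    obtain ⟨j, hj⟩ := not_forall.1 (hω h1.le)
    exact hj (h3 j h2)
  refine (measureReal_mono hsub).trans ((measureReal_union_le _ _).trans ?_)
  refine (add_le_add (measureReal_union_le _ _) (measureReal_biUnion_finset_le _ _)).trans ?_
  have h3 : ∑ j : Fin p, P.real {ω | (∀ i, |f (Z i ω)| ≤ 2 * K * √(Real.log n)) ∧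
      n * ((32 + 96 * c) * (K * K') ^ 2) < ∑ i ∈ s, f (Z i ω) ^ 2 * g j (Z i ω) ^ 2} ≤
        1 / (n : ℝ) ^ 3 := by
    calc _ ≤ ∑ _j : Fin p, Real.exp (-(4 * l)) := Finset.sum_le_sum fun j _ => u3 j
      _ = p * Real.exp (-(4 * l)) := by simp
      _ ≤ Real.exp l * (1 / (n : ℝ) ^ 3 * (1 / Real.exp l)) := by gcongr
      _ = _ := by field_simp
  have h4 : Real.exp (-(4 * l)) ≤ 1 / (n : ℝ) ^ 3 := by
    refine hexp.trans (mul_le_of_le_one_right (by positivity) ?_)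
    rw [div_le_one (by positivity)]; exact he1
  calc _ ≤ (2 * (1 / (n : ℝ) ^ 3) + 2 / (n : ℝ) ^ 3) + 1 / (n : ℝ) ^ 3 := by
        gcongr
        exact u1.trans (by gcongr)
    _ = 5 / (n : ℝ) ^ 3 := by ring
    _ ≤ _ := by
        rw [div_le_div_iff₀ (by positivity) hn']
        nlinarith [pow_pos hn' 2]

end Direction

/-! ### Symmetric matrices and their extreme eigenvalues -/

section Spectrum

variable {p : ℕ}

lemma l2Norm_sq (v : Fin p → ℝ) : l2Norm v ^ 2 = v ⬝ᵥ v := by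
  rw [l2Norm, Real.sq_sqrt (Finset.sum_nonneg fun j _ => sq_nonneg _)]
  simp [dotProduct, sq]

lemma l2Norm_nonneg (v : Fin p → ℝ) : 0 ≤ l2Norm v := Real.sqrt_nonneg _

lemma l2Norm_pos {v : Fin p → ℝ} (hv : v ≠ 0) : 0 < l2Norm v := by
  have h : 0 < l2Norm v ^ 2 := by
    rw [l2Norm_sq]
    refine lt_of_le_of_ne (Finset.sum_nonneg fun j _ => mul_self_nonneg _) fun h => hv ?_
    exact dotProduct_self_eq_zero.1 h.symm
  exact (sq_pos_iff.1 h).lt_of_le' (l2Norm_nonneg v)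

lemma l1Norm_nonneg (v : Fin p → ℝ) : 0 ≤ l1Norm v := Finset.sum_nonneg fun _ _ => abs_nonneg _

lemma l1Norm_pos {v : Fin p → ℝ} (hv : v ≠ 0) : 0 < l1Norm v := by
  refine lt_of_le_of_ne (l1Norm_nonneg v) fun h => hv ?_
  funext j
  have := (Finset.sum_eq_zero_iff_of_nonneg fun j _ => abs_nonneg (v j)).1 h.symm j
    (Finset.mem_univ j)
  simpa using this

lemma isUnit_det_of_lamMin_inv_pos [NeZero p] {A : Matrix (Fin p) (Fin p) ℝ}
    (h : 0 < lamMin A⁻¹) : IsUnit A.det := by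
  by_contra hA
  rw [nonsing_inv_apply_not_isUnit _ hA, lamMin, spectrum.zero_eq, csInf_singleton] at h
  exact lt_irrefl _ h

lemma lamMin_le_eigenvalues {A : Matrix (Fin p) (Fin p) ℝ} (hA : A.IsHermitian) (i : Fin p) :
    lamMin A ≤ hA.eigenvalues i :=
  csInf_le finite_real_spectrum.bddBelow (hA.eigenvalues_mem_spectrum_real i)

lemma eigenvalues_le_lamMax {A : Matrix (Fin p) (Fin p) ℝ} (hA : A.IsHermitian) (i : Fin p) :
    hA.eigenvalues i ≤ lamMax A :=
  le_csSup finite_real_spectrum.bddAbove (hA.eigenvalues_mem_spectrum_real i)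

lemma sum_sq_eigenvectorBasis_dotProduct {A : Matrix (Fin p) (Fin p) ℝ} (hA : A.IsHermitian)
    (v : Fin p → ℝ) : ∑ i, ((hA.eigenvectorBasis i).ofLp ⬝ᵥ v) ^ 2 = v ⬝ᵥ v := by
  have := hA.eigenvectorBasis.sum_inner_mul_inner (WithLp.toLp 2 v) (WithLp.toLp 2 v)
  simp only [EuclideanSpace.inner_eq_star_dotProduct, star_trivial] at this
  rw [← this]
  refine Finset.sum_congr rfl fun i _ => ?_
  rw [sq, dotProduct_comm v]

lemma eigenvectorBasis_dotProduct_mulVec {A : Matrix (Fin p) (Fin p) ℝ} (hA : A.IsHermitian)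
    (v : Fin p → ℝ) (i : Fin p) : (hA.eigenvectorBasis i).ofLp ⬝ᵥ (A *ᵥ v) =
      hA.eigenvalues i * ((hA.eigenvectorBasis i).ofLp ⬝ᵥ v) := by
  have hs : Aᵀ = A := by simpa [IsHermitian] using hA
  have h1 : (hA.eigenvectorBasis i).ofLp ᵥ* A = A *ᵥ (hA.eigenvectorBasis i).ofLp := by
    rw [← vecMul_transpose]; exact congrArg _ hs.symm
  rw [dotProduct_mulVec, h1, hA.mulVec_eigenvectorBasis, smul_dotProduct, smul_eq_mul]

lemma le_dotProduct_mulVec {A : Matrix (Fin p) (Fin p) ℝ} (hA : A.IsHermitian) {c : ℝ}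
    (hc : c ≤ lamMin A) (v : Fin p → ℝ) : c * (v ⬝ᵥ v) ≤ v ⬝ᵥ (A *ᵥ v) := by
  have h := hA.eigenvectorBasis.sum_inner_mul_inner (WithLp.toLp 2 v) (WithLp.toLp 2 (A *ᵥ v))
  simp only [EuclideanSpace.inner_eq_star_dotProduct, star_trivial] at h
  rw [dotProduct_comm v (A *ᵥ v), ← h, ← sum_sq_eigenvectorBasis_dotProduct hA v, Finset.mul_sum]
  refine Finset.sum_le_sum fun i _ => ?_
  rw [dotProduct_comm (A *ᵥ v), eigenvectorBasis_dotProduct_mulVec]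
  have := hc.trans (lamMin_le_eigenvalues hA i)
  nlinarith [mul_le_mul_of_nonneg_right this (sq_nonneg ((hA.eigenvectorBasis i).ofLp ⬝ᵥ v))]

lemma l2Norm_mulVec_le {A : Matrix (Fin p) (Fin p) ℝ} (hA : A.IsHermitian) {C : ℝ} (hC : 0 ≤ C)
    (h0 : 0 ≤ lamMin A) (hC' : lamMax A ≤ C) (v : Fin p → ℝ) :
    l2Norm (A *ᵥ v) ≤ C * l2Norm v := by
  refine le_of_sq_le_sq ?_ (mul_nonneg hC (l2Norm_nonneg v))
  rw [mul_pow, l2Norm_sq, l2Norm_sq, ← sum_sq_eigenvectorBasis_dotProduct hA v,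
    ← sum_sq_eigenvectorBasis_dotProduct hA (A *ᵥ v), Finset.mul_sum]
  refine Finset.sum_le_sum fun i _ => ?_
  rw [eigenvectorBasis_dotProduct_mulVec, mul_pow]
  have h1 := h0.trans (lamMin_le_eigenvalues hA i)
  have h2 := (eigenvalues_le_lamMax hA i).trans hC'
  gcongr

end Spectrum

namespace Setting

/-! ### The loss: measurability and Taylor bounds -/

variable {Ω : Type*} [MeasurableSpace Ω] {P : Measure Ω} {n p : ℕ} (S : Setting Ω P n p)

lemma hasDerivAt_φd {k : ℕ} (hk : k < 3) (a b : ℝ) :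
    HasDerivAt (S.φd k a) (S.φd (k + 1) a b) b := by
  have h := (S.differentiable_φ a k hk b).hasDerivAt
  rwa [← iteratedDeriv_succ] at h

lemma measurable_φd {k : ℕ} (hk : k ≤ 3) : Measurable (Function.uncurry (S.φd k)) := by
  induction k with
  | zero =>
    have : Function.uncurry (S.φd 0) = Function.uncurry S.φ := by
      funext z; simp [Function.uncurry, φd]
    rw [this]; exact S.measurable_φ
  | succ k ih =>
    have ih' := ih (by omega)
    -- The derivative is the limit of the difference quotients with step `1 / (m + 1)`.
    refine measurable_of_tendsto_metrizable (f := fun (m : ℕ) (z : ℝ × ℝ) =>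
      (1 / ((m : ℝ) + 1))⁻¹ * (S.φd k z.1 (z.2 + 1 / ((m : ℝ) + 1)) - S.φd k z.1 z.2)) ?_ ?_
    · intro m
      have h1 : Measurable fun z : ℝ × ℝ => S.φd k z.1 (z.2 + 1 / ((m : ℝ) + 1)) :=
        ih'.comp (by fun_prop : Measurable fun z : ℝ × ℝ => (z.1, z.2 + 1 / ((m : ℝ) + 1)))
      have h2 : Measurable fun z : ℝ × ℝ => S.φd k z.1 z.2 := ih'
      exact (h1.sub h2).const_mul _
    · rw [tendsto_pi_nhds]
      intro z
      have h := hasDerivAt_iff_tendsto_slope_zero.1 (S.hasDerivAt_φd (k := k) (by omega) z.1 z.2)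
      refine h.comp (tendsto_nhdsWithin_iff.2 ⟨tendsto_one_div_add_atTop_nhds_zero_nat, ?_⟩)
      refine Filter.Eventually.of_forall fun m => ?_
      have : (0 : ℝ) < 1 / ((m : ℝ) + 1) := by positivity
      exact this.ne'

lemma φd_two_nonneg (a b : ℝ) : 0 ≤ S.φd 2 a b := by
  have hm : Monotone (deriv (S.φ a)) := by
    rw [← monotoneOn_univ]
    refine (S.convex_φ a).monotoneOn_deriv fun x _ => ?_
    have := S.differentiable_φ a 0 (by norm_num)
    rw [iteratedDeriv_zero] at this
    exact this x
  have : S.φd 2 a b = deriv (deriv (S.φ a)) b := by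
    simp [φd, iteratedDeriv_succ]
  rw [this]
  exact hm.deriv_nonneg

/-- The score `φ₁(y, xᵀ βbar)` of an observation `(x, y)`. -/
noncomputable def score (z : (Fin p → ℝ) × ℝ) : ℝ := S.φd 1 z.2 (z.1 ⬝ᵥ S.βbar)

/-- The curvature `φ₂(y, xᵀ βbar)` of an observation `(x, y)`. -/
noncomputable def curv (z : (Fin p → ℝ) × ℝ) : ℝ := S.φd 2 z.2 (z.1 ⬝ᵥ S.βbar)

lemma measurable_φd_dotProduct {k : ℕ} (hk : k ≤ 3) (β : Fin p → ℝ) :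
    Measurable fun z : (Fin p → ℝ) × ℝ => S.φd k z.2 (z.1 ⬝ᵥ β) :=
  (S.measurable_φd hk).comp (f := fun z : (Fin p → ℝ) × ℝ => (z.2, z.1 ⬝ᵥ β))
    (by unfold dotProduct; fun_prop)

lemma measurable_score : Measurable S.score := S.measurable_φd_dotProduct (by norm_num) _

lemma measurable_curv : Measurable S.curv := S.measurable_φd_dotProduct (by norm_num) _

/-- The observation `(x, y)` satisfies the derivative bounds along `β ↦ xᵀβ`. The bound on `φ₃` is
recorded as Lipschitz continuity of `φ₂`, which is testable on countably many `β`. -/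
def Regular (C₆ C₇ : ℝ) (z : (Fin p → ℝ) × ℝ) : Prop :=
  (∀ β, S.φd 2 z.2 (z.1 ⬝ᵥ β) ≤ C₆) ∧
  ∀ β β', |S.φd 2 z.2 (z.1 ⬝ᵥ β) - S.φd 2 z.2 (z.1 ⬝ᵥ β')| ≤ C₇ * |z.1 ⬝ᵥ β - z.1 ⬝ᵥ β'|

lemma continuous_φd_dotProduct (y : ℝ) (x : Fin p → ℝ) :
    Continuous fun β => S.φd 2 y (x ⬝ᵥ β) := by
  have h : Continuous (S.φd 2 y) := (S.differentiable_φ y 2 (by norm_num)).continuous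
  exact h.comp (by unfold dotProduct; fun_prop)

lemma measurableSet_regular (C₆ C₇ : ℝ) : MeasurableSet {z | S.Regular C₆ C₇ z} := by
  set d := TopologicalSpace.denseSeq (Fin p → ℝ) with hd
  have hdense : DenseRange d := TopologicalSpace.denseRange_denseSeq _
  have e : {z | S.Regular C₆ C₇ z} =
      (⋂ m, {z | S.φd 2 z.2 (z.1 ⬝ᵥ d m) ≤ C₆}) ∩ ⋂ m, ⋂ k,
        {z | |S.φd 2 z.2 (z.1 ⬝ᵥ d m) - S.φd 2 z.2 (z.1 ⬝ᵥ d k)| ≤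
          C₇ * |z.1 ⬝ᵥ d m - z.1 ⬝ᵥ d k|} := by
    ext z
    simp only [Regular, Set.mem_inter_iff, Set.mem_iInter, Set.mem_ofPred_eq]
    have hc := S.continuous_φd_dotProduct z.2 z.1
    have hc' : Continuous fun β : Fin p → ℝ => z.1 ⬝ᵥ β := by unfold dotProduct; fun_prop
    refine ⟨fun h => ⟨fun m => h.1 _, fun m k => h.2 _ _⟩, fun h => ⟨fun β => ?_, fun β β' => ?_⟩⟩
    · exact hdense.induction_on (p := fun β => S.φd 2 z.2 (z.1 ⬝ᵥ β) ≤ C₆) β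
        (isClosed_le hc continuous_const) h.1
    · refine hdense.induction_on₂ (p := fun β β' => |S.φd 2 z.2 (z.1 ⬝ᵥ β) -
        S.φd 2 z.2 (z.1 ⬝ᵥ β')| ≤ C₇ * |z.1 ⬝ᵥ β - z.1 ⬝ᵥ β'|) ?_ h.2 β β'
      exact isClosed_le ((hc.comp continuous_fst).sub (hc.comp continuous_snd)).abs
        (continuous_const.mul ((hc'.comp continuous_fst).sub (hc'.comp continuous_snd)).abs)
  have hx : ∀ β : Fin p → ℝ, Measurable fun z : (Fin p → ℝ) × ℝ => z.1 ⬝ᵥ β := fun β => by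
    unfold dotProduct; fun_prop
  have h2 := fun β => S.measurable_φd_dotProduct (k := 2) (by norm_num) β
  rw [e]
  refine (MeasurableSet.iInter fun m => measurableSet_le (h2 _) measurable_const).inter
    (MeasurableSet.iInter fun m => MeasurableSet.iInter fun k => ?_)
  have h3 : Measurable fun z : (Fin p → ℝ) × ℝ =>
      |S.φd 2 z.2 (z.1 ⬝ᵥ d m) - S.φd 2 z.2 (z.1 ⬝ᵥ d k)| :=
    measurable_norm.comp ((h2 (d m)).sub (h2 (d k)))
  have h4 : Measurable fun z : (Fin p → ℝ) × ℝ => C₇ * |z.1 ⬝ᵥ d m - z.1 ⬝ᵥ d k| :=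
    (measurable_norm.comp ((hx (d m)).sub (hx (d k)))).const_mul C₇
  exact measurableSet_le h3 h4

/-- Mean value theorem in multiplicative form, without an order on the end points. -/
lemma exists_mem_Icc_sub_eq {F F' : ℝ → ℝ} (hF : ∀ b, HasDerivAt F (F' b) b) (b₀ b₁ : ℝ) :
    ∃ θ ∈ Set.Icc (0 : ℝ) 1, F b₁ - F b₀ = F' (b₀ + θ * (b₁ - b₀)) * (b₁ - b₀) := by
  have hg : ∀ s : ℝ, HasDerivAt (fun s => F (b₀ + s * (b₁ - b₀)))
      (F' (b₀ + s * (b₁ - b₀)) * (b₁ - b₀)) s := fun s => by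
    refine (hF _).comp s ?_
    simpa using ((hasDerivAt_id s).mul_const (b₁ - b₀)).const_add b₀
  obtain ⟨θ, hθ, h⟩ := exists_hasDerivAt_eq_slope (fun s => F (b₀ + s * (b₁ - b₀))) _
    (zero_lt_one' ℝ) (fun s _ => (hg s).continuousAt.continuousWithinAt) fun s _ => hg s
  refine ⟨θ, Set.Ioo_subset_Icc_self hθ, ?_⟩
  rw [h]; simp

variable {S} {C₆ C₇ : ℝ} {z : (Fin p → ℝ) × ℝ}

lemma Regular.abs_φd_one_sub_le (h : S.Regular C₆ C₇ z) (β β' : Fin p → ℝ) :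
    |S.φd 1 z.2 (z.1 ⬝ᵥ β') - S.φd 1 z.2 (z.1 ⬝ᵥ β)| ≤ C₆ * |z.1 ⬝ᵥ (β' - β)| := by
  obtain ⟨θ, -, e⟩ := exists_mem_Icc_sub_eq
    (fun b => S.hasDerivAt_φd (k := 1) (by norm_num) z.2 b) (z.1 ⬝ᵥ β) (z.1 ⬝ᵥ β')
  have e2 : z.1 ⬝ᵥ β + θ * (z.1 ⬝ᵥ β' - z.1 ⬝ᵥ β) = z.1 ⬝ᵥ (β + θ • (β' - β)) := by
    rw [dotProduct_add, dotProduct_smul, dotProduct_sub, smul_eq_mul]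
  rw [e, e2, dotProduct_sub, abs_mul, abs_of_nonneg (S.φd_two_nonneg _ _)]
  have := h.1 (β + θ • (β' - β))
  gcongr

lemma Regular.abs_φd_one_taylor_le (h : S.Regular C₆ C₇ z) (h7 : 0 ≤ C₇) (β β' : Fin p → ℝ) :
    |S.φd 1 z.2 (z.1 ⬝ᵥ β') - S.φd 1 z.2 (z.1 ⬝ᵥ β) -
      S.φd 2 z.2 (z.1 ⬝ᵥ β) * (z.1 ⬝ᵥ (β' - β))| ≤ C₇ * (z.1 ⬝ᵥ (β' - β)) ^ 2 := by
  obtain ⟨θ, hθ, e⟩ := exists_mem_Icc_sub_eq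
    (fun b => S.hasDerivAt_φd (k := 1) (by norm_num) z.2 b) (z.1 ⬝ᵥ β) (z.1 ⬝ᵥ β')
  have e2 : z.1 ⬝ᵥ β + θ * (z.1 ⬝ᵥ β' - z.1 ⬝ᵥ β) = z.1 ⬝ᵥ (β + θ • (β' - β)) := by
    rw [dotProduct_add, dotProduct_smul, dotProduct_sub, smul_eq_mul]
  rw [e, e2, ← dotProduct_sub, ← sub_mul, abs_mul]
  have h1 := h.2 (β + θ • (β' - β)) β
  have e3 : z.1 ⬝ᵥ (β + θ • (β' - β)) - z.1 ⬝ᵥ β = θ * (z.1 ⬝ᵥ (β' - β)) := by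
    rw [dotProduct_add, dotProduct_smul, smul_eq_mul]; ring
  rw [e3, abs_mul, abs_of_nonneg hθ.1] at h1
  calc _ ≤ (C₇ * (θ * |z.1 ⬝ᵥ (β' - β)|)) * |z.1 ⬝ᵥ (β' - β)| := by gcongr
    _ ≤ (C₇ * (1 * |z.1 ⬝ᵥ (β' - β)|)) * |z.1 ⬝ᵥ (β' - β)| := by gcongr; exact hθ.2
    _ = C₇ * |z.1 ⬝ᵥ (β' - β)| ^ 2 := by ring
    _ = _ := by rw [sq_abs]

lemma Regular.φ_sub_le (h : S.Regular C₆ C₇ z) (h6 : 0 ≤ C₆) (β β' : Fin p → ℝ) :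
    S.φ z.2 (z.1 ⬝ᵥ β') - S.φ z.2 (z.1 ⬝ᵥ β) ≤
      S.φd 1 z.2 (z.1 ⬝ᵥ β) * (z.1 ⬝ᵥ (β' - β)) + C₆ * (z.1 ⬝ᵥ (β' - β)) ^ 2 := by
  have h0 : S.φd 0 z.2 = S.φ z.2 := by funext b; simp [φd]
  obtain ⟨θ, hθ, e⟩ := exists_mem_Icc_sub_eq
    (fun b => S.hasDerivAt_φd (k := 0) (by norm_num) z.2 b) (z.1 ⬝ᵥ β) (z.1 ⬝ᵥ β')
  have e2 : z.1 ⬝ᵥ β + θ * (z.1 ⬝ᵥ β' - z.1 ⬝ᵥ β) = z.1 ⬝ᵥ (β + θ • (β' - β)) := by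
    rw [dotProduct_add, dotProduct_smul, dotProduct_sub, smul_eq_mul]
  rw [h0] at e
  rw [e, e2, ← dotProduct_sub]
  have h1 := h.abs_φd_one_sub_le β (β + θ • (β' - β))
  rw [add_sub_cancel_left, dotProduct_smul, smul_eq_mul, abs_mul, abs_of_nonneg hθ.1] at h1
  set w := z.1 ⬝ᵥ (β' - β)
  have h2 : (S.φd 1 z.2 (z.1 ⬝ᵥ (β + θ • (β' - β))) - S.φd 1 z.2 (z.1 ⬝ᵥ β)) * w ≤ C₆ * w ^ 2 := by
    calc _ ≤ |(S.φd 1 z.2 (z.1 ⬝ᵥ (β + θ • (β' - β))) - S.φd 1 z.2 (z.1 ⬝ᵥ β)) * w| := le_abs_self _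
      _ ≤ (C₆ * (θ * |w|)) * |w| := by rw [abs_mul]; gcongr
      _ ≤ (C₆ * (1 * |w|)) * |w| := by gcongr; exact hθ.2
      _ = C₆ * |w| ^ 2 := by ring
      _ = _ := by rw [sq_abs]
  simp only [zero_add]
  linarith

lemma ae_regular_generic (h : S.BoundedDerivatives C₆ C₇) :
    ∀ᵐ ω ∂P, S.Regular C₆ C₇ (S.X₀ ω, S.Y₀ ω) := by
  filter_upwards [h] with ω hω
  refine ⟨fun β => (hω β).1, fun β β' => ?_⟩
  obtain ⟨θ, -, e⟩ := exists_mem_Icc_sub_eq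
    (fun b => S.hasDerivAt_φd (k := 2) (by norm_num) (S.Y₀ ω) b) (S.X₀ ω ⬝ᵥ β') (S.X₀ ω ⬝ᵥ β)
  have e2 : S.X₀ ω ⬝ᵥ β' + θ * (S.X₀ ω ⬝ᵥ β - S.X₀ ω ⬝ᵥ β') =
      S.X₀ ω ⬝ᵥ (β' + θ • (β - β')) := by
    rw [dotProduct_add, dotProduct_smul, dotProduct_sub, smul_eq_mul]
  simp only
  rw [e, e2, abs_mul]
  have := (hω (β' + θ • (β - β'))).2
  gcongr

lemma ae_regular (h : S.BoundedDerivatives C₆ C₇) :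
    ∀ᵐ ω ∂P, ∀ i, S.Regular C₆ C₇ (S.X i ω, S.Y i ω) :=
  ae_all_iff.2 fun i => (S.identDistrib i).symm.ae_snd (S.measurableSet_regular C₆ C₇)
    (ae_regular_generic h)

/-! ### Population identities -/

/-- First-order optimality of `βbar`. The curvature bound makes the excess loss in direction `t v`
at most `t E[(vᵀX₀) φ₁] + O(t²)`, and it is nonnegative for every `t`, so that no differentiation
under the integral is needed. -/
lemma integral_dotProduct_mul_score_eq_zero (h6 : 0 ≤ C₆)
    (h : S.BoundedDerivatives C₆ C₇) {v : Fin p → ℝ}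
    (h1 : Integrable (fun ω => (v ⬝ᵥ S.X₀ ω) * S.score (S.X₀ ω, S.Y₀ ω)) P)
    (h2 : Integrable (fun ω => (v ⬝ᵥ S.X₀ ω) ^ 2) P) :
    ∫ ω, (v ⬝ᵥ S.X₀ ω) * S.score (S.X₀ ω, S.Y₀ ω) ∂P = 0 := by
  have key : ∀ t : ℝ, 0 ≤ (C₆ * ∫ ω, (v ⬝ᵥ S.X₀ ω) ^ 2 ∂P) * (t * t) +
      (∫ ω, (v ⬝ᵥ S.X₀ ω) * S.score (S.X₀ ω, S.Y₀ ω) ∂P) * t + 0 := by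
    intro t
    have hmin := S.βbar_isMin (S.βbar + t • v)
    have i1 : Integrable (fun ω => t * ((v ⬝ᵥ S.X₀ ω) * S.score (S.X₀ ω, S.Y₀ ω)) +
        C₆ * t ^ 2 * (v ⬝ᵥ S.X₀ ω) ^ 2) P := (h1.const_mul t).add (h2.const_mul _)
    have hle : ∫ ω, (S.φ (S.Y₀ ω) (S.X₀ ω ⬝ᵥ (S.βbar + t • v)) - S.φ (S.Y₀ ω) (S.X₀ ω ⬝ᵥ S.βbar)) ∂P
        ≤ ∫ ω, (t * ((v ⬝ᵥ S.X₀ ω) * S.score (S.X₀ ω, S.Y₀ ω)) +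
          C₆ * t ^ 2 * (v ⬝ᵥ S.X₀ ω) ^ 2) ∂P := by
      refine integral_mono_ae ((S.integrable_loss _).sub (S.integrable_loss _)) i1 ?_
      filter_upwards [ae_regular_generic h] with ω hω
      have := hω.φ_sub_le h6 S.βbar (S.βbar + t • v)
      rw [add_sub_cancel_left, dotProduct_smul, smul_eq_mul, dotProduct_comm (S.X₀ ω) v] at this
      refine this.trans (le_of_eq ?_)
      simp only [score]; ring
    rw [integral_sub (S.integrable_loss _) (S.integrable_loss _),
      integral_add (h1.const_mul t) (h2.const_mul _), integral_const_mul, integral_const_mul] at hle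
    linarith
  have := discrim_le_zero key
  rw [discrim] at this
  simpa using this

variable (S)

lemma H_transpose : S.Hᵀ = S.H := by
  ext j k
  simp only [H, transpose_apply, of_apply, mul_comm (S.X₀ _ j)]

lemma Mstar_transpose : S.Mstarᵀ = S.Mstar := by
  rw [Mstar, transpose_nonsing_inv, H_transpose]

lemma Sig_transpose : S.Sigᵀ = S.Sig := by
  ext j k
  simp only [Sig, transpose_apply, of_apply, mul_comm (S.X₀ _ j)]

/-- A symmetric matrix moves across the inner product. -/
lemma dotProduct_mulVec_of_transpose {A : Matrix (Fin p) (Fin p) ℝ} (hA : Aᵀ = A)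
    (v w : Fin p → ℝ) : v ⬝ᵥ (A *ᵥ w) = (A *ᵥ v) ⬝ᵥ w := by
  rw [dotProduct_mulVec, ← vecMul_transpose, hA]

lemma p_ne_zero (S : Setting Ω P n p) : NeZero p := ⟨by
  rintro rfl
  exact S.ξ_ne_zero (Subsingleton.elim _ _)⟩

variable {S}

lemma H_mulVec_Mstar_mulVec {C₃ C₄ : ℝ} (hC₃ : 0 < C₃) (hE : S.EigenvalueBounds C₃ C₄) :
    S.H *ᵥ (S.Mstar *ᵥ S.ξ) = S.ξ := by
  have := S.p_ne_zero
  have hu : IsUnit S.H.det := isUnit_det_of_lamMin_inv_pos (hC₃.trans_le hE.1.2.1)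
  rw [mulVec_mulVec, Mstar, mul_nonsing_inv _ hu, one_mulVec]

lemma l2Norm_Mstar_mulVec_le {C₃ C₄ : ℝ} (hC₃ : 0 < C₃) (hC₄ : 0 ≤ C₄)
    (hE : S.EigenvalueBounds C₃ C₄) : l2Norm (S.Mstar *ᵥ S.ξ) ≤ C₄ * l2Norm S.ξ := by
  refine l2Norm_mulVec_le ?_ hC₄ (hC₃.le.trans hE.1.2.1) hE.2 _
  simpa [IsHermitian] using S.Mstar_transpose

lemma integral_dotProduct_sq (hX : ∀ j k, Integrable (fun ω => S.X₀ ω j * S.X₀ ω k) P)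
    (v : Fin p → ℝ) : ∫ ω, (v ⬝ᵥ S.X₀ ω) ^ 2 ∂P = v ⬝ᵥ (S.Sig *ᵥ v) := by
  have e : ∀ ω, (v ⬝ᵥ S.X₀ ω) ^ 2 = ∑ j, ∑ k, v j * v k * (S.X₀ ω j * S.X₀ ω k) := fun ω => by
    rw [sq, dotProduct, Finset.sum_mul_sum]
    exact Finset.sum_congr rfl fun j _ => Finset.sum_congr rfl fun k _ => by ring
  simp_rw [e]
  rw [integral_finsetSum _ fun j _ => integrable_finsetSum _ fun k _ => (hX j k).const_mul _]
  simp_rw [integral_finsetSum _ fun k _ => (hX _ k).const_mul _, integral_const_mul]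
  simp only [dotProduct, mulVec, Sig, of_apply, Finset.mul_sum]
  exact Finset.sum_congr rfl fun j _ => Finset.sum_congr rfl fun k _ => by ring

lemma integral_dotProduct_mul_curv
    (hX : ∀ j k, Integrable (fun ω => S.curv (S.X₀ ω, S.Y₀ ω) * (S.X₀ ω j * S.X₀ ω k)) P)
    (v : Fin p → ℝ) (j : Fin p) :
    ∫ ω, (v ⬝ᵥ S.X₀ ω) * S.curv (S.X₀ ω, S.Y₀ ω) * S.X₀ ω j ∂P = (S.H *ᵥ v) j := by
  have e : ∀ ω, (v ⬝ᵥ S.X₀ ω) * S.curv (S.X₀ ω, S.Y₀ ω) * S.X₀ ω j =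
      ∑ k, v k * (S.curv (S.X₀ ω, S.Y₀ ω) * (S.X₀ ω j * S.X₀ ω k)) := fun ω => by
    rw [dotProduct, Finset.sum_mul, Finset.sum_mul]
    exact Finset.sum_congr rfl fun k _ => by ring
  simp_rw [e]
  rw [integral_finsetSum _ fun k _ => (hX j k).const_mul _]
  simp_rw [integral_const_mul]
  simp only [dotProduct, mulVec, H, of_apply, curv]
  exact Finset.sum_congr rfl fun k _ => by ring

/-- The asymptotic variance is bounded below, by conditioning on the covariates. -/
lemma le_V [IsProbabilityMeasure P] {C₃ C₄ C₅ σ₂ : ℝ} (hC₅ : 0 ≤ C₅)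
    (hE : S.EigenvalueBounds C₃ C₄)
    (hscore : S.ScoreAssumption C₅ σ₂)
    (hX : ∀ j k, Integrable (fun ω => S.X₀ ω j * S.X₀ ω k) P)
    (h1 : Integrable (fun ω => S.score (S.X₀ ω, S.Y₀ ω) ^ 2) P)
    (h2 : Integrable (fun ω => ((S.Mstar *ᵥ S.ξ) ⬝ᵥ S.X₀ ω) ^ 2) P)
    (h3 : Integrable (fun ω => ((S.Mstar *ᵥ S.ξ) ⬝ᵥ S.X₀ ω) ^ 2 *
      S.score (S.X₀ ω, S.Y₀ ω) ^ 2) P) :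
    C₅ * C₃ * l2Norm S.ξ ^ 2 ≤ S.V := by
  set u := S.Mstar *ᵥ S.ξ with hu
  have hm : MeasurableSpace.comap S.X₀ inferInstance ≤ (inferInstance : MeasurableSpace Ω) :=
    S.measurable_X₀.comap_le
  have hsm : StronglyMeasurable[MeasurableSpace.comap S.X₀ inferInstance]
      (fun ω => (u ⬝ᵥ S.X₀ ω) ^ 2) := by
    have h4 : Measurable fun x : Fin p → ℝ => (u ⬝ᵥ x) ^ 2 := by unfold dotProduct; fun_prop
    exact (h4.comp (comap_measurable S.X₀)).stronglyMeasurable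
  have hce := condExp_mul_of_stronglyMeasurable_left (μ := P) hsm h3 h1
  have hV : S.V = ∫ ω, (u ⬝ᵥ S.X₀ ω) ^ 2 * S.score (S.X₀ ω, S.Y₀ ω) ^ 2 ∂P := by
    simp only [V, score, dotProduct_mulVec_of_transpose S.Mstar_transpose, hu]
  have h5 : ∫ ω, C₅ * (u ⬝ᵥ S.X₀ ω) ^ 2 ∂P ≤ S.V := by
    rw [hV]
    refine le_trans ?_ (integral_condExp hm).le
    refine integral_mono_ae (h2.const_mul _) integrable_condExp ?_
    filter_upwards [hce, hscore.2] with ω h6 h7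
    refine le_trans ?_ (le_of_eq h6.symm)
    simp only [Pi.mul_apply]
    rw [mul_comm]
    exact mul_le_mul_of_nonneg_left h7 (sq_nonneg _)
  rw [integral_const_mul, integral_dotProduct_sq hX] at h5
  have hherm : (S.Mstar * S.Sig * S.Mstar).IsHermitian := by
    simp only [IsHermitian, conjTranspose_eq_transpose_of_trivial, transpose_mul, Mstar_transpose,
      Sig_transpose, mul_assoc]
  have h8 := le_dotProduct_mulVec hherm hE.1.2.2 S.ξ
  rw [← mulVec_mulVec, ← mulVec_mulVec, dotProduct_mulVec_of_transpose S.Mstar_transpose,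
    ← l2Norm_sq] at h8
  calc C₅ * C₃ * l2Norm S.ξ ^ 2 = C₅ * (C₃ * l2Norm S.ξ ^ 2) := by ring
    _ ≤ C₅ * (u ⬝ᵥ (S.Sig *ᵥ u)) := by gcongr
    _ ≤ _ := h5

end Setting

/-! ### Deterministic inequalities for weighted sums -/

section Deterministic

variable {ι : Type*}

lemma abs_mul_sum_mul_le {s : Finset ι} {w X Y : ℝ} (hw : 0 ≤ w) {x y : ι → ℝ}
    (hx : w * ∑ i ∈ s, x i ^ 2 ≤ X) (hy : w * ∑ i ∈ s, y i ^ 2 ≤ Y) :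
    w * ∑ i ∈ s, |x i * y i| ≤ √X * √Y := by
  have h1 := Finset.sum_mul_sq_le_sq_mul_sq s (fun i => |x i|) (fun i => |y i|)
  simp only [sq_abs] at h1
  have hx0 : 0 ≤ w * ∑ i ∈ s, x i ^ 2 := mul_nonneg hw (Finset.sum_nonneg fun i _ => sq_nonneg _)
  have hy0 : 0 ≤ w * ∑ i ∈ s, y i ^ 2 := mul_nonneg hw (Finset.sum_nonneg fun i _ => sq_nonneg _)
  rw [← Real.sqrt_mul (hx0.trans hx)]
  refine Real.le_sqrt_of_sq_le ?_
  simp only [abs_mul]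
  calc (w * ∑ i ∈ s, |x i| * |y i|) ^ 2 = w ^ 2 * (∑ i ∈ s, |x i| * |y i|) ^ 2 := by ring
    _ ≤ w ^ 2 * ((∑ i ∈ s, x i ^ 2) * ∑ i ∈ s, y i ^ 2) := by gcongr
    _ = (w * ∑ i ∈ s, x i ^ 2) * (w * ∑ i ∈ s, y i ^ 2) := by ring
    _ ≤ X * Y := by gcongr; exact hx0.trans hx

/-- Perturbation of `∑ a² ε²` when the weights `a` are perturbed by `δ` and the scores `ε` by
`e = O(|g|)`. -/
lemma abs_sum_sq_mul_sq_sub_le {s : Finset ι} {w c α τ G q R W : ℝ} (hw : 0 ≤ w) (hc : 0 ≤ c)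
    (hα : 0 ≤ α) (hτ : 0 ≤ τ) {a δ ε e g : ι → ℝ} (he : ∀ i, |e i| ≤ c * |g i|)
    (hG : w * ∑ i ∈ s, g i ^ 2 ≤ G) (ha : ∀ i, |a i| ≤ α) (hε : ∀ i, |ε i| ≤ τ)
    (hq : w * ∑ i ∈ s, δ i ^ 2 ≤ q) (hR : w * ∑ i ∈ s, δ i ^ 2 * g i ^ 2 ≤ R)
    (hW : w * ∑ i ∈ s, a i ^ 2 * ε i ^ 2 ≤ W) :
    |w * ∑ i ∈ s, (a i + δ i) ^ 2 * (ε i + e i) ^ 2 - w * ∑ i ∈ s, a i ^ 2 * ε i ^ 2| ≤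
      2 * τ * (√W * √q) + 3 * τ ^ 2 * q + 4 * α * c * (√W * √G) + 2 * α ^ 2 * c ^ 2 * G +
        4 * c ^ 2 * R := by
  have hsq : ∀ {x y : ℝ}, |x| ≤ y → x ^ 2 ≤ y ^ 2 := fun h => by rw [← sq_abs]; gcongr
  have he2 : ∀ i, e i ^ 2 ≤ c ^ 2 * g i ^ 2 := fun i => by
    have := hsq (he i); rwa [mul_pow, sq_abs] at this
  have hpt : ∀ i, |(a i + δ i) ^ 2 * (ε i + e i) ^ 2 - a i ^ 2 * ε i ^ 2| ≤
      2 * τ * |(a i * ε i) * δ i| + 3 * τ ^ 2 * δ i ^ 2 + 4 * α * c * |(a i * ε i) * g i| +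
        2 * α ^ 2 * c ^ 2 * g i ^ 2 + 4 * c ^ 2 * (δ i ^ 2 * g i ^ 2) := by
    intro i
    have e1 : (a i + δ i) ^ 2 * (ε i + e i) ^ 2 - a i ^ 2 * ε i ^ 2 =
        2 * (ε i * ((a i * ε i) * δ i)) + ε i ^ 2 * δ i ^ 2 +
          (a i + δ i) ^ 2 * (2 * (ε i * e i) + e i ^ 2) := by ring
    have h1 : |2 * (ε i * ((a i * ε i) * δ i))| ≤ 2 * τ * |(a i * ε i) * δ i| := by
      rw [abs_mul, abs_mul, abs_two, mul_assoc 2 τ]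
      have := hε i
      gcongr
    have h2 : |ε i ^ 2 * δ i ^ 2| ≤ τ ^ 2 * δ i ^ 2 := by
      rw [abs_of_nonneg (by positivity)]
      have := hsq (hε i)
      gcongr
    have h3 : |(a i + δ i) ^ 2 * (2 * (ε i * e i) + e i ^ 2)| ≤
        (2 * a i ^ 2 + 2 * δ i ^ 2) * (2 * |ε i * e i| + e i ^ 2) := by
      rw [abs_mul, abs_of_nonneg (sq_nonneg (a i + δ i))]
      have h4 : (a i + δ i) ^ 2 ≤ 2 * a i ^ 2 + 2 * δ i ^ 2 := by
        nlinarith [sq_nonneg (a i - δ i)]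
      have h5 : |2 * (ε i * e i) + e i ^ 2| ≤ 2 * |ε i * e i| + e i ^ 2 := by
        refine (abs_add_le _ _).trans (le_of_eq ?_)
        rw [abs_mul, abs_two, abs_of_nonneg (sq_nonneg (e i))]
      gcongr
    have h6 : a i ^ 2 * |ε i * e i| ≤ α * c * |(a i * ε i) * g i| := by
      calc a i ^ 2 * |ε i * e i| = |a i| * (|a i * ε i| * |e i|) := by
            rw [← sq_abs, abs_mul, abs_mul]; ring
        _ ≤ α * (|a i * ε i| * (c * |g i|)) := by
            have := ha i; have := he i; gcongr
        _ = _ := by rw [abs_mul (a i * ε i)]; ring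
    have h7 : a i ^ 2 * e i ^ 2 ≤ α ^ 2 * (c ^ 2 * g i ^ 2) := by
      have := hsq (ha i); have := he2 i; gcongr
    have h8 : δ i ^ 2 * (2 * |ε i * e i|) ≤ δ i ^ 2 * (τ ^ 2 + c ^ 2 * g i ^ 2) := by
      gcongr
      have := hsq (hε i)
      have h9 : 2 * |ε i * e i| ≤ ε i ^ 2 + e i ^ 2 := by
        rw [abs_mul]
        nlinarith [sq_nonneg (|ε i| - |e i|), sq_abs (ε i), sq_abs (e i)]
      linarith [he2 i]
    have h10 : δ i ^ 2 * e i ^ 2 ≤ δ i ^ 2 * (c ^ 2 * g i ^ 2) := by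
      have := he2 i; gcongr
    rw [e1]
    refine (abs_add_three _ _ _).trans ?_
    refine (add_le_add (add_le_add h1 h2) h3).trans ?_
    nlinarith
  have hq0 : 0 ≤ q :=
    (mul_nonneg hw (Finset.sum_nonneg fun i _ => sq_nonneg (δ i))).trans hq
  have hW' : w * ∑ i ∈ s, (a i * ε i) ^ 2 ≤ W := by simpa only [mul_pow] using hW
  have k1 := abs_mul_sum_mul_le hw hW' hq
  have k2 := abs_mul_sum_mul_le hw hW' hG
  rw [← mul_sub, ← Finset.sum_sub_distrib, abs_mul, abs_of_nonneg hw]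
  calc _ ≤ w * ∑ i ∈ s, (2 * τ * |(a i * ε i) * δ i| + 3 * τ ^ 2 * δ i ^ 2 +
        4 * α * c * |(a i * ε i) * g i| + 2 * α ^ 2 * c ^ 2 * g i ^ 2 +
        4 * c ^ 2 * (δ i ^ 2 * g i ^ 2)) := by
        gcongr
        exact (Finset.abs_sum_le_sum_abs _ _).trans (Finset.sum_le_sum fun i _ => hpt i)
    _ = 2 * τ * (w * ∑ i ∈ s, |(a i * ε i) * δ i|) + 3 * τ ^ 2 * (w * ∑ i ∈ s, δ i ^ 2) +
        4 * α * c * (w * ∑ i ∈ s, |(a i * ε i) * g i|) +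
        2 * α ^ 2 * c ^ 2 * (w * ∑ i ∈ s, g i ^ 2) +
        4 * c ^ 2 * (w * ∑ i ∈ s, δ i ^ 2 * g i ^ 2) := by
        simp only [Finset.sum_add_distrib, ← Finset.mul_sum]; ring
    _ ≤ _ := by gcongr

lemma abs_dotProduct_le {p : ℕ} {v w : Fin p → ℝ} {η : ℝ} (h : ∀ j, |w j| ≤ η) :
    |v ⬝ᵥ w| ≤ l1Norm v * η := by
  rw [dotProduct, l1Norm, Finset.sum_mul]
  refine (Finset.abs_sum_le_sum_abs _ _).trans (Finset.sum_le_sum fun j _ => ?_)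
  rw [abs_mul]
  exact mul_le_mul_of_nonneg_left (h j) (abs_nonneg _)

lemma sq_dotProduct_le {p : ℕ} (v x : Fin p → ℝ) :
    (v ⬝ᵥ x) ^ 2 ≤ l1Norm v * ∑ j, |v j| * x j ^ 2 := by
  have h := Finset.sum_mul_sq_le_sq_mul_sq Finset.univ (fun j => √|v j|)
    (fun j => √|v j| * |x j|)
  simp only [mul_pow, Real.sq_sqrt (abs_nonneg _), sq_abs] at h
  refine le_trans ?_ h
  rw [← sq_abs]
  gcongr
  refine (Finset.abs_sum_le_sum_abs _ _).trans (Finset.sum_le_sum fun j _ => ?_)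
  rw [abs_mul, ← mul_assoc, Real.mul_self_sqrt (abs_nonneg _)]

end Deterministic

namespace Setting

/-! ### Algebraic form of the estimators -/

variable {Ω : Type*} [MeasurableSpace Ω] {P : Measure Ω} {n p : ℕ} (S : Setting Ω P n p)

/-- The error `(M̂ - M*) ξ` of the direction applied to the subsample `J`, where `M̂` is computed
from `Jᶜ`. -/
noncomputable def dirJ (ω : Ω) : Fin p → ℝ := (S.MhatJc ω - S.Mstar) *ᵥ S.ξ

/-- The error `(M̂ - M*) ξ` of the direction applied to the subsample `Jᶜ`, where `M̂` is computed
from `J`. -/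
noncomputable def dirJc (ω : Ω) : Fin p → ℝ := (S.MhatJ ω - S.Mstar) *ᵥ S.ξ

/-- The population direction `M* ξ`. -/
noncomputable def dir : Fin p → ℝ := S.Mstar *ᵥ S.ξ

/-- The error of the weight of observation `i` in the debiasing step: the inner product of `Xᵢ`
with the direction error of its half of the sample. -/
noncomputable def weightErr (ω : Ω) (i : Fin n) : ℝ :=
  (if i ∈ S.J then S.dirJ ω else S.dirJc ω) ⬝ᵥ S.X i ω

lemma weightErr_of_mem {ω : Ω} {i : Fin n} (hi : i ∈ S.J) :
    S.weightErr ω i = S.dirJ ω ⬝ᵥ S.X i ω := by rw [weightErr, if_pos hi]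

lemma weightErr_of_mem_compl {ω : Ω} {i : Fin n} (hi : i ∈ S.Jᶜ) :
    S.weightErr ω i = S.dirJc ω ⬝ᵥ S.X i ω := by
  rw [weightErr, if_neg (Finset.mem_compl.1 hi)]

lemma MhatJ_transpose (ω : Ω) : (S.MhatJ ω)ᵀ = S.MhatJ ω := S.symm_estJ _

lemma MhatJc_transpose (ω : Ω) : (S.MhatJc ω)ᵀ = S.MhatJc ω := S.symm_estJc _

lemma ξ_dotProduct_MhatJc {ω : Ω} {i : Fin n} (hi : i ∈ S.J) :
    S.ξ ⬝ᵥ (S.MhatJc ω *ᵥ S.X i ω) = S.dir ⬝ᵥ S.X i ω + S.weightErr ω i := by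
  rw [dotProduct_mulVec_of_transpose (S.MhatJc_transpose ω), weightErr_of_mem S hi, dir, dirJ,
    sub_mulVec, ← add_dotProduct, add_sub_cancel]

lemma ξ_dotProduct_MhatJ {ω : Ω} {i : Fin n} (hi : i ∈ S.Jᶜ) :
    S.ξ ⬝ᵥ (S.MhatJ ω *ᵥ S.X i ω) = S.dir ⬝ᵥ S.X i ω + S.weightErr ω i := by
  rw [dotProduct_mulVec_of_transpose (S.MhatJ_transpose ω), weightErr_of_mem_compl S hi, dir, dirJc,
    sub_mulVec, ← add_dotProduct, add_sub_cancel]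

lemma dotProduct_mulVec_smul_sum (A : Matrix (Fin p) (Fin p) ℝ) (s : Finset (Fin n)) (w : ℝ)
    (c : Fin n → ℝ) (x : Fin n → Fin p → ℝ) (v : Fin p → ℝ) :
    v ⬝ᵥ (A *ᵥ (w • ∑ i ∈ s, c i • x i)) = w * ∑ i ∈ s, (v ⬝ᵥ (A *ᵥ x i)) * c i := by
  rw [mulVec_smul, dotProduct_smul, smul_eq_mul, dotProduct_mulVec, dotProduct_sum]
  congr 1
  refine Finset.sum_congr rfl fun i _ => ?_
  rw [dotProduct_smul, smul_eq_mul, dotProduct_mulVec, mul_comm]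

lemma debiased_eq (ω : Ω) : S.debiased ω = S.ξ ⬝ᵥ S.βhat ω - 1 / (n : ℝ) *
    ∑ i, (S.dir ⬝ᵥ S.X i ω + S.weightErr ω i) * S.φd 1 (S.Y i ω) (S.X i ω ⬝ᵥ S.βhat ω) := by
  rw [debiased, dotProduct_mulVec_smul_sum, dotProduct_mulVec_smul_sum,
    ← Finset.sum_add_sum_compl S.J, mul_add, ← sub_sub]
  congr 1
  · congr 2
    exact Finset.sum_congr rfl fun i hi => by rw [S.ξ_dotProduct_MhatJc hi]
  · congr 1
    exact Finset.sum_congr rfl fun i hi => by rw [S.ξ_dotProduct_MhatJ hi]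

lemma Vhat_eq (ω : Ω) : S.Vhat ω = 1 / (n : ℝ) *
    ∑ i, (S.dir ⬝ᵥ S.X i ω + S.weightErr ω i) ^ 2 *
      S.φd 1 (S.Y i ω) (S.X i ω ⬝ᵥ S.βhat ω) ^ 2 := by
  rw [Vhat, ← Finset.sum_add_sum_compl S.J, mul_add]
  congr 1
  · congr 1
    exact Finset.sum_congr rfl fun i hi => by rw [S.ξ_dotProduct_MhatJc hi]
  · congr 1
    exact Finset.sum_congr rfl fun i hi => by rw [S.ξ_dotProduct_MhatJ hi]

lemma dotProduct_mul_sum_vecMulVec_mul {A : Matrix (Fin p) (Fin p) ℝ} (hA : Aᵀ = A)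
    (s : Finset (Fin n)) (w : ℝ) (x : Fin n → Fin p → ℝ) (v : Fin p → ℝ) :
    v ⬝ᵥ ((A * (∑ i ∈ s, w • vecMulVec (x i) (x i)) * A) *ᵥ v) =
      w * ∑ i ∈ s, ((A *ᵥ v) ⬝ᵥ x i) ^ 2 := by
  rw [← mulVec_mulVec, ← mulVec_mulVec, dotProduct_mulVec_of_transpose hA, sum_mulVec,
    dotProduct_sum, Finset.mul_sum]
  refine Finset.sum_congr rfl fun i _ => ?_
  rw [smul_mulVec, dotProduct_smul, vecMulVec_mulVec, smul_eq_mul]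
  simp only [op_smul_eq_smul, dotProduct_smul, smul_eq_mul]
  rw [dotProduct_comm (x i), sq]

lemma Q₁_eq (ω : Ω) : S.Q₁ ω = 1 / (n : ℝ) * ∑ i ∈ S.J, S.weightErr ω i ^ 2 := by
  have hs : (S.MhatJc ω - S.Mstar)ᵀ = S.MhatJc ω - S.Mstar := by
    rw [transpose_sub, MhatJc_transpose, Mstar_transpose]
  rw [Q₁, dotProduct_mul_sum_vecMulVec_mul hs]
  congr 1
  exact Finset.sum_congr rfl fun i hi => by rw [S.weightErr_of_mem hi, dirJ]

lemma Q₁'_eq (ω : Ω) : S.Q₁' ω = 1 / (n : ℝ) * ∑ i ∈ S.Jᶜ, S.weightErr ω i ^ 2 := by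
  have hs : (S.MhatJ ω - S.Mstar)ᵀ = S.MhatJ ω - S.Mstar := by
    rw [transpose_sub, MhatJ_transpose, Mstar_transpose]
  rw [Q₁', dotProduct_mul_sum_vecMulVec_mul hs]
  congr 1
  exact Finset.sum_congr rfl fun i hi => by rw [S.weightErr_of_mem_compl hi, dirJc]

lemma Q₁_nonneg (ω : Ω) : 0 ≤ S.Q₁ ω := by
  rw [Q₁_eq]; exact mul_nonneg (by positivity) (Finset.sum_nonneg fun i _ => sq_nonneg _)

lemma Q₁'_nonneg (ω : Ω) : 0 ≤ S.Q₁' ω := by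
  rw [Q₁'_eq]; exact mul_nonneg (by positivity) (Finset.sum_nonneg fun i _ => sq_nonneg _)

lemma mul_sum_weightErr_sq (ω : Ω) :
    1 / (n : ℝ) * ∑ i, S.weightErr ω i ^ 2 = S.Q₁ ω + S.Q₁' ω := by
  rw [Q₁_eq, Q₁'_eq, ← mul_add, Finset.sum_add_sum_compl]

lemma sqrt_Q_add_le (ω : Ω) : √(S.Q₁ ω + S.Q₁' ω) ≤ √(S.Q₁ ω) + √(S.Q₁' ω) :=
  Real.sqrt_le_iff.2 ⟨by positivity, by
    nlinarith [Real.sq_sqrt (S.Q₁_nonneg ω), Real.sq_sqrt (S.Q₁'_nonneg ω),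
      mul_nonneg (Real.sqrt_nonneg (S.Q₁ ω)) (Real.sqrt_nonneg (S.Q₁' ω))]⟩

end Setting

namespace Setting

/-! ### The bounds on the good event -/

variable {Ω : Type*} [MeasurableSpace Ω] {P : Measure Ω} {n p : ℕ} (S : Setting Ω P n p)

/-- The event on which the bounds hold. The norm `N` measures the direction errors, `K`, `Ka`, `Ke`
are sub-Gaussian scales of the covariates, of `ξᵀM*X₀` and of the score, and `r` is `n^(1/3)`. -/
structure GoodEvent (N : (Fin p → ℝ) → ℝ) (c C₁ C₆ C₇ K Ka Ke r : ℝ) (ω : Ω) : Prop where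
  regular : ∀ i, S.Regular C₆ C₇ (S.X i ω, S.Y i ω)
  l1Norm_le : l1Norm (S.βhat ω - S.βbar) ≤ C₁ * S.s₀ * √(S.logpn / n)
  pred_le : 1 / (n : ℝ) * ∑ i, (S.X i ω ⬝ᵥ S.βhat ω - S.X i ω ⬝ᵥ S.βbar) ^ 2 ≤
    C₁ * S.s₀ * (S.logpn / n)
  dir_le : ∀ i, |S.dir ⬝ᵥ S.X i ω| ≤ 2 * Ka * √(Real.log n)
  score_le : ∀ i, |S.score (S.X i ω, S.Y i ω)| ≤ 2 * Ke * √(Real.log n)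
  hessian_le : ∀ j, |∑ i, ((S.dir ⬝ᵥ S.X i ω) * S.curv (S.X i ω, S.Y i ω) * S.X i ω j - S.ξ j)| ≤
    (8 * √c + 8 / √c) * (C₆ * (Ka * K)) * √(n * S.logpn)
  dirJ_linear : |∑ i ∈ S.J, (S.dirJ ω ⬝ᵥ S.X i ω) * S.score (S.X i ω, S.Y i ω)| ≤
    (8 * √c + 8 / √c) * (K * N (S.dirJ ω) * Ke) * √(n * S.logpn)
  dirJ_quartic : ∀ j, ∑ i ∈ S.J, (S.dirJ ω ⬝ᵥ S.X i ω) ^ 2 * S.X i ω j ^ 2 ≤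
    n * ((32 + 96 * c) * (K * N (S.dirJ ω) * K) ^ 2)
  dirJc_linear : |∑ i ∈ S.Jᶜ, (S.dirJc ω ⬝ᵥ S.X i ω) * S.score (S.X i ω, S.Y i ω)| ≤
    (8 * √c + 8 / √c) * (K * N (S.dirJc ω) * Ke) * √(n * S.logpn)
  dirJc_quartic : ∀ j, ∑ i ∈ S.Jᶜ, (S.dirJc ω ⬝ᵥ S.X i ω) ^ 2 * S.X i ω j ^ 2 ≤
    n * ((32 + 96 * c) * (K * N (S.dirJc ω) * K) ^ 2)
  variance_le : |∑ i, ((S.dir ⬝ᵥ S.X i ω) / Ka) ^ 2 * (S.score (S.X i ω, S.Y i ω) / Ke) ^ 2 -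
    n * ∫ ω', ((S.dir ⬝ᵥ S.X₀ ω') / Ka) ^ 2 * (S.score (S.X₀ ω', S.Y₀ ω') / Ke) ^ 2 ∂P| ≤
      4032 * n / r

lemma s₀_nonneg : 0 ≤ S.s₀ := Nat.cast_nonneg _

lemma logpn_nonneg : 0 ≤ S.logpn := Real.log_natCast_nonneg _

variable {S} {N : (Fin p → ℝ) → ℝ} {c C₁ C₆ C₇ K Ka Ke r : ℝ} {ω : Ω}

lemma GoodEvent.pred_le' (h : S.GoodEvent N c C₁ C₆ C₇ K Ka Ke r ω) :
    1 / (n : ℝ) * ∑ i, (S.X i ω ⬝ᵥ (S.βhat ω - S.βbar)) ^ 2 ≤ C₁ * S.s₀ * (S.logpn / n) := by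
  simpa only [dotProduct_sub] using h.pred_le

lemma GoodEvent.abs_expansion_le (h : S.GoodEvent N c C₁ C₆ C₇ K Ka Ke r ω) (hn : 0 < n)
    (h6 : 0 ≤ C₆) (h7 : 0 ≤ C₇) (hKa : 0 ≤ Ka) :
    |S.debiased ω - S.ξ ⬝ᵥ S.βbar + 1 / (n : ℝ) *
      ∑ i, (S.dir ⬝ᵥ S.X i ω) * S.score (S.X i ω, S.Y i ω)| ≤
    1 / (n : ℝ) * ((8 * √c + 8 / √c) * (K * N (S.dirJ ω) * Ke) * √(n * S.logpn)) +
    1 / (n : ℝ) * ((8 * √c + 8 / √c) * (K * N (S.dirJc ω) * Ke) * √(n * S.logpn)) +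
    C₆ * (√(S.Q₁ ω + S.Q₁' ω) * √(C₁ * S.s₀ * (S.logpn / n))) +
    (C₁ * S.s₀ * √(S.logpn / n)) *
      (1 / (n : ℝ) * ((8 * √c + 8 / √c) * (C₆ * (Ka * K)) * √(n * S.logpn))) +
    C₇ * (2 * Ka * √(Real.log n)) * (C₁ * S.s₀ * (S.logpn / n)) := by
  have hn' : (0 : ℝ) < n := by exact_mod_cast hn
  set ν : ℝ := 1 / (n : ℝ) with hν
  have hν0 : 0 ≤ ν := by positivity
  set a : Fin n → ℝ := fun i => S.dir ⬝ᵥ S.X i ω with ha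
  set δ : Fin n → ℝ := S.weightErr ω with hδ
  set ε : Fin n → ℝ := fun i => S.score (S.X i ω, S.Y i ω) with hε
  set κ : Fin n → ℝ := fun i => S.curv (S.X i ω, S.Y i ω) with hκ
  set f : Fin n → ℝ := fun i => S.φd 1 (S.Y i ω) (S.X i ω ⬝ᵥ S.βhat ω) with hf
  set d := S.βhat ω - S.βbar with hd
  set g : Fin n → ℝ := fun i => S.X i ω ⬝ᵥ d with hg
  have he : ∀ i, |f i - ε i| ≤ C₆ * |g i| := fun i => (h.regular i).abs_φd_one_sub_le _ _
  have hρ : ∀ i, |f i - ε i - κ i * g i| ≤ C₇ * g i ^ 2 := fun i =>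
    (h.regular i).abs_φd_one_taylor_le h7 _ _
  have hG := h.pred_le'
  -- The linear term of the expansion, through the identity `ξ = H M* ξ`.
  have hlin : S.ξ ⬝ᵥ d - ν * ∑ i, a i * κ i * g i =
      d ⬝ᵥ fun j => -(ν * ∑ i, (a i * κ i * S.X i ω j - S.ξ j)) := by
    have e1 : d ⬝ᵥ (fun j => -(ν * ∑ i, (a i * κ i * S.X i ω j - S.ξ j))) =
        ∑ j, (S.ξ j * d j - ν * ∑ i, a i * κ i * (S.X i ω j * d j)) := by
      simp only [dotProduct]
      refine Finset.sum_congr rfl fun j _ => ?_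
      rw [Finset.sum_sub_distrib, Finset.sum_const, Finset.card_univ, Fintype.card_fin,
        nsmul_eq_mul]
      have e2 : ∑ i, a i * κ i * (S.X i ω j * d j) = (∑ i, a i * κ i * S.X i ω j) * d j := by
        rw [Finset.sum_mul]; exact Finset.sum_congr rfl fun i _ => by ring
      rw [e2, hν]
      field_simp
      ring
    rw [e1, Finset.sum_sub_distrib, ← Finset.mul_sum, Finset.sum_comm]
    simp only [hg, dotProduct, Finset.mul_sum]
  have hdec : S.debiased ω - S.ξ ⬝ᵥ S.βbar + ν * ∑ i, a i * ε i =
      -(ν * ∑ i, δ i * ε i) - ν * ∑ i, δ i * (f i - ε i) +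
        (S.ξ ⬝ᵥ d - ν * ∑ i, a i * κ i * g i) - ν * ∑ i, a i * (f i - ε i - κ i * g i) := by
    rw [debiased_eq, hd, dotProduct_sub]
    simp only [mul_sub, add_mul, Finset.sum_sub_distrib, Finset.sum_add_distrib, mul_add, hf, ha, hδ,
      mul_assoc, hν]
    ring
  have b1 : |ν * ∑ i, δ i * ε i| ≤
      ν * ((8 * √c + 8 / √c) * (K * N (S.dirJ ω) * Ke) * √(n * S.logpn)) +
      ν * ((8 * √c + 8 / √c) * (K * N (S.dirJc ω) * Ke) * √(n * S.logpn)) := by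
    rw [← Finset.sum_add_sum_compl S.J, abs_mul, abs_of_nonneg hν0, ← mul_add]
    refine mul_le_mul_of_nonneg_left ((abs_add_le _ _).trans (add_le_add ?_ ?_)) hν0
    · refine le_trans (le_of_eq ?_) h.dirJ_linear
      congr 1
      exact Finset.sum_congr rfl fun i hi => by rw [hδ, S.weightErr_of_mem hi]
    · refine le_trans (le_of_eq ?_) h.dirJc_linear
      congr 1
      exact Finset.sum_congr rfl fun i hi => by rw [hδ, S.weightErr_of_mem_compl hi]
  have b2 : |ν * ∑ i, δ i * (f i - ε i)| ≤
      C₆ * (√(S.Q₁ ω + S.Q₁' ω) * √(C₁ * S.s₀ * (S.logpn / n))) := by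
    have h1 := abs_mul_sum_mul_le hν0 (S.mul_sum_weightErr_sq ω).le hG
    rw [abs_mul, abs_of_nonneg hν0]
    calc ν * |∑ i, δ i * (f i - ε i)| ≤ ν * ∑ i, C₆ * |δ i * g i| := by
          gcongr
          refine (Finset.abs_sum_le_sum_abs _ _).trans (Finset.sum_le_sum fun i _ => ?_)
          rw [abs_mul, abs_mul]
          nlinarith [he i, abs_nonneg (δ i)]
      _ = C₆ * (ν * ∑ i, |δ i * g i|) := by rw [← Finset.mul_sum]; ring
      _ ≤ _ := by gcongr
  have b3 : |S.ξ ⬝ᵥ d - ν * ∑ i, a i * κ i * g i| ≤ (C₁ * S.s₀ * √(S.logpn / n)) *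
      (ν * ((8 * √c + 8 / √c) * (C₆ * (Ka * K)) * √(n * S.logpn))) := by
    rw [hlin]
    have hj : ∀ j, |-(ν * ∑ i, (a i * κ i * S.X i ω j - S.ξ j))| ≤
        ν * ((8 * √c + 8 / √c) * (C₆ * (Ka * K)) * √(n * S.logpn)) := fun j => by
      rw [abs_neg, abs_mul, abs_of_nonneg hν0]
      exact mul_le_mul_of_nonneg_left (h.hessian_le j) hν0
    refine (abs_dotProduct_le hj).trans (mul_le_mul_of_nonneg_right h.l1Norm_le ?_)
    have := S.p_ne_zero
    exact (abs_nonneg _).trans (hj 0)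
  have b4 : |ν * ∑ i, a i * (f i - ε i - κ i * g i)| ≤
      C₇ * (2 * Ka * √(Real.log n)) * (C₁ * S.s₀ * (S.logpn / n)) := by
    rw [abs_mul, abs_of_nonneg hν0]
    calc ν * |∑ i, a i * (f i - ε i - κ i * g i)|
        ≤ ν * ∑ i, (2 * Ka * √(Real.log n)) * (C₇ * g i ^ 2) := by
          gcongr
          refine (Finset.abs_sum_le_sum_abs _ _).trans (Finset.sum_le_sum fun i _ => ?_)
          rw [abs_mul]
          have h1 := h.dir_le i
          have h2 := hρ i
          gcongr
      _ = C₇ * (2 * Ka * √(Real.log n)) * (ν * ∑ i, g i ^ 2) := by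
          rw [← Finset.mul_sum, ← Finset.mul_sum]; ring
      _ ≤ _ := by gcongr
  rw [hdec]
  rw [abs_le] at b1 b2 b3 b4 ⊢
  constructor <;> linarith [b1.1, b1.2, b2.1, b2.2, b3.1, b3.2, b4.1, b4.2]

/-- The bound on `Δ₁` with explicit constants; `x` is `‖ξ‖₂`. -/
lemma GoodEvent.abs_Δ₁_le {cV C₄ x : ℝ} (h : S.GoodEvent N c C₁ C₆ C₇ K (K * C₄ * x) Ke r ω)
    (hn : 0 < n) (h1 : 0 ≤ C₁) (h4 : 0 ≤ C₄) (h6 : 0 ≤ C₆) (h7 : 0 ≤ C₇) (hK : 0 ≤ K)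
    (hx : 0 < x) (hcV : 0 < cV) (hV : cV * x ^ 2 ≤ S.V) :
    |S.Δ₁ ω| ≤
      ((8 * √c + 8 / √c) * (C₆ * (K * C₄ * K)) * C₁ / √cV) * (S.s₀ * (S.logpn / √n)) +
      ((8 * √c + 8 / √c) * (K * Ke) / √cV) * (√S.logpn * ((N (S.dirJc ω) + N (S.dirJ ω)) / x)) +
      (C₆ * √C₁ / √cV) * ((√(S.Q₁ ω) + √(S.Q₁' ω)) / x * √(S.s₀ * S.logpn)) +
      (2 * (K * C₄) * C₁ / √cV) * (C₇ * S.s₀ * (S.logpn * √(Real.log n) / √n)) := by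
  have hn' : (0 : ℝ) < n := by exact_mod_cast hn
  have hL := S.logpn_nonneg
  have hs := S.s₀_nonneg
  have hVpos : 0 < S.V := lt_of_lt_of_le (by positivity) hV
  have hsV : √cV * x ≤ √S.V := by
    rw [← Real.sqrt_sq hx.le, ← Real.sqrt_mul hcV.le]
    exact Real.sqrt_le_sqrt hV
  have hcV' : 0 < √cV := Real.sqrt_pos.2 hcV
  have hV' : 0 < √S.V := Real.sqrt_pos.2 hVpos
  have e : S.Δ₁ ω = √n / √S.V * (S.debiased ω - S.ξ ⬝ᵥ S.βbar + 1 / (n : ℝ) *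
      ∑ i, (S.dir ⬝ᵥ S.X i ω) * S.score (S.X i ω, S.Y i ω)) := by
    simp only [Δ₁, dotProduct_mulVec_of_transpose S.Mstar_transpose, dir, score, ← Finset.sum_div]
    ring
  have hexp := h.abs_expansion_le hn h6 h7 (by positivity)
  rw [e, abs_mul, abs_of_nonneg (by positivity)]
  set T := 1 / (n : ℝ) * ((8 * √c + 8 / √c) * (K * N (S.dirJ ω) * Ke) * √(n * S.logpn)) +
    1 / (n : ℝ) * ((8 * √c + 8 / √c) * (K * N (S.dirJc ω) * Ke) * √(n * S.logpn)) +
    C₆ * (√(S.Q₁ ω + S.Q₁' ω) * √(C₁ * S.s₀ * (S.logpn / n))) +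
    (C₁ * S.s₀ * √(S.logpn / n)) *
      (1 / (n : ℝ) * ((8 * √c + 8 / √c) * (C₆ * (K * C₄ * x * K)) * √(n * S.logpn))) +
    C₇ * (2 * (K * C₄ * x) * √(Real.log n)) * (C₁ * S.s₀ * (S.logpn / n)) with hT
  have hT0 : 0 ≤ T := (abs_nonneg _).trans hexp
  have hsn : 0 < √(n : ℝ) := Real.sqrt_pos.2 hn'
  have hnn : (n : ℝ) = √n * √n := (Real.mul_self_sqrt hn'.le).symm
  have hLL : S.logpn = √S.logpn * √S.logpn := (Real.mul_self_sqrt hL).symm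
  have hTle : √n * T ≤ x *
      ((8 * √c + 8 / √c) * (C₆ * (K * C₄ * K)) * C₁ * (S.s₀ * (S.logpn / √n)) +
      (8 * √c + 8 / √c) * (K * Ke) * (√S.logpn * ((N (S.dirJc ω) + N (S.dirJ ω)) / x)) +
      C₆ * √C₁ * ((√(S.Q₁ ω) + √(S.Q₁' ω)) / x * √(S.s₀ * S.logpn)) +
      2 * (K * C₄) * C₁ * (C₇ * S.s₀ * (S.logpn * √(Real.log n) / √n))) := by
    have e1 : √n * (C₆ * (√(S.Q₁ ω + S.Q₁' ω) * √(C₁ * S.s₀ * (S.logpn / n)))) ≤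
        x * (C₆ * √C₁ * ((√(S.Q₁ ω) + √(S.Q₁' ω)) / x * √(S.s₀ * S.logpn))) := by
      have e2 : √(C₁ * S.s₀ * (S.logpn / n)) = √C₁ * √(S.s₀ * S.logpn) / √n := by
        rw [← Real.sqrt_mul h1, ← Real.sqrt_div (by positivity)]; congr 1; ring
      calc _ = C₆ * √C₁ * (√(S.Q₁ ω + S.Q₁' ω) * √(S.s₀ * S.logpn)) := by
            rw [e2]; field_simp
        _ ≤ C₆ * √C₁ * ((√(S.Q₁ ω) + √(S.Q₁' ω)) * √(S.s₀ * S.logpn)) := by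
            have := S.sqrt_Q_add_le ω
            gcongr
        _ = _ := by field_simp
    have e3 : √n * (1 / (n : ℝ) * ((8 * √c + 8 / √c) * (K * N (S.dirJ ω) * Ke) * √(n * S.logpn)) +
        1 / (n : ℝ) * ((8 * √c + 8 / √c) * (K * N (S.dirJc ω) * Ke) * √(n * S.logpn))) =
        x * ((8 * √c + 8 / √c) * (K * Ke) *
          (√S.logpn * ((N (S.dirJc ω) + N (S.dirJ ω)) / x))) := by
      rw [Real.sqrt_mul hn'.le]
      generalize 8 * √c + 8 / √c = B
      calc _ = (√n * √n) / n * (B * (K * Ke) * √S.logpn * (N (S.dirJc ω) + N (S.dirJ ω))) := by ring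
        _ = _ := by rw [← hnn]; field_simp
    have e4 : √n * ((C₁ * S.s₀ * √(S.logpn / n)) *
        (1 / (n : ℝ) * ((8 * √c + 8 / √c) * (C₆ * (K * C₄ * x * K)) * √(n * S.logpn)))) =
        x * ((8 * √c + 8 / √c) * (C₆ * (K * C₄ * K)) * C₁ * (S.s₀ * (S.logpn / √n))) := by
      rw [Real.sqrt_mul hn'.le, Real.sqrt_div hL]
      generalize 8 * √c + 8 / √c = B
      calc _ = (√n * √n) / n * (√S.logpn * √S.logpn) *
            (x * (B * (C₆ * (K * C₄ * K)) * C₁ * (S.s₀ * (1 / √n)))) := by ring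
        _ = _ := by rw [← hnn, ← hLL]; field_simp
    have e5 : √n * (C₇ * (2 * (K * C₄ * x) * √(Real.log n)) * (C₁ * S.s₀ * (S.logpn / n))) =
        x * (2 * (K * C₄) * C₁ * (C₇ * S.s₀ * (S.logpn * √(Real.log n) / √n))) := by
      have : (1 : ℝ) / √n = √n / n := by
        rw [div_eq_div_iff hsn.ne' hn'.ne', one_mul]; exact hnn
      calc _ = √n / n * (x * (2 * (K * C₄) * C₁ * (C₇ * S.s₀ * (S.logpn * √(Real.log n))))) := by ring
        _ = _ := by rw [← this]; ring
    rw [hT, mul_add, mul_add, mul_add, e3, e4, e5]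
    linarith
  calc √n / √S.V * _ ≤ √n / √S.V * T := by gcongr
    _ = √n * T / √S.V := by ring
    _ ≤ √n * T / (√cV * x) := by gcongr
    _ ≤ _ := by
      rw [div_le_iff₀ (by positivity)]
      refine hTle.trans (le_of_eq ?_)
      field_simp

end Setting

namespace Setting

variable {Ω : Type*} [MeasurableSpace Ω] {P : Measure Ω} {n p : ℕ} {S : Setting Ω P n p}

variable {N : (Fin p → ℝ) → ℝ} {c C₁ C₆ C₇ K Ka Ke r : ℝ} {ω : Ω}

lemma V_eq_mul_integral (S : Setting Ω P n p) (hKa : Ka ≠ 0) (hKe : Ke ≠ 0) :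
    S.V = (Ka * Ke) ^ 2 *
      ∫ ω', ((S.dir ⬝ᵥ S.X₀ ω') / Ka) ^ 2 * (S.score (S.X₀ ω', S.Y₀ ω') / Ke) ^ 2 ∂P := by
  rw [← integral_const_mul]
  simp only [V, dotProduct_mulVec_of_transpose S.Mstar_transpose, dir, score]
  refine integral_congr_ae (Filter.Eventually.of_forall fun ω' => ?_)
  simp only
  field_simp

/-- A sum `∑ (vᵀXᵢ)² (hᵀXᵢ)²` is controlled by `‖h‖₁²` and the coordinatewise sums
`∑ (vᵀXᵢ)² Xᵢⱼ²`. -/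
lemma sum_sq_mul_dotProduct_sq_le {s : Finset (Fin n)} (w : Fin n → ℝ) (x : Fin n → Fin p → ℝ)
    (v : Fin p → ℝ) {T : ℝ} (h : ∀ j, ∑ i ∈ s, w i ^ 2 * x i j ^ 2 ≤ T) :
    ∑ i ∈ s, w i ^ 2 * (x i ⬝ᵥ v) ^ 2 ≤ l1Norm v ^ 2 * T := by
  calc ∑ i ∈ s, w i ^ 2 * (x i ⬝ᵥ v) ^ 2
      ≤ ∑ i ∈ s, w i ^ 2 * (l1Norm v * ∑ j, |v j| * x i j ^ 2) := by
        refine Finset.sum_le_sum fun i _ => ?_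
        have := sq_dotProduct_le v (x i)
        rw [dotProduct_comm]
        gcongr
    _ = l1Norm v * ∑ j, |v j| * ∑ i ∈ s, w i ^ 2 * x i j ^ 2 := by
        simp only [Finset.mul_sum]
        rw [Finset.sum_comm]
        exact Finset.sum_congr rfl fun j _ => Finset.sum_congr rfl fun i _ => by ring
    _ ≤ l1Norm v * ∑ j, |v j| * T := by
        have h1 := l1Norm_nonneg v
        gcongr with j
        exact h j
    _ = _ := by rw [← Finset.sum_mul, ← l1Norm]; ring

/-- The bound on `Δ₂` with explicit constants; `x` is `‖ξ‖₂`. -/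
lemma GoodEvent.abs_Δ₂_le {cV C₄ x : ℝ} (h : S.GoodEvent N c C₁ C₆ C₇ K (K * C₄ * x) Ke r ω)
    (hn : 0 < n) (hc : 0 < c) (h1 : 0 ≤ C₁) (h4 : 0 < C₄) (h6 : 0 ≤ C₆) (hK : 0 < K) (hKe : 0 < Ke)
    (hx : 0 < x) (hcV : 0 < cV) (hV : cV * x ^ 2 ≤ S.V) (hr : 1 ≤ r)
    (hm : ∫ ω', ((S.dir ⬝ᵥ S.X₀ ω') / (K * C₄ * x)) ^ 2 *
      (S.score (S.X₀ ω', S.Y₀ ω') / Ke) ^ 2 ∂P ≤ 4) :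
    |S.Δ₂ ω| ≤
      (4032 * (K * C₄ * Ke) ^ 2 / cV) * r⁻¹ +
      (8 * (K * C₄) * C₆ * √4036 * (K * C₄ * Ke) * √C₁ / cV) *
        (√S.s₀ * √(Real.log n * S.logpn / n)) +
      (8 * (K * C₄) ^ 2 * C₆ ^ 2 * C₁ / cV) * (S.s₀ * (S.logpn * Real.log n / n)) +
      (4 * Ke * √4036 * (K * C₄ * Ke) / cV) * (√(Real.log n) * (√(S.Q₁ ω) + √(S.Q₁' ω)) / x) +
      (12 * Ke ^ 2 / cV) * ((S.Q₁ ω + S.Q₁' ω) * Real.log n / x ^ 2) +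
      (4 * C₆ ^ 2 * ((32 + 96 * c) * K ^ 4) * C₁ ^ 2 / cV) *
        (S.s₀ ^ 2 * (S.logpn / n) * ((N (S.dirJc ω) ^ 2 + N (S.dirJ ω) ^ 2) / x ^ 2)) := by
  have hn' : (0 : ℝ) < n := by exact_mod_cast hn
  have hlog : 0 ≤ Real.log n := Real.log_natCast_nonneg _
  have hL := S.logpn_nonneg
  have hs := S.s₀_nonneg
  have hVpos : 0 < S.V := lt_of_lt_of_le (by positivity) hV
  set Ka := K * C₄ * x with hKa
  have hKa0 : 0 < Ka := by positivity
  set ν : ℝ := 1 / (n : ℝ) with hν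
  have hν0 : 0 ≤ ν := by positivity
  set a : Fin n → ℝ := fun i => S.dir ⬝ᵥ S.X i ω with ha
  set δ : Fin n → ℝ := S.weightErr ω with hδ
  set ε : Fin n → ℝ := fun i => S.score (S.X i ω, S.Y i ω) with hε
  set f : Fin n → ℝ := fun i => S.φd 1 (S.Y i ω) (S.X i ω ⬝ᵥ S.βhat ω) with hf
  set d := S.βhat ω - S.βbar with hd
  set g : Fin n → ℝ := fun i => S.X i ω ⬝ᵥ d with hg
  set m := ∫ ω', ((S.dir ⬝ᵥ S.X₀ ω') / Ka) ^ 2 * (S.score (S.X₀ ω', S.Y₀ ω') / Ke) ^ 2 ∂P with hmd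
  have hVm : S.V = (Ka * Ke) ^ 2 * m := S.V_eq_mul_integral hKa0.ne' hKe.ne'
  have he : ∀ i, |f i - ε i| ≤ C₆ * |g i| := fun i => (h.regular i).abs_φd_one_sub_le _ _
  -- The empirical variance at the true parameters.
  have hvar : |ν * ∑ i, a i ^ 2 * ε i ^ 2 - S.V| ≤ (Ka * Ke) ^ 2 * (4032 * r⁻¹) := by
    have e : ν * ∑ i, a i ^ 2 * ε i ^ 2 - S.V =
        (Ka * Ke) ^ 2 * (ν * (∑ i, (a i / Ka) ^ 2 * (ε i / Ke) ^ 2 - n * m)) := by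
      have e1 : ∑ i, a i ^ 2 * ε i ^ 2 = (Ka * Ke) ^ 2 * ∑ i, (a i / Ka) ^ 2 * (ε i / Ke) ^ 2 := by
        rw [Finset.mul_sum]
        exact Finset.sum_congr rfl fun i _ => by field_simp
      rw [e1, hVm, hν]
      field_simp
    rw [e, abs_mul, abs_mul, abs_of_nonneg (sq_nonneg _), abs_of_nonneg hν0]
    have h2 : |∑ i, (a i / Ka) ^ 2 * (ε i / Ke) ^ 2 - n * m| ≤ 4032 * n / r := h.variance_le
    refine mul_le_mul_of_nonneg_left ?_ (sq_nonneg _)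
    calc ν * _ ≤ ν * (4032 * n / r) := by gcongr
      _ = _ := by rw [hν]; field_simp
  have hW : ν * ∑ i, a i ^ 2 * ε i ^ 2 ≤ 4036 * (Ka * Ke) ^ 2 := by
    have h2 := (abs_le.1 hvar).2
    have h3 : r⁻¹ ≤ 1 := inv_le_one_of_one_le₀ hr
    have h4 : S.V ≤ (Ka * Ke) ^ 2 * 4 := by rw [hVm]; gcongr
    have h5 : (Ka * Ke) ^ 2 * (4032 * r⁻¹) ≤ (Ka * Ke) ^ 2 * (4032 * 1) := by gcongr
    linarith
  set T := (32 + 96 * c) * K ^ 4 with hT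
  have hR : ν * ∑ i, δ i ^ 2 * g i ^ 2 ≤
      (C₁ * S.s₀ * √(S.logpn / n)) ^ 2 * (T * (N (S.dirJc ω) ^ 2 + N (S.dirJ ω) ^ 2)) := by
    have k1 := sum_sq_mul_dotProduct_sq_le (fun i => S.dirJ ω ⬝ᵥ S.X i ω) (fun i => S.X i ω) d
      h.dirJ_quartic
    have k2 := sum_sq_mul_dotProduct_sq_le (fun i => S.dirJc ω ⬝ᵥ S.X i ω) (fun i => S.X i ω) d
      h.dirJc_quartic
    have k3 : l1Norm d ^ 2 ≤ (C₁ * S.s₀ * √(S.logpn / n)) ^ 2 :=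
      pow_le_pow_left₀ (l1Norm_nonneg d) h.l1Norm_le 2
    rw [← Finset.sum_add_sum_compl S.J]
    have s1 : ∑ i ∈ S.J, δ i ^ 2 * g i ^ 2 =
        ∑ i ∈ S.J, (S.dirJ ω ⬝ᵥ S.X i ω) ^ 2 * (S.X i ω ⬝ᵥ d) ^ 2 :=
      Finset.sum_congr rfl fun i hi => by rw [hδ, S.weightErr_of_mem hi]
    have s2 : ∑ i ∈ S.Jᶜ, δ i ^ 2 * g i ^ 2 =
        ∑ i ∈ S.Jᶜ, (S.dirJc ω ⬝ᵥ S.X i ω) ^ 2 * (S.X i ω ⬝ᵥ d) ^ 2 :=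
      Finset.sum_congr rfl fun i hi => by rw [hδ, S.weightErr_of_mem_compl hi]
    rw [s1, s2]
    calc _ ≤ ν * (l1Norm d ^ 2 * (n * ((32 + 96 * c) * (K * N (S.dirJ ω) * K) ^ 2)) +
          l1Norm d ^ 2 * (n * ((32 + 96 * c) * (K * N (S.dirJc ω) * K) ^ 2))) := by gcongr
      _ = l1Norm d ^ 2 * (T * (N (S.dirJc ω) ^ 2 + N (S.dirJ ω) ^ 2)) := by
          rw [hν, hT]; field_simp; ring
      _ ≤ _ := by gcongr
  have hmain := abs_sum_sq_mul_sq_sub_le (s := Finset.univ) hν0 h6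
    (by positivity : 0 ≤ 2 * Ka * √(Real.log n)) (by positivity : 0 ≤ 2 * Ke * √(Real.log n))
    he h.pred_le' h.dir_le h.score_le (S.mul_sum_weightErr_sq ω).le hR hW
  have hVh : S.Vhat ω = ν * ∑ i, (a i + δ i) ^ 2 * (ε i + (f i - ε i)) ^ 2 := by
    rw [Vhat_eq]
    simp only [add_sub_cancel, hf, ha, hδ, hν]
  rw [← hVh] at hmain
  have e : S.Δ₂ ω = (S.Vhat ω - S.V) / S.V := by
    rw [Δ₂, sub_div, div_self hVpos.ne']
  rw [e, abs_div, abs_of_pos hVpos, div_le_iff₀ hVpos]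
  have hsW : √(4036 * (Ka * Ke) ^ 2) = √4036 * (Ka * Ke) := by
    rw [Real.sqrt_mul (by norm_num), Real.sqrt_sq (by positivity)]
  have hsG : √(C₁ * S.s₀ * (S.logpn / n)) = √C₁ * √(S.s₀ * (S.logpn / n)) := by
    rw [mul_assoc, Real.sqrt_mul h1]
  have hslog : √(Real.log n) * √(S.s₀ * (S.logpn / n)) =
      √S.s₀ * √(Real.log n * S.logpn / n) := by
    rw [← Real.sqrt_mul hlog, ← Real.sqrt_mul hs]; congr 1; ring
  have hllog : √(Real.log n) ^ 2 = Real.log n := Real.sq_sqrt hlog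
  have hq := S.sqrt_Q_add_le ω
  have hQ := S.Q₁_nonneg ω
  have hQ' := S.Q₁'_nonneg ω
  calc |S.Vhat ω - S.V|
      ≤ |S.Vhat ω - ν * ∑ i, a i ^ 2 * ε i ^ 2| + |ν * ∑ i, a i ^ 2 * ε i ^ 2 - S.V| :=
        abs_sub_le _ _ _
    _ ≤ _ := add_le_add hmain hvar
    _ ≤ (4032 * (K * C₄ * Ke) ^ 2 * r⁻¹ +
      8 * (K * C₄) * C₆ * √4036 * (K * C₄ * Ke) * √C₁ *
        (√S.s₀ * √(Real.log n * S.logpn / n)) +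
      8 * (K * C₄) ^ 2 * C₆ ^ 2 * C₁ * (S.s₀ * (S.logpn * Real.log n / n)) +
      4 * Ke * √4036 * (K * C₄ * Ke) * (√(Real.log n) * (√(S.Q₁ ω) + √(S.Q₁' ω)) / x) +
      12 * Ke ^ 2 * ((S.Q₁ ω + S.Q₁' ω) * Real.log n / x ^ 2) +
      4 * C₆ ^ 2 * T * C₁ ^ 2 *
        (S.s₀ ^ 2 * (S.logpn / n) * ((N (S.dirJc ω) ^ 2 + N (S.dirJ ω) ^ 2) / x ^ 2))) * x ^ 2 := by
        rw [hsW, hsG]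
        have t1 : 2 * (2 * Ke * √(Real.log n)) * (√4036 * (Ka * Ke) * √(S.Q₁ ω + S.Q₁' ω)) ≤
            4 * Ke * √4036 * (K * C₄ * Ke) *
              (√(Real.log n) * (√(S.Q₁ ω) + √(S.Q₁' ω)) / x) * x ^ 2 := by
          calc _ ≤ 2 * (2 * Ke * √(Real.log n)) *
                (√4036 * (Ka * Ke) * (√(S.Q₁ ω) + √(S.Q₁' ω))) := by gcongr
            _ = _ := by rw [hKa]; field_simp; ring
        have t2 : 3 * (2 * Ke * √(Real.log n)) ^ 2 * (S.Q₁ ω + S.Q₁' ω) =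
            12 * Ke ^ 2 * ((S.Q₁ ω + S.Q₁' ω) * Real.log n / x ^ 2) * x ^ 2 := by
          rw [mul_pow, mul_pow, hllog]; field_simp; ring
        have t3 : 4 * (2 * Ka * √(Real.log n)) * C₆ *
            (√4036 * (Ka * Ke) * (√C₁ * √(S.s₀ * (S.logpn / n)))) =
            8 * (K * C₄) * C₆ * √4036 * (K * C₄ * Ke) * √C₁ *
              (√S.s₀ * √(Real.log n * S.logpn / n)) * x ^ 2 := by
          rw [← hslog, hKa]; ring
        have t4 : 2 * (2 * Ka * √(Real.log n)) ^ 2 * C₆ ^ 2 * (C₁ * S.s₀ * (S.logpn / n)) =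
            8 * (K * C₄) ^ 2 * C₆ ^ 2 * C₁ * (S.s₀ * (S.logpn * Real.log n / n)) * x ^ 2 := by
          rw [mul_pow, mul_pow, hllog, hKa]; ring
        have t5 : 4 * C₆ ^ 2 * ((C₁ * S.s₀ * √(S.logpn / n)) ^ 2 *
            (T * (N (S.dirJc ω) ^ 2 + N (S.dirJ ω) ^ 2))) =
            4 * C₆ ^ 2 * T * C₁ ^ 2 * (S.s₀ ^ 2 * (S.logpn / n) *
              ((N (S.dirJc ω) ^ 2 + N (S.dirJ ω) ^ 2) / x ^ 2)) * x ^ 2 := by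
          rw [mul_pow, Real.sq_sqrt (by positivity)]; field_simp
        have t6 : (Ka * Ke) ^ 2 * (4032 * r⁻¹) = 4032 * (K * C₄ * Ke) ^ 2 * r⁻¹ * x ^ 2 := by
          rw [hKa]; ring
        rw [t2, t3, t4, t5, t6]
        linarith
    _ ≤ _ := by
        have hB : 0 ≤ (4032 * (K * C₄ * Ke) ^ 2 * r⁻¹ +
          8 * (K * C₄) * C₆ * √4036 * (K * C₄ * Ke) * √C₁ *
            (√S.s₀ * √(Real.log n * S.logpn / n)) +
          8 * (K * C₄) ^ 2 * C₆ ^ 2 * C₁ * (S.s₀ * (S.logpn * Real.log n / n)) +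
          4 * Ke * √4036 * (K * C₄ * Ke) * (√(Real.log n) * (√(S.Q₁ ω) + √(S.Q₁' ω)) / x) +
          12 * Ke ^ 2 * ((S.Q₁ ω + S.Q₁' ω) * Real.log n / x ^ 2) +
          4 * C₆ ^ 2 * T * C₁ ^ 2 * (S.s₀ ^ 2 * (S.logpn / n) *
            ((N (S.dirJc ω) ^ 2 + N (S.dirJ ω) ^ 2) / x ^ 2))) := by positivity
        have h2 : x ^ 2 ≤ S.V / cV := by rw [le_div_iff₀ hcV]; linarith
        refine (mul_le_mul_of_nonneg_left h2 hB).trans (le_of_eq ?_)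
        field_simp

end Setting

namespace Setting

/-! ### The good event has high probability -/

variable {Ω : Type*} [MeasurableSpace Ω] {P : Measure Ω} {n p : ℕ} (S : Setting Ω P n p)

/-- The sub-Gaussianity used for both parts: `N` is a norm for which `vᵀX₀` has sub-Gaussian scale
`K N(v)`. For entrywise sub-Gaussian covariates it is the `ℓ₁` norm, for a sub-Gaussian covariate
vector the `ℓ₂` norm. -/
structure SubGaussianDesign (N : (Fin p → ℝ) → ℝ) (K Ka Ke : ℝ) : Prop where
  measurable_N : Measurable N
  norm_zero : N 0 = 0
  norm_nonneg : ∀ v, 0 ≤ N v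
  subG_dotProduct : ∀ v, v ≠ 0 → SubG P (fun ω => v ⬝ᵥ S.X₀ ω) (K * N v)
  subG_entry : ∀ j, SubG P (fun ω => S.X₀ ω j) K
  subG_dir : SubG P (fun ω => S.dir ⬝ᵥ S.X₀ ω) Ka
  subG_score : SubG P (fun ω => S.score (S.X₀ ω, S.Y₀ ω)) Ke

lemma measurable_mulVec_sub {A : Type*} [MeasurableSpace A] {F : A → Matrix (Fin p) (Fin p) ℝ}
    (hF : ∀ j k, Measurable fun d => F d j k) (M : Matrix (Fin p) (Fin p) ℝ) (v : Fin p → ℝ) :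
    Measurable fun d => (F d - M) *ᵥ v := by
  refine measurable_pi_iff.2 fun j => ?_
  simp only [mulVec, dotProduct, Matrix.sub_apply]
  exact Finset.measurable_sum _ fun k _ => ((hF j k).sub_const _).mul_const _

variable [IsProbabilityMeasure P] {S} {N : (Fin p → ℝ) → ℝ} {c C₁ C₆ C₇ K Ka Ke r : ℝ}

/-- Control of the linear and quartic sums on the subsample `s` along a direction computed from a
disjoint subsample `t`. -/
lemma SubGaussianDesign.measureReal_not_direction_le (hD : S.SubGaussianDesign N K Ka Ke)
    (hBD : S.BoundedDerivatives C₆ C₇) (h6 : 0 ≤ C₆) (hn : 5 ≤ n)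
    (hr : 0 < r) (hrn : r ^ 3 = n) (hc : 0 < c) (hl : S.logpn ≤ c * r ^ 2)
    (hnl : Real.log n ≤ S.logpn) (hpl : (p : ℝ) ≤ Real.exp S.logpn)
    {s t : Finset (Fin n)} (hst : Disjoint s t)
    {D : ({i // i ∈ t} → (Fin p → ℝ) × ℝ) → Fin p → ℝ} (hDm : Measurable D)
    {v : Ω → Fin p → ℝ} (hv : ∀ ω, v ω = D fun i => (S.X i ω, S.Y i ω)) :
    P.real {ω | ¬ (|∑ i ∈ s, (v ω ⬝ᵥ S.X i ω) * S.score (S.X i ω, S.Y i ω)| ≤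
        (8 * √c + 8 / √c) * (K * N (v ω) * Ke) * √(n * S.logpn) ∧
      ∀ j, ∑ i ∈ s, (v ω ⬝ᵥ S.X i ω) ^ 2 * S.X i ω j ^ 2 ≤
        n * ((32 + 96 * c) * (K * N (v ω) * K) ^ 2))} ≤ 1 / (n : ℝ) := by
  have hZ : ∀ i, Measurable fun ω => (S.X i ω, S.Y i ω) := fun i =>
    (S.measurable_X i).prodMk (S.measurable_Y i)
  have hind := S.indep.indepFun_finset s t hst hZ
  have hNm := hD.measurable_N
  have hsm := S.measurable_score
  set bad : Set (({i // i ∈ s} → (Fin p → ℝ) × ℝ) × ({i // i ∈ t} → (Fin p → ℝ) × ℝ)) :=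
    {w | |∑ i, (D w.2 ⬝ᵥ (w.1 i).1) * S.score (w.1 i)| ≤
        (8 * √c + 8 / √c) * (K * N (D w.2) * Ke) * √(n * S.logpn) ∧
      ∀ j, ∑ i, (D w.2 ⬝ᵥ (w.1 i).1) ^ 2 * (w.1 i).1 j ^ 2 ≤
        n * ((32 + 96 * c) * (K * N (D w.2) * K) ^ 2)}ᶜ with hbad
  have hDj : ∀ k, Measurable fun w : ({i // i ∈ s} → (Fin p → ℝ) × ℝ) ×
      ({i // i ∈ t} → (Fin p → ℝ) × ℝ) => D w.2 k := fun k =>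
    (measurable_pi_apply k).comp (hDm.comp measurable_snd)
  have hw : ∀ i, Measurable fun w : ({i // i ∈ s} → (Fin p → ℝ) × ℝ) ×
      ({i // i ∈ t} → (Fin p → ℝ) × ℝ) => w.1 i := fun i => by fun_prop
  have hND : Measurable fun w : ({i // i ∈ s} → (Fin p → ℝ) × ℝ) ×
      ({i // i ∈ t} → (Fin p → ℝ) × ℝ) => N (D w.2) := hNm.comp (hDm.comp measurable_snd)
  have hdot : ∀ i, Measurable fun w : ({i // i ∈ s} → (Fin p → ℝ) × ℝ) ×
      ({i // i ∈ t} → (Fin p → ℝ) × ℝ) => D w.2 ⬝ᵥ (w.1 i).1 := fun i => by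
    unfold dotProduct
    refine Finset.measurable_sum _ fun k _ => (hDj k).mul ?_
    fun_prop
  have hbadm : MeasurableSet bad := by
    refine MeasurableSet.compl (MeasurableSet.inter ?_ ?_)
    · refine measurableSet_le (measurable_norm.comp (Finset.measurable_sum _ fun i _ =>
        (hdot i).mul (hsm.comp (hw i)))) ?_
      exact (((hND.const_mul K).mul_const Ke).const_mul _).mul_const _
    · have : {w : ({i // i ∈ s} → (Fin p → ℝ) × ℝ) × ({i // i ∈ t} → (Fin p → ℝ) × ℝ) |
          ∀ j, ∑ i, (D w.2 ⬝ᵥ (w.1 i).1) ^ 2 * (w.1 i).1 j ^ 2 ≤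
            n * ((32 + 96 * c) * (K * N (D w.2) * K) ^ 2)} = ⋂ j, {w |
          ∑ i, (D w.2 ⬝ᵥ (w.1 i).1) ^ 2 * (w.1 i).1 j ^ 2 ≤
            n * ((32 + 96 * c) * (K * N (D w.2) * K) ^ 2)} := by
        ext w; simp
      change MeasurableSet {w : ({i // i ∈ s} → (Fin p → ℝ) × ℝ) × ({i // i ∈ t} → (Fin p → ℝ) × ℝ) |
          ∀ j, ∑ i, (D w.2 ⬝ᵥ (w.1 i).1) ^ 2 * (w.1 i).1 j ^ 2 ≤
            n * ((32 + 96 * c) * (K * N (D w.2) * K) ^ 2)}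
      rw [this]
      refine MeasurableSet.iInter fun j => measurableSet_le
        (Finset.measurable_sum _ fun i _ => ((hdot i).pow_const 2).mul ?_) ?_
      · exact ((measurable_pi_apply j).comp (measurable_fst.comp (hw i))).pow_const 2
      · exact ((((hND.const_mul K).mul_const K).pow_const 2).const_mul _).const_mul _
  have hle := IndepFun.measureReal_le_of_forall
    (measurable_pi_iff.2 fun i : {i // i ∈ s} => hZ i)
    (measurable_pi_iff.2 fun i : {i // i ∈ t} => hZ i) hind hbadm
    (η := 1 / (n : ℝ)) (by positivity) ?_
  · refine le_trans (measureReal_mono fun ω hω => ?_) hle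
    simp only [hbad, Set.mem_compl_iff, Set.mem_ofPred_eq] at hω ⊢
    rw [← hv ω]
    have hquart : ∀ j, ∑ i : {i // i ∈ s}, (v ω ⬝ᵥ S.X i ω) ^ 2 * S.X i ω j ^ 2 =
        ∑ i ∈ s, (v ω ⬝ᵥ S.X i ω) ^ 2 * S.X i ω j ^ 2 := fun j =>
      Finset.sum_coe_sort s fun i => (v ω ⬝ᵥ S.X i ω) ^ 2 * S.X i ω j ^ 2
    simpa only [Finset.sum_coe_sort s fun i => (v ω ⬝ᵥ S.X i ω) * S.score (S.X i ω, S.Y i ω),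
      hquart] using hω
  · intro b
    rcases eq_or_ne (D b) 0 with h0 | h0
    · have : {ω | ((fun i : {i // i ∈ s} => (S.X i ω, S.Y i ω)), b) ∈ bad} = ∅ := by
        ext ω
        simp [hbad, h0, hD.norm_zero]
      rw [this]; simp
    · have hsub := hD.subG_dotProduct _ h0
      have hfe : ∫ ω, (D b ⬝ᵥ S.X₀ ω) * S.score (S.X₀ ω, S.Y₀ ω) ∂P = 0 :=
        integral_dotProduct_mul_score_eq_zero h6 hBD (hsub.integrable_mul hD.subG_score)
          hsub.integrable_sq
      have hfm : Measurable fun z : (Fin p → ℝ) × ℝ => D b ⬝ᵥ z.1 := by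
        unfold dotProduct; fun_prop
      have := measureReal_not_fixed_direction_le hZ S.indep S.identDistrib
        (S.measurable_X₀.prodMk S.measurable_Y₀) s (f := fun z => D b ⬝ᵥ z.1) (e := S.score)
        (g := fun j z => z.1 j) hfm hsm (fun j => by fun_prop) hn hr hrn hc hl hnl hpl hsub
        hD.subG_score hD.subG_entry hfe
      refine le_trans (measureReal_mono fun ω hω => ?_) this
      simp only [hbad, Set.mem_compl_iff, Set.mem_ofPred_eq] at hω ⊢
      have hquart : ∀ j, ∑ i : {i // i ∈ s}, (D b ⬝ᵥ S.X i ω) ^ 2 * S.X i ω j ^ 2 =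
          ∑ i ∈ s, (D b ⬝ᵥ S.X i ω) ^ 2 * S.X i ω j ^ 2 := fun j =>
        Finset.sum_coe_sort s fun i => (D b ⬝ᵥ S.X i ω) ^ 2 * S.X i ω j ^ 2
      simpa only [Finset.sum_coe_sort s fun i => (D b ⬝ᵥ S.X i ω) * S.score (S.X i ω, S.Y i ω),
        hquart] using hω

/-- Concentration of the empirical Hessian in direction `M*ξ`, around `H M* ξ = ξ`. -/
lemma SubGaussianDesign.measureReal_hessian_le (hD : S.SubGaussianDesign N K Ka Ke)
    (hBD : S.BoundedDerivatives C₆ C₇) (h6 : 0 < C₆) (hn : 0 < n) (hc : 0 < c)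
    (hlc : S.logpn ≤ c * n) (hH : S.H *ᵥ S.dir = S.ξ) :
    P.real {ω | ¬ ∀ j, |∑ i, ((S.dir ⬝ᵥ S.X i ω) * S.curv (S.X i ω, S.Y i ω) * S.X i ω j - S.ξ j)| ≤
      (8 * √c + 8 / √c) * (C₆ * (Ka * K)) * √(n * S.logpn)} ≤
        p * (2 * Real.exp (-(4 * S.logpn))) := by
  have hZ : ∀ i, Measurable fun ω => (S.X i ω, S.Y i ω) := fun i =>
    (S.measurable_X i).prodMk (S.measurable_Y i)
  have hZ₀ : Measurable fun ω => (S.X₀ ω, S.Y₀ ω) := S.measurable_X₀.prodMk S.measurable_Y₀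
  have hcm := S.measurable_curv
  have hcurv : ∀ᵐ ω ∂P, |S.curv (S.X₀ ω, S.Y₀ ω)| ≤ C₆ := by
    filter_upwards [ae_regular_generic hBD] with ω hω
    rw [curv, abs_of_nonneg (S.φd_two_nonneg _ _)]
    exact hω.1 _
  have hint : ∀ j k, Integrable
      (fun ω => S.curv (S.X₀ ω, S.Y₀ ω) * (S.X₀ ω j * S.X₀ ω k)) P := fun j k =>
    ((hD.subG_entry j).integrable_mul (hD.subG_entry k)).bdd_mul
      (hcm.comp hZ₀).aestronglyMeasurable hcurv
  have hdm : Measurable fun z : (Fin p → ℝ) × ℝ => S.dir ⬝ᵥ z.1 := by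
    unfold dotProduct; fun_prop
  have key : ∀ j, P.real {ω | (8 * √c + 8 / √c) * (C₆ * (Ka * K)) * √(n * S.logpn) <
      |∑ i, ((S.dir ⬝ᵥ S.X i ω) * S.curv (S.X i ω, S.Y i ω) * S.X i ω j - S.ξ j)|} ≤
        2 * Real.exp (-(4 * S.logpn)) := by
    intro j
    have hfm : Measurable fun z : (Fin p → ℝ) × ℝ => (S.dir ⬝ᵥ z.1) * S.curv z * z.1 j :=
      (hdm.mul hcm).mul (by fun_prop)
    obtain ⟨i1, b1⟩ := hD.subG_dir.exp_mul_le (hD.subG_entry j)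
      (w := fun ω => (S.dir ⬝ᵥ S.X₀ ω) * S.curv (S.X₀ ω, S.Y₀ ω) * S.X₀ ω j)
      (hfm.comp hZ₀) h6 (by
        filter_upwards [hcurv] with ω hω
        calc |(S.dir ⬝ᵥ S.X₀ ω) * S.curv (S.X₀ ω, S.Y₀ ω) * S.X₀ ω j|
            = |S.curv (S.X₀ ω, S.Y₀ ω)| * |(S.dir ⬝ᵥ S.X₀ ω) * S.X₀ ω j| := by
              rw [← abs_mul]; congr 1; ring
          _ ≤ _ := by gcongr)
    have hK := (hD.subG_entry j).pos
    have hKa := hD.subG_dir.pos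
    have u := bernstein hZ S.indep S.identDistrib hZ₀ Finset.univ
      (f := fun z => (S.dir ⬝ᵥ z.1) * S.curv z * z.1 j) hfm (by positivity) hc hn S.logpn_nonneg hlc
      i1 b1
    simp only [integral_dotProduct_mul_curv hint, hH] at u
    refine le_trans (measureReal_mono ?_) u
    intro ω hω
    simp only [Set.mem_ofPred_eq] at hω ⊢
    exact hω.le
  have hU : {ω | ¬ ∀ j, |∑ i, ((S.dir ⬝ᵥ S.X i ω) * S.curv (S.X i ω, S.Y i ω) * S.X i ω j - S.ξ j)| ≤
      (8 * √c + 8 / √c) * (C₆ * (Ka * K)) * √(n * S.logpn)} =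
      ⋃ j ∈ (Finset.univ : Finset (Fin p)), {ω |
        (8 * √c + 8 / √c) * (C₆ * (Ka * K)) * √(n * S.logpn) <
        |∑ i, ((S.dir ⬝ᵥ S.X i ω) * S.curv (S.X i ω, S.Y i ω) * S.X i ω j - S.ξ j)|} := by
    ext ω; simp
  rw [hU]
  calc _ ≤ ∑ j : Fin p, _ := measureReal_biUnion_finset_le _ _
    _ ≤ ∑ _j : Fin p, 2 * Real.exp (-(4 * S.logpn)) := Finset.sum_le_sum fun j _ => key j
    _ = _ := by simp

/-- The good event fails with probability at most `δ₁ + 4 / n`. -/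
lemma SubGaussianDesign.le_measureReal_goodEvent {δ₁ : ℝ} (hD : S.SubGaussianDesign N K Ka Ke)
    (hBD : S.BoundedDerivatives C₆ C₇) (hI : S.InitialRate C₁ δ₁) (h6 : 0 < C₆) (hn : 5 ≤ n)
    (hr : 0 < r) (hrn : r ^ 3 = n) (hc : 0 < c) (hl : S.logpn ≤ c * r ^ 2)
    (hH : S.H *ᵥ S.dir = S.ξ) :
    1 - δ₁ - 4 / (n : ℝ) ≤ P.real {ω | S.GoodEvent N c C₁ C₆ C₇ K Ka Ke r ω} := by
  have hn5 : (5 : ℝ) ≤ n := by exact_mod_cast hn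
  have hn' : (0 : ℝ) < n := by linarith
  have hZ : ∀ i, Measurable fun ω => (S.X i ω, S.Y i ω) := fun i =>
    (S.measurable_X i).prodMk (S.measurable_Y i)
  have hZ₀ : Measurable fun ω => (S.X₀ ω, S.Y₀ ω) := S.measurable_X₀.prodMk S.measurable_Y₀
  have hr1 : 1 ≤ r := by
    by_contra hlt
    push Not at hlt
    have := pow_lt_one₀ hr.le hlt (n := 3) (by norm_num)
    linarith
  have hlc : S.logpn ≤ c * n := by
    rw [← hrn]
    have : r ^ 2 ≤ r ^ 3 := pow_le_pow_right₀ hr1 (by norm_num)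
    nlinarith
  have hmaxpos : (0 : ℝ) < ((max p n : ℕ) : ℝ) := by
    have : 0 < max p n := lt_of_lt_of_le (by omega) (le_max_right p n)
    exact_mod_cast this
  have hexpl : Real.exp S.logpn = ((max p n : ℕ) : ℝ) := Real.exp_log hmaxpos
  have hpl : (p : ℝ) ≤ Real.exp S.logpn := by rw [hexpl]; exact_mod_cast le_max_left p n
  have hnle : (n : ℝ) ≤ Real.exp S.logpn := by rw [hexpl]; exact_mod_cast le_max_right p n
  have hnl : Real.log n ≤ S.logpn := (Real.log_le_iff_le_exp hn').2 hnle
  have hdm : Measurable fun z : (Fin p → ℝ) × ℝ => S.dir ⬝ᵥ z.1 := by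
    unfold dotProduct; fun_prop
  have u1 := measureReal_exists_abs_gt_le S.identDistrib (f := fun z => S.dir ⬝ᵥ z.1) hdm
    (by omega) hD.subG_dir
  have u2 := measureReal_exists_abs_gt_le S.identDistrib (f := S.score) S.measurable_score
    (by omega) hD.subG_score
  have u3 := hD.measureReal_hessian_le hBD h6 (by omega) hc hlc hH
  have u4 := hD.measureReal_not_direction_le hBD h6.le hn hr hrn hc hl hnl hpl
    (disjoint_compl_right (a := S.J)) (measurable_mulVec_sub S.measurable_estJc S.Mstar S.ξ)
    (v := S.dirJ) fun ω => rfl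
  have u5 := hD.measureReal_not_direction_le hBD h6.le hn hr hrn hc hl hnl hpl
    (disjoint_compl_left (a := S.J)) (measurable_mulVec_sub S.measurable_estJ S.Mstar S.ξ)
    (v := S.dirJc) fun ω => rfl
  have u6 := measureReal_sum_sq_mul_sq_deviation_le hZ S.indep S.identDistrib hZ₀
    (f := fun z => S.dir ⬝ᵥ z.1) (g := S.score) hdm S.measurable_score (by omega) hr hrn
    hD.subG_dir hD.subG_score
  have u7 : P.real {ω | ¬ ∀ i, S.Regular C₆ C₇ (S.X i ω, S.Y i ω)} = 0 := by
    rw [measureReal_eq_zero_iff]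
    exact ae_iff.1 (ae_regular hBD)
  have u3' : (p : ℝ) * (2 * Real.exp (-(4 * S.logpn))) ≤ 2 / (n : ℝ) ^ 3 := by
    have e : Real.exp (-(4 * S.logpn)) = (1 / Real.exp S.logpn) * (1 / Real.exp S.logpn ^ 3) := by
      rw [← Real.exp_nat_mul, Real.exp_neg,
        show 4 * S.logpn = S.logpn + ((3 : ℕ) : ℝ) * S.logpn by push_cast; ring, Real.exp_add]
      field_simp
    calc (p : ℝ) * (2 * Real.exp (-(4 * S.logpn)))
        ≤ Real.exp S.logpn * (2 * ((1 / Real.exp S.logpn) * (1 / Real.exp S.logpn ^ 3))) := by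
          rw [e]; gcongr
      _ = 2 / Real.exp S.logpn ^ 3 := by field_simp
      _ ≤ _ := by gcongr
  rw [InitialRate] at hI
  set G := {ω | S.GoodEvent N c C₁ C₆ C₇ K Ka Ke r ω}
  set b1 := {ω | ∃ i, 2 * Ka * √(Real.log n) < |S.dir ⬝ᵥ S.X i ω|} with hb1
  set b2 := {ω | ∃ i, 2 * Ke * √(Real.log n) < |S.score (S.X i ω, S.Y i ω)|} with hb2
  set b3 := {ω | ¬ ∀ j, |∑ i, ((S.dir ⬝ᵥ S.X i ω) * S.curv (S.X i ω, S.Y i ω) * S.X i ω j - S.ξ j)| ≤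
      (8 * √c + 8 / √c) * (C₆ * (Ka * K)) * √(n * S.logpn)} with hb3
  set b4 := {ω | ¬ (|∑ i ∈ S.J, (S.dirJ ω ⬝ᵥ S.X i ω) * S.score (S.X i ω, S.Y i ω)| ≤
        (8 * √c + 8 / √c) * (K * N (S.dirJ ω) * Ke) * √(n * S.logpn) ∧
      ∀ j, ∑ i ∈ S.J, (S.dirJ ω ⬝ᵥ S.X i ω) ^ 2 * S.X i ω j ^ 2 ≤
        n * ((32 + 96 * c) * (K * N (S.dirJ ω) * K) ^ 2))} with hb4
  set b5 := {ω | ¬ (|∑ i ∈ S.Jᶜ, (S.dirJc ω ⬝ᵥ S.X i ω) * S.score (S.X i ω, S.Y i ω)| ≤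
        (8 * √c + 8 / √c) * (K * N (S.dirJc ω) * Ke) * √(n * S.logpn) ∧
      ∀ j, ∑ i ∈ S.Jᶜ, (S.dirJc ω ⬝ᵥ S.X i ω) ^ 2 * S.X i ω j ^ 2 ≤
        n * ((32 + 96 * c) * (K * N (S.dirJc ω) * K) ^ 2))} with hb5
  set b6 := {ω | (∀ i, |S.dir ⬝ᵥ S.X i ω| ≤ 2 * Ka * √(Real.log n)) ∧
      (∀ i, |S.score (S.X i ω, S.Y i ω)| ≤ 2 * Ke * √(Real.log n)) ∧
      4032 * n / r < |∑ i, ((S.dir ⬝ᵥ S.X i ω) / Ka) ^ 2 * (S.score (S.X i ω, S.Y i ω) / Ke) ^ 2 -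
        n * ∫ ω', ((S.dir ⬝ᵥ S.X₀ ω') / Ka) ^ 2 * (S.score (S.X₀ ω', S.Y₀ ω') / Ke) ^ 2 ∂P|}
    with hb6
  set b7 := {ω | ¬ ∀ i, S.Regular C₆ C₇ (S.X i ω, S.Y i ω)} with hb7
  have hsub := measureReal_mono (μ := P) (s₁ := {ω |
    l1Norm (S.βhat ω - S.βbar) ≤ C₁ * S.s₀ * Real.sqrt (S.logpn / n) ∧
    1 / (n : ℝ) * ∑ i, (S.X i ω ⬝ᵥ S.βhat ω - S.X i ω ⬝ᵥ S.βbar) ^ 2 ≤ C₁ * S.s₀ * (S.logpn / n)})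
    (s₂ := G ∪ (b1 ∪ (b2 ∪ (b3 ∪ (b4 ∪ (b5 ∪ (b6 ∪ b7))))))) (by
      rintro ω ⟨hω1, hω2⟩
      by_contra hcon
      simp only [Set.mem_union, not_or] at hcon
      obtain ⟨g, g1, g2, g3, g4, g5, g6, g7⟩ := hcon
      simp only [hb1, hb2, Set.mem_ofPred_eq, not_exists, not_lt] at g1 g2
      simp only [hb3, hb4, hb5, hb7, Set.mem_ofPred_eq, not_not] at g3 g4 g5 g7
      refine g ⟨g7, hω1, hω2, g1, g2, g3, g4.1, g4.2, g5.1, g5.2, ?_⟩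
      by_contra hlt
      exact g6 ⟨g1, g2, not_le.1 hlt⟩)
  have k0 := measureReal_union_le (μ := P) G (b1 ∪ (b2 ∪ (b3 ∪ (b4 ∪ (b5 ∪ (b6 ∪ b7))))))
  have k1 := measureReal_union_le (μ := P) b1 (b2 ∪ (b3 ∪ (b4 ∪ (b5 ∪ (b6 ∪ b7)))))
  have k2 := measureReal_union_le (μ := P) b2 (b3 ∪ (b4 ∪ (b5 ∪ (b6 ∪ b7))))
  have k3 := measureReal_union_le (μ := P) b3 (b4 ∪ (b5 ∪ (b6 ∪ b7)))
  have k4 := measureReal_union_le (μ := P) b4 (b5 ∪ (b6 ∪ b7))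
  have k5 := measureReal_union_le (μ := P) b5 (b6 ∪ b7)
  have k6 := measureReal_union_le (μ := P) b6 b7
  have hbudget : 2 / (n : ℝ) ^ 3 + 2 / (n : ℝ) ^ 3 + 2 / (n : ℝ) ^ 3 + 1 / (n : ℝ) + 1 / (n : ℝ) +
      2 / (n : ℝ) ^ 2 ≤ 4 / (n : ℝ) := by
    have e : 4 / (n : ℝ) - (2 / (n : ℝ) ^ 3 + 2 / (n : ℝ) ^ 3 + 2 / (n : ℝ) ^ 3 + 1 / (n : ℝ) +
        1 / (n : ℝ) + 2 / (n : ℝ) ^ 2) = (2 * (n : ℝ) ^ 2 - 2 * n - 6) / (n : ℝ) ^ 3 := by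
      field_simp; ring
    have : 0 ≤ (2 * (n : ℝ) ^ 2 - 2 * n - 6) / (n : ℝ) ^ 3 :=
      div_nonneg (by nlinarith) (by positivity)
    linarith
  linarith

end Setting

namespace Setting

/-! ### Sub-Gaussian designs in the two norms -/

variable {Ω : Type*} [MeasurableSpace Ω] {P : Measure Ω} {n p : ℕ} {S : Setting Ω P n p}

/-- Jensen's inequality: a linear combination of entries that are sub-Gaussian at scale `K` is
sub-Gaussian at scale `K ‖v‖₁`, whatever the dependence between the entries. -/
lemma subG_dotProduct_of_entries {K : ℝ} (h : ∀ j, SubG P (fun ω => S.X₀ ω j) K)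
    {v : Fin p → ℝ} (hv : v ≠ 0) : SubG P (fun ω => v ⬝ᵥ S.X₀ ω) (K * l1Norm v) := by
  have hl := l1Norm_pos hv
  have hK : 0 < K := by
    have := S.p_ne_zero
    exact (h 0).pos
  have hX := S.measurable_X₀
  have hm : Measurable fun ω => v ⬝ᵥ S.X₀ ω := by unfold dotProduct; fun_prop
  have hw1 : ∑ j, |v j| / l1Norm v = 1 := by
    rw [← Finset.sum_div, ← l1Norm, div_self hl.ne']
  have hle : ∀ ω, Real.exp ((v ⬝ᵥ S.X₀ ω / (K * l1Norm v)) ^ 2) ≤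
      ∑ j, |v j| / l1Norm v * Real.exp ((S.X₀ ω j / K) ^ 2) := fun ω => by
    have h1 := convexOn_exp.map_sum_le (t := Finset.univ) (w := fun j => |v j| / l1Norm v)
      (p := fun j => (S.X₀ ω j / K) ^ 2) (fun j _ => by positivity) hw1 fun j _ => Set.mem_univ _
    simp only [smul_eq_mul] at h1
    refine le_trans (Real.exp_le_exp.2 ?_) h1
    have h2 := sq_dotProduct_le v (S.X₀ ω)
    rw [div_pow, div_le_iff₀ (by positivity)]
    refine h2.trans (le_of_eq ?_)
    rw [Finset.sum_mul, Finset.mul_sum]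
    refine Finset.sum_congr rfl fun j _ => ?_
    field_simp
  have hi : Integrable (fun ω => ∑ j, |v j| / l1Norm v * Real.exp ((S.X₀ ω j / K) ^ 2)) P :=
    integrable_finsetSum _ fun j _ => (h j).integrable.const_mul _
  have hi' : Integrable (fun ω => Real.exp ((v ⬝ᵥ S.X₀ ω / (K * l1Norm v)) ^ 2)) P :=
    hi.mono' (Measurable.aestronglyMeasurable (by fun_prop)) (Filter.Eventually.of_forall fun ω => by
      rw [Real.norm_eq_abs, abs_of_pos (Real.exp_pos _)]; exact hle ω)
  refine ⟨by positivity, hm, hi', (integral_mono hi' hi hle).trans ?_⟩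
  rw [integral_finsetSum _ fun j _ => (h j).integrable.const_mul _]
  simp only [integral_const_mul]
  calc _ ≤ ∑ j, |v j| / l1Norm v * 2 := Finset.sum_le_sum fun j _ =>
        mul_le_mul_of_nonneg_left (h j).integral_le (by positivity)
    _ = 2 := by rw [← Finset.sum_mul, hw1, one_mul]

lemma measurable_dotProduct_X₀ (v : Fin p → ℝ) : Measurable fun ω => v ⬝ᵥ S.X₀ ω := by
  have hX := S.measurable_X₀
  unfold dotProduct; fun_prop

lemma subG_dotProduct_of_vector {σ : ℝ} (hσ : 0 < σ) (h : S.SubGaussianVector σ)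
    {v : Fin p → ℝ} (hv : v ≠ 0) : SubG P (fun ω => v ⬝ᵥ S.X₀ ω) (2 * σ * l2Norm v) := by
  have hl := l2Norm_pos hv
  have h1 : psi2Norm P (fun ω => (v ⬝ᵥ S.X₀ ω) / l2Norm v) ≤ ENNReal.ofReal σ :=
    le_trans (le_iSup₂ (f := fun (s : Fin p → ℝ) (_ : s ≠ 0) =>
      psi2Norm P (fun ω => (s ⬝ᵥ S.X₀ ω) / l2Norm s)) v hv) h
  have h2 := (subG_of_psi2Norm_le hσ ((S.measurable_dotProduct_X₀ v).div_const _) h1).const_mul hl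
  have e : (fun ω => l2Norm v * (v ⬝ᵥ S.X₀ ω / l2Norm v)) = fun ω => v ⬝ᵥ S.X₀ ω := by
    funext ω; field_simp
  rw [e, mul_comm] at h2
  exact h2

lemma subG_score {C₅ σ : ℝ} (hσ : 0 < σ) (h : S.ScoreAssumption C₅ σ) :
    SubG P (fun ω => S.score (S.X₀ ω, S.Y₀ ω)) (2 * σ) :=
  subG_of_psi2Norm_le hσ (S.measurable_score.comp (S.measurable_X₀.prodMk S.measurable_Y₀)) h.1

lemma dir_ne_zero {C₃ C₄ : ℝ} (hC₃ : 0 < C₃) (hE : S.EigenvalueBounds C₃ C₄) : S.dir ≠ 0 := by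
  intro h
  have := H_mulVec_Mstar_mulVec hC₃ hE
  rw [← dir, h, mulVec_zero] at this
  exact S.ξ_ne_zero this.symm

lemma subGaussianDesign_l1Norm {C₃ C₄ C₅ σ₁ σ₂ : ℝ} (hC₃ : 0 < C₃) (hC₄ : 0 < C₄) (hσ₁ : 0 < σ₁)
    (hσ₂ : 0 < σ₂) (hE : S.EigenvalueBounds C₃ C₄) (hR : S.ScoreAssumption C₅ σ₂)
    (h : S.SubGaussianEntries σ₁) :
    S.SubGaussianDesign l1Norm (2 * σ₁) (2 * σ₁ * C₄ * l2Norm S.ξ) (2 * σ₂) := by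
  have hX := S.measurable_X₀
  have he : ∀ j, SubG P (fun ω => S.X₀ ω j) (2 * σ₁) := fun j =>
    subG_of_psi2Norm_le hσ₁ (by fun_prop) (h.1 j)
  have hd := l2Norm_pos (dir_ne_zero hC₃ hE)
  refine ⟨by unfold l1Norm; fun_prop, by simp [l1Norm], l1Norm_nonneg,
    fun v hv => subG_dotProduct_of_entries he hv, he, ?_, subG_score hσ₂ hR⟩
  have h2 := h.2
  simp only [dotProduct_mulVec_of_transpose S.Mstar_transpose] at h2
  refine (subG_of_psi2Norm_le (mul_pos hσ₁ hd) (S.measurable_dotProduct_X₀ _) h2).mono ?_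
  have := l2Norm_Mstar_mulVec_le hC₃ hC₄.le hE
  rw [← mul_assoc, mul_assoc (2 * σ₁) C₄]
  exact mul_le_mul_of_nonneg_left this (by positivity)

lemma subGaussianDesign_l2Norm {C₃ C₄ C₅ σ₁ σ₂ : ℝ} (hC₃ : 0 < C₃) (hC₄ : 0 < C₄) (hσ₁ : 0 < σ₁)
    (hσ₂ : 0 < σ₂) (hE : S.EigenvalueBounds C₃ C₄) (hR : S.ScoreAssumption C₅ σ₂)
    (h : S.SubGaussianVector σ₁) :
    S.SubGaussianDesign l2Norm (2 * σ₁) (2 * σ₁ * C₄ * l2Norm S.ξ) (2 * σ₂) := by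
  refine ⟨by unfold l2Norm; fun_prop, by simp [l2Norm], l2Norm_nonneg,
    fun v hv => subG_dotProduct_of_vector hσ₁ h hv, fun j => ?_, ?_, subG_score hσ₂ hR⟩
  · have h1 : (Pi.single j 1 : Fin p → ℝ) ≠ 0 := by simp
    have h2 := subG_dotProduct_of_vector hσ₁ h h1
    have h3 : l2Norm (Pi.single j 1 : Fin p → ℝ) = 1 := by
      have h4 := l2Norm_sq (Pi.single j 1 : Fin p → ℝ)
      simp only [single_dotProduct, Pi.single_eq_same, mul_one] at h4
      exact (pow_eq_one_iff_of_nonneg (l2Norm_nonneg _) two_ne_zero).1 h4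
    simpa [h3, single_dotProduct] using h2
  · refine (subG_dotProduct_of_vector hσ₁ h (dir_ne_zero hC₃ hE)).mono ?_
    have := l2Norm_Mstar_mulVec_le hC₃ hC₄.le hE
    rw [mul_assoc (2 * σ₁) C₄]
    exact mul_le_mul_of_nonneg_left this (by positivity)

/-! ### The remainder bounds -/

/-- The constant of the remainder bounds: one plus the sum of the constants of the individual terms.
Here `cV ‖ξ‖₂²` bounds the asymptotic variance from below. -/
noncomputable def remainderConst (c C₁ C₄ C₆ K Ke cV : ℝ) : ℝ :=
  1 + (8 * √c + 8 / √c) * (C₆ * (K * C₄ * K)) * C₁ / √cV +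
    (8 * √c + 8 / √c) * (K * Ke) / √cV + C₆ * √C₁ / √cV + 2 * (K * C₄) * C₁ / √cV +
    4032 * (K * C₄ * Ke) ^ 2 / cV +
    8 * (K * C₄) * C₆ * √4036 * (K * C₄ * Ke) * √C₁ / cV +
    8 * (K * C₄) ^ 2 * C₆ ^ 2 * C₁ / cV +
    4 * Ke * √4036 * (K * C₄ * Ke) / cV + 12 * Ke ^ 2 / cV +
    4 * C₆ ^ 2 * ((32 + 96 * c) * K ^ 4) * C₁ ^ 2 / cV

/-- The rate condition in terms of `r = n^(1/3)`. -/
lemma logpn_le_of_div_sqrt_le {c : ℝ} (hn : 0 < n)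
    (h : S.logpn / √(n : ℝ) ≤ c * (n : ℝ) ^ (1 / 6 : ℝ)) :
    S.logpn ≤ c * ((n : ℝ) ^ (1 / 3 : ℝ)) ^ 2 := by
  have hn' : (0 : ℝ) < n := by exact_mod_cast hn
  rw [div_le_iff₀ (Real.sqrt_pos.2 hn'), mul_assoc, Real.sqrt_eq_rpow, ← Real.rpow_add hn'] at h
  rw [← Real.rpow_natCast, ← Real.rpow_mul hn'.le]
  norm_num at h ⊢
  exact h

variable [IsProbabilityMeasure P]

/-- Both remainder bounds hold with probability `1 - δ₁ - 4 / n`, in any norm `N` adapted to the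
design. -/
lemma SubGaussianDesign.le_measureReal_bounds {N : (Fin p → ℝ) → ℝ}
    {c C₁ C₃ C₄ C₅ C₆ C₇ σ₁ σ₂ δ₁ : ℝ} (hC₁ : 0 < C₁) (hC₃ : 0 < C₃) (hC₄ : 0 < C₄) (hC₅ : 0 < C₅)
    (hC₆ : 0 < C₆) (hC₇ : 0 ≤ C₇) (hσ₁ : 0 < σ₁) (hσ₂ : 0 < σ₂) (hc : 0 < c)
    (hD : S.SubGaussianDesign N (2 * σ₁) (2 * σ₁ * C₄ * l2Norm S.ξ) (2 * σ₂))
    (hI : S.InitialRate C₁ δ₁) (hE : S.EigenvalueBounds C₃ C₄) (hR : S.ScoreAssumption C₅ σ₂)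
    (hBD : S.BoundedDerivatives C₆ C₇) (hn : 5 ≤ n)
    (hl : S.logpn ≤ c * ((n : ℝ) ^ (1 / 3 : ℝ)) ^ 2) {C : ℝ}
    (hC : C = remainderConst c C₁ C₄ C₆ (2 * σ₁) (2 * σ₂) (C₅ * C₃)) :
    1 - δ₁ - 4 / (n : ℝ) ≤ P.real {ω |
      |S.Δ₁ ω| ≤ C * (S.s₀ * (S.logpn / √(n : ℝ))
        + √S.logpn * ((N (S.dirJc ω) + N (S.dirJ ω)) / l2Norm S.ξ)
        + (√(S.Q₁ ω) + √(S.Q₁' ω)) / l2Norm S.ξ * √(S.s₀ * S.logpn)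
        + C₇ * S.s₀ * (S.logpn * √(Real.log n) / √(n : ℝ))) ∧
      |S.Δ₂ ω| ≤ C * ((n : ℝ) ^ (-(1 / 3) : ℝ)
        + √S.s₀ * √(Real.log n * S.logpn / n)
        + S.s₀ * (S.logpn * Real.log n / n)
        + √(Real.log n) * (√(S.Q₁ ω) + √(S.Q₁' ω)) / l2Norm S.ξ
        + S.s₀ ^ 2 * (S.logpn * √(Real.log n) / n)
            * ((N (S.dirJc ω) + N (S.dirJ ω)) / l2Norm S.ξ)
        + (S.Q₁ ω + S.Q₁' ω) * Real.log n / l2Norm S.ξ ^ 2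
        + S.s₀ ^ 2 * (S.logpn / n)
            * ((N (S.dirJc ω) ^ 2 + N (S.dirJ ω) ^ 2) / l2Norm S.ξ ^ 2))} := by
  have hn5 : (5 : ℝ) ≤ n := by exact_mod_cast hn
  have hn' : (0 : ℝ) < n := by linarith
  have hx := l2Norm_pos S.ξ_ne_zero
  have hL := S.logpn_nonneg
  have hs := S.s₀_nonneg
  have hlog : 0 ≤ Real.log n := Real.log_natCast_nonneg _
  set r : ℝ := (n : ℝ) ^ (1 / 3 : ℝ) with hr
  have hr0 : 0 < r := Real.rpow_pos_of_pos hn' _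
  have hr3 : r ^ 3 = n := by
    rw [hr, ← Real.rpow_natCast, ← Real.rpow_mul hn'.le]; norm_num
  have hr1 : 1 ≤ r := Real.one_le_rpow (by linarith) (by norm_num)
  have hrinv : (n : ℝ) ^ (-(1 / 3) : ℝ) = r⁻¹ := Real.rpow_neg hn'.le _
  have hmom := hD.subG_dir.sq_mul_sq_moments hD.subG_score
  have hV : C₅ * C₃ * l2Norm S.ξ ^ 2 ≤ S.V := by
    refine le_V hC₅.le hE hR (fun j k => (hD.subG_entry j).integrable_mul (hD.subG_entry k))
      hD.subG_score.integrable_sq hD.subG_dir.integrable_sq ?_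
    refine (hmom.1.1.const_mul ((2 * σ₁ * C₄ * l2Norm S.ξ) ^ 2 * (2 * σ₂) ^ 2)).congr
      (Filter.Eventually.of_forall fun ω => ?_)
    simp only [dir]
    field_simp
  have hgood := hD.le_measureReal_goodEvent hBD hI hC₆ hn hr0 hr3 hc hl
    (H_mulVec_Mstar_mulVec hC₃ hE)
  refine hgood.trans (measureReal_mono fun ω hω => ?_)
  have hω' : S.GoodEvent N c C₁ C₆ C₇ (2 * σ₁) (2 * σ₁ * C₄ * l2Norm S.ξ) (2 * σ₂) r ω := hω
  have b1 := hω'.abs_Δ₁_le (by omega) hC₁.le hC₄.le hC₆.le hC₇ (by positivity) hx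
    (mul_pos hC₅ hC₃) hV
  have b2 := hω'.abs_Δ₂_le (by omega) hc hC₁.le hC₄ hC₆.le (by positivity) (by positivity) hx
    (mul_pos hC₅ hC₃) hV hr1 hmom.1.2
  have hcV : 0 < C₅ * C₃ := mul_pos hC₅ hC₃
  have hQ := S.Q₁_nonneg ω
  have hQ' := S.Q₁'_nonneg ω
  have hN := hD.norm_nonneg (S.dirJ ω)
  have hN' := hD.norm_nonneg (S.dirJc ω)
  rw [remainderConst] at hC
  generalize hk1 : (8 * √c + 8 / √c) * (C₆ * (2 * σ₁ * C₄ * (2 * σ₁))) * C₁ / √(C₅ * C₃) = k1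
    at b1 hC
  generalize hk2 : (8 * √c + 8 / √c) * (2 * σ₁ * (2 * σ₂)) / √(C₅ * C₃) = k2 at b1 hC
  generalize hk3 : C₆ * √C₁ / √(C₅ * C₃) = k3 at b1 hC
  generalize hk4 : 2 * (2 * σ₁ * C₄) * C₁ / √(C₅ * C₃) = k4 at b1 hC
  generalize hk5 : 4032 * (2 * σ₁ * C₄ * (2 * σ₂)) ^ 2 / (C₅ * C₃) = k5 at b2 hC
  generalize hk6 : 8 * (2 * σ₁ * C₄) * C₆ * √4036 * (2 * σ₁ * C₄ * (2 * σ₂)) * √C₁ / (C₅ * C₃) = k6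
    at b2 hC
  generalize hk7 : 8 * (2 * σ₁ * C₄) ^ 2 * C₆ ^ 2 * C₁ / (C₅ * C₃) = k7 at b2 hC
  generalize hk8 : 4 * (2 * σ₂) * √4036 * (2 * σ₁ * C₄ * (2 * σ₂)) / (C₅ * C₃) = k8 at b2 hC
  generalize hk9 : 12 * (2 * σ₂) ^ 2 / (C₅ * C₃) = k9 at b2 hC
  generalize hk10 : 4 * C₆ ^ 2 * ((32 + 96 * c) * (2 * σ₁) ^ 4) * C₁ ^ 2 / (C₅ * C₃) = k10 at b2 hC
  have p1 : 0 ≤ k1 := by rw [← hk1]; positivity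
  have p2 : 0 ≤ k2 := by rw [← hk2]; positivity
  have p3 : 0 ≤ k3 := by rw [← hk3]; positivity
  have p4 : 0 ≤ k4 := by rw [← hk4]; positivity
  have p5 : 0 ≤ k5 := by rw [← hk5]; positivity
  have p6 : 0 ≤ k6 := by rw [← hk6]; positivity
  have p7 : 0 ≤ k7 := by rw [← hk7]; positivity
  have p8 : 0 ≤ k8 := by rw [← hk8]; positivity
  have p9 : 0 ≤ k9 := by rw [← hk9]; positivity
  have p10 : 0 ≤ k10 := by rw [← hk10]; positivity
  constructor
  · refine b1.trans ?_
    simp only [mul_add C]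
    gcongr <;> linarith
  · refine b2.trans ?_
    rw [hrinv]
    have hcross : 0 ≤ C * (S.s₀ ^ 2 * (S.logpn * √(Real.log n) / n)
        * ((N (S.dirJc ω) + N (S.dirJ ω)) / l2Norm S.ξ)) := by
      have : 0 ≤ C := by linarith
      positivity
    simp only [mul_add C]
    refine le_trans ?_ (add_le_add (add_le_add (le_add_of_nonneg_right hcross) le_rfl) le_rfl)
    gcongr <;> linarith

end Setting

end DebiasedGLM

theorem theorem7
    (c_half c_twothirds c_one : ℝ)
    (hc_half : 0 < c_half) (hc_twothirds : 0 < c_twothirds) (hc_one : 0 < c_one)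
    (C₁ C₃ C₄ C₅ C₆ σ₁ σ₂ ρ : ℝ)
    (hC₁ : 0 < C₁) (hC₃ : 0 < C₃) (hC₄ : 0 < C₄) (hC₅ : 0 < C₅) (hC₆ : 0 < C₆)
    (hσ₁ : 0 < σ₁) (hσ₂ : 0 < σ₂) (hρ₀ : 0 < ρ) (hρ₁ : ρ < 1) :
    ∃ C : ℝ, 0 < C ∧
      ∀ (Ω : Type*) [MeasurableSpace Ω] (P : Measure Ω) [IsProbabilityMeasure P]
        (n p : ℕ) (S : Setting Ω P n p) (C₇ δ₁ : ℝ), 0 ≤ C₇ →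
        S.SplitRatio ρ →
        S.InitialRate C₁ δ₁ →
        S.EigenvalueBounds C₃ C₄ →
        S.ScoreAssumption C₅ σ₂ →
        S.BoundedDerivatives C₆ C₇ →
        -- part (i)
        (S.SubGaussianEntries σ₁ →
          S.logpn / √(n : ℝ) ≤
            min (c_one * ρ * √(n : ℝ) / 2) (c_twothirds * (n : ℝ) ^ (1 / 6 : ℝ) / 4) →
          1 - δ₁ - 4 / (n : ℝ) - 8 / ((max p n : ℕ) : ℝ)
              - 2 * Real.exp (-(c_half * (n : ℝ) ^ (1 / 3 : ℝ)))
              - 4 * Real.exp (-(1 / 2 * √(n : ℝ))) ≤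
            P.real {ω |
              |S.Δ₁ ω| ≤ C * (S.s₀ * (S.logpn / √(n : ℝ))
                + √S.logpn * ((S.L₁ ω + S.L₁' ω) / l2Norm S.ξ)
                + (√(S.Q₁ ω) + √(S.Q₁' ω)) / l2Norm S.ξ * √(S.s₀ * S.logpn)
                + C₇ * S.s₀ * (S.logpn * √(Real.log n) / √(n : ℝ))) ∧
              |S.Δ₂ ω| ≤ C * ((n : ℝ) ^ (-(1 / 3) : ℝ)
                + √S.s₀ * √(Real.log n * S.logpn / n)
                + S.s₀ * (S.logpn * Real.log n / n)
                + √(Real.log n) * (√(S.Q₁ ω) + √(S.Q₁' ω)) / l2Norm S.ξ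
                + S.s₀ ^ 2 * (S.logpn * √(Real.log n) / n)
                    * ((S.L₁ ω + S.L₁' ω) / l2Norm S.ξ)
                + (S.Q₁ ω + S.Q₁' ω) * Real.log n / l2Norm S.ξ ^ 2
                + S.s₀ ^ 2 * (S.logpn / n)
                    * ((S.L₁ ω ^ 2 + S.L₁' ω ^ 2) / l2Norm S.ξ ^ 2))}) ∧
        -- part (ii)
        (S.SubGaussianVector σ₁ →
          S.logpn / √(n : ℝ) ≤
            min (min (c_one * ρ * √(n : ℝ)) (c_one * √(n : ℝ) / 2))
              (c_twothirds * (n : ℝ) ^ (1 / 6 : ℝ) * ρ ^ (2 / 3 : ℝ) / 3) →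
          1 - δ₁ - 8 / (n : ℝ) - 12 / ((max p n : ℕ) : ℝ)
              - 2 * Real.exp (-(c_half * (n : ℝ) ^ (1 / 3 : ℝ)))
              - 4 * Real.exp (-(1 / 2 * √(n : ℝ))) ≤
            P.real {ω |
              |S.Δ₁ ω| ≤ C * (S.s₀ * (S.logpn / √(n : ℝ))
                + √S.logpn * ((S.L₂ ω + S.L₂' ω) / l2Norm S.ξ)
                + (√(S.Q₁ ω) + √(S.Q₁' ω)) / l2Norm S.ξ * √(S.s₀ * S.logpn)
                + C₇ * S.s₀ * (S.logpn * √(Real.log n) / √(n : ℝ))) ∧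
              |S.Δ₂ ω| ≤ C * ((n : ℝ) ^ (-(1 / 3) : ℝ)
                + √S.s₀ * √(Real.log n * S.logpn / n)
                + S.s₀ * (S.logpn * Real.log n / n)
                + √(Real.log n) * (√(S.Q₁ ω) + √(S.Q₁' ω)) / l2Norm S.ξ
                + S.s₀ ^ 2 * (S.logpn * √(Real.log n) / n)
                    * ((S.L₂ ω + S.L₂' ω) / l2Norm S.ξ)
                + (S.Q₁ ω + S.Q₁' ω) * Real.log n / l2Norm S.ξ ^ 2
                + S.s₀ ^ 2 * (S.logpn * √(Real.log n) / n)
                    * ((S.L₂ ω ^ 2 + S.L₂' ω ^ 2) / l2Norm S.ξ ^ 2))}) := by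
  refine ⟨Setting.remainderConst c_twothirds C₁ C₄ C₆ (2 * σ₁) (2 * σ₂) (C₅ * C₃), ?_, ?_⟩
  · unfold Setting.remainderConst
    have : 0 < C₅ * C₃ := mul_pos hC₅ hC₃
    positivity
  intro Ω _ P _ n p S C₇ δ₁ hC₇ hsplit hI hE hR hBD
  have hn0 : 0 < n := by
    rcases Nat.eq_zero_or_pos n with rfl | h
    · have h1 := hsplit.1
      have : S.J.card = 0 := by
        have := S.J.card_le_univ
        simpa using this
      simp [this] at h1
    · exact h
  have hn' : (0 : ℝ) < n := by exact_mod_cast hn0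
  have hδ : 0 ≤ δ₁ := by
    have h1 := hI
    rw [Setting.InitialRate] at h1
    have h2 := h1.trans measureReal_le_one
    linarith
  have e1 : 0 ≤ Real.exp (-(c_half * (n : ℝ) ^ (1 / 3 : ℝ))) := (Real.exp_pos _).le
  have e2 : 0 ≤ Real.exp (-(1 / 2 * √(n : ℝ))) := (Real.exp_pos _).le
  have e3 : (0 : ℝ) ≤ 8 / ((max p n : ℕ) : ℝ) := by positivity
  have e4 : (0 : ℝ) ≤ 12 / ((max p n : ℕ) : ℝ) := by positivity
  have e5 : (8 : ℝ) / n = 4 / n + 4 / n := by ring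
  have e6 : (0 : ℝ) ≤ 4 / n := by positivity
  have h16 : (0 : ℝ) ≤ (n : ℝ) ^ (1 / 6 : ℝ) := by positivity
  -- For `n ≤ 4` the probability bounds are vacuous.
  rcases Nat.lt_or_ge n 5 with hn | hn
  · have h1 : (1 : ℝ) ≤ 4 / n := by
      rw [le_div_iff₀ hn', one_mul]
      exact_mod_cast Nat.lt_succ_iff.1 hn
    exact ⟨fun _ _ => le_trans (by linarith) measureReal_nonneg,
      fun _ _ => le_trans (by linarith) measureReal_nonneg⟩
  refine ⟨fun hX hrate => ?_, fun hX hrate => ?_⟩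
  · have hD := Setting.subGaussianDesign_l1Norm hC₃ hC₄ hσ₁ hσ₂ hE hR hX
    have hl := S.logpn_le_of_div_sqrt_le (c := c_twothirds) hn0 (by
      refine hrate.trans ((min_le_right _ _).trans ?_)
      nlinarith [mul_nonneg hc_twothirds.le h16])
    refine le_trans ?_ (hD.le_measureReal_bounds hC₁ hC₃ hC₄ hC₅ hC₆ hC₇ hσ₁ hσ₂ hc_twothirds hI hE
      hR hBD hn hl rfl)
    linarith
  · have hD := Setting.subGaussianDesign_l2Norm hC₃ hC₄ hσ₁ hσ₂ hE hR hX
    have hρ : ρ ^ (2 / 3 : ℝ) ≤ 1 := Real.rpow_le_one hρ₀.le hρ₁.le (by norm_num)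
    have hl := S.logpn_le_of_div_sqrt_le (c := c_twothirds) hn0 (by
      refine hrate.trans ((min_le_right _ _).trans ?_)
      have h0 := mul_nonneg hc_twothirds.le h16
      have := mul_le_of_le_one_right h0 hρ
      linarith)
    have hb := hD.le_measureReal_bounds hC₁ hC₃ hC₄ hC₅ hC₆ hC₇ hσ₁ hσ₂ hc_twothirds hI hE
      hR hBD hn hl rfl
    refine le_trans ?_ (hb.trans (measureReal_mono fun ω hω => ⟨hω.1, hω.2.trans ?_⟩))
    · linarith
    -- The last term of the second bound only grows by the factor `√(log n) ≥ 1`.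
    have hn5 : (5 : ℝ) ≤ n := by exact_mod_cast hn
    have hlog1 : 1 ≤ √(Real.log n) := by
      rw [Real.one_le_sqrt, Real.le_log_iff_exp_le hn']
      have := Real.exp_one_lt_d9
      linarith
    have hL := S.logpn_nonneg
    have hLle : S.logpn / n ≤ S.logpn * √(Real.log n) / n := by
      gcongr
      exact le_mul_of_one_le_right hL hlog1
    have hRC : 0 ≤ Setting.remainderConst c_twothirds C₁ C₄ C₆ (2 * σ₁) (2 * σ₂) (C₅ * C₃) := by
      unfold Setting.remainderConst
      have : 0 < C₅ * C₃ := mul_pos hC₅ hC₃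
      positivity
    refine mul_le_mul_of_nonneg_left (add_le_add le_rfl ?_) hRC
    refine mul_le_mul (mul_le_mul_of_nonneg_left hLle (sq_nonneg _)) le_rfl ?_ ?_
    · positivity
    · positivity
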